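/- **Setting.** Let $\mathcal G$ be a finite simple graph with maximum degree $d_{\max}\ge 1$ whose nodes $i$ carry identical agents $x_{i,t+1}=Ax_{i,t}+Bu_{i,t}$, with $A\in\mathbb R^{n\times n}$, $B\in\mathbb R^{n\times m}$, $n,m\ge1$ and $(A,B)$ controllable. Let $d=d_{\max}+1$ and choose $d$ nodes of $\mathcal G$, labelled $1,\dots,d$ (the learning agents). Let $Q_1\succ0$, $Q_2\succeq0$, $R\succ0$, with $A\neq0$ or $Q_2\neq0$. Put $\widetilde Q=Q_1+dQ_2$, $\widetilde{\mathbf A}=I_d\otimes A$, $\widetilde{\mathbf B}=I_d\otimes B$, $\widetilde{\mathbf Q}=I_d\otimes\widetilde Q-\mathbb 1\mathbb 1^\top\otimes Q_2$, $\widetilde{\mathbf R}=I_d\otimes R$, and $p=d(n+m)$. **Algorithm (D3PI).** Fix $K_1\in\mathbb R^{m\times n}$ with $A+BK_1$ Schur stable, $L_1=0$, $\tau_1=0$, $\mathbf H_0\in\mathbb R^{p\times p}$, $\beta>0$, initial states of all agents, an exploration signal $e_t$ (an arbitrary sequence of inputs in $\mathbb R^{dm}$, e.g. a realization of Gaussian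 noise), and numbers $T_1,T_2,\dots$ of inner steps. For $z\in\mathbb R^p$ let $q(z)=(z_iz_j)_{i\le j}$, and for $\mathbf H\in\mathbb R^{p\times p}$ let $\mathrm{vech}(\mathbf H)$ be the vector with entries $\mathbf H_{ii}$ and, for $i<j$, $\mathbf H_{ij}+\mathbf H_{ji}$, so that $q(z)^\top\mathrm{vech}(\mathbf H)=z^\top\mathbf Hz$; $\mathrm{vech}^{-1}$ returns a symmetric matrix. Iteration $k=1,2,\dots$ consists of the following two parts. *Subgraph policy evaluation (SPE).* Under $\mathrm{Policy}_k$ a learning agent $i$ uses $u_i=(K_k-L_k)x_i+L_k\sum_{j=1}^d x_j$, so that the stacked input of the learning agents is $\tilde u=\big(I_d\otimes(K_k-L_k)+\mathbb 1\mathbb 1^\top\otimes L_k\big)\tilde x$; any other agent uses $u_i=(K_k-L_k)x_i+\frac{\tau_k}{d-1}L_k\sum_{j\in\mathcal N_i}x_j$. Start from $\theta=\mathrm{vech}(\mathbf H_{k-1})$ and $\mathcal P=\beta I$ and repeat $T_k$ times, along the running trajectory of the network (time $t$ and the states are carried over from one iteration to the next): add $e_t$ to the policy inputs of the learning agents, giving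 their stacked input $\tilde u_t$; let the network make one step; put $z_t=[\tilde x_t;\tilde u_t]$, $z_{t+1}=[\tilde x_{t+1};\tilde u_{t+1}]$ with $\tilde u_{t+1}$ the policy input (without exploration), $\zeta_t=q(z_t)-q(z_{t+1})$, $\mathcal R_t=\tilde x_t^\top\widetilde{\mathbf Q}\tilde x_t+\tilde u_t^\top\widetilde{\mathbf R}\tilde u_t$, and update $$\theta\leftarrow\theta+\frac{\mathcal P\zeta_t(\mathcal R_t-\zeta_t^\top\theta)}{1+\zeta_t^\top\mathcal P\zeta_t},\qquad \mathcal P\leftarrow\mathcal P-\frac{\mathcal P\zeta_t\zeta_t^\top\mathcal P}{1+\zeta_t^\top\mathcal P\zeta_t}.$$ Then set $\mathbf H_k=\mathrm{vech}^{-1}(\theta)$. *Update.* Partition $\mathbf H_k$ into $\mathbf H_{11}$ ($dn\times dn$), $\mathbf H_{21}$ ($dm\times dn$), $\mathbf H_{22}$ ($dm\times dm$), and let $X_1,Y_1,Z_1$ be the blocks in position $(1,1)$, and $X_2,Y_2,Z_2$ those in position $(1,2)$, of $\mathbf H_{11},\mathbf H_{22},\mathbf H_{21}$, respectively, seen as $d\times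 d$ block matrices. Put $\Delta X=X_1-X_2$, $\Delta Y=Y_1-Y_2$, $\Delta Z=Z_1-Z_2$, $F=\big(Y_1-(d-1)Y_2(Y_1+(d-2)Y_2)^{-1}Y_2\big)^{-1}$, $G=(Y_1+(d-1)Y_2)^{-1}Y_2(Y_1-Y_2)^{-1}$ and $$K_{k+1}=-FZ_1+(d-1)GZ_2,\quad L_{k+1}=-FZ_2+GZ_1+(d-2)GZ_2,\quad \Delta K_{k+1}=K_{k+1}-L_{k+1},$$ $$\Xi_{k+1}=\Delta X-\widetilde Q+Q_2+\Delta K_{k+1}^\top\Delta Z+\Delta Z^\top\Delta K_{k+1}+\Delta K_{k+1}^\top(\Delta Y-R)\Delta K_{k+1},$$ $$\gamma_{k+1}=\frac{\sigma_{\min}\big(\Delta K_{k+1}^\top R\,\Delta K_{k+1}+\widetilde Q\big)}{\sigma_{\max}\big(\Xi_{k+1}+L_{k+1}^\top(\Delta Y-R)L_{k+1}\big)},\qquad \tau_{k+1}=\sqrt{\gamma_{k+1}^2/(1+\gamma_{k+1})}.$$ For $\varepsilon>0$, the run is *persistently excited with level $\varepsilon$* if in every iteration $k$ the $T_k$ regression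 vectors of the SPE satisfy $\varepsilon I\preceq\frac1{T_k}\sum_t\zeta_t\zeta_t^\top$. **Theorem.** There are $K^*,L^*\in\mathbb R^{m\times n}$ and $\gamma^*,\tau^*\in\mathbb R$ such that: 1. $\widetilde{\mathbf K}^*=I_d\otimes(K^*-L^*)+\mathbb 1\mathbb 1^\top\otimes L^*$ is the unique optimal gain of the infinite-horizon state-feedback LQR problem with parameters $(\widetilde{\mathbf A},\widetilde{\mathbf B},\widetilde{\mathbf Q},\widetilde{\mathbf R})$: $\widetilde{\mathbf A}+\widetilde{\mathbf B}\widetilde{\mathbf K}^*$ is Schur stable and, from every initial state, $\tilde u_t=\widetilde{\mathbf K}^*\tilde x_t$ minimizes $\sum_{t\ge0}\tilde x_t^\top\widetilde{\mathbf Q}\tilde x_t+\tilde u_t^\top\widetilde{\mathbf R}\tilde u_t$ over all input sequences. 2. For all $\mathbf H_0$, $\beta>0$ and $\varepsilon>0$ there is a $T_0$ such that for all initial states, all exploration signals and all $(T_k)$ with $T_k\ge T_0$ for every $k$: if the run is persistently excited with level $\varepsilon$, then $K_k\to K^*$, $L_k\to L^*$, $\gamma_k\to\gamma^*$ and $\tau_k\to\tau^*$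 as $k\to\infty$. -/

import Mathlib

open Matrix Filter Topology
open scoped Kronecker ENNReal

/-! ### Linear systems and the infinite-horizon LQR problem -/

/-- A real square matrix is Schur stable if all its complex eigenvalues lie in the open unit
disc, i.e. its spectral radius is less than one. -/
def IsSchurStable {ι : Type*} [Fintype ι] [DecidableEq ι] (M : Matrix ι ι ℝ) : Prop :=
  ∀ μ ∈ spectrum ℂ (M.map (algebraMap ℝ ℂ)), ‖μ‖ < 1

/-- Controllability of `(A, B)`: the columns of `B, A B, …, A ^ (n - 1) B` span `ℝⁿ`. -/
def IsControllable {n m : ℕ} (A : Matrix (Fin n) (Fin n) ℝ) (B : Matrix (Fin n) (Fin m) ℝ) :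
    Prop :=
  Submodule.span ℝ (Set.range fun q : Fin n × Fin m => (A ^ (q.1 : ℕ) * B).col q.2) = ⊤

/-- State trajectory of `x (t+1) = A x t + B u t`, `x 0 = x₀`. -/
def lqrState {ι κ : Type*} [Fintype ι] [Fintype κ] (A : Matrix ι ι ℝ) (B : Matrix ι κ ℝ)
    (x₀ : ι → ℝ) (u : ℕ → κ → ℝ) : ℕ → ι → ℝ
  | 0 => x₀
  | t + 1 => A *ᵥ lqrState A B x₀ u t + B *ᵥ u t

/-- The infinite-horizon cost `∑ₜ xₜᵀ Q xₜ + uₜᵀ R uₜ`, with values in `[0, ∞]`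
(for `Q`, `R` positive semidefinite every summand is nonnegative). -/
noncomputable def lqrCost {ι κ : Type*} [Fintype ι] [Fintype κ] (A : Matrix ι ι ℝ)
    (B : Matrix ι κ ℝ) (Q : Matrix ι ι ℝ) (R : Matrix κ κ ℝ) (x₀ : ι → ℝ) (u : ℕ → κ → ℝ) :
    ℝ≥0∞ :=
  ∑' t, ENNReal.ofReal
    (lqrState A B x₀ u t ⬝ᵥ Q *ᵥ lqrState A B x₀ u t + u t ⬝ᵥ R *ᵥ u t)

/-- The input sequence generated by the state feedback `u t = K x t` from `x 0 = x₀`. -/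
def feedbackInput {ι κ : Type*} [Fintype ι] [DecidableEq ι] [Fintype κ] (A : Matrix ι ι ℝ)
    (B : Matrix ι κ ℝ) (K : Matrix κ ι ℝ) (x₀ : ι → ℝ) (t : ℕ) : κ → ℝ :=
  K *ᵥ ((A + B * K) ^ t *ᵥ x₀)

/-- `K` solves the infinite-horizon state-feedback LQR problem with parameters `(A, B, Q, R)`:
it is stabilizing and, from every initial state, the feedback `u = K x` has the least cost among
all input sequences (in particular among all those generated by feedback). -/
def IsOptimalLQRGain {ι κ : Type*} [Fintype ι] [DecidableEq ι] [Fintype κ]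
    (A : Matrix ι ι ℝ) (B : Matrix ι κ ℝ) (Q : Matrix ι ι ℝ) (R : Matrix κ κ ℝ)
    (K : Matrix κ ι ℝ) : Prop :=
  IsSchurStable (A + B * K) ∧
    ∀ (x₀ : ι → ℝ) (u : ℕ → κ → ℝ),
      lqrCost A B Q R x₀ (feedbackInput A B K x₀) ≤ lqrCost A B Q R x₀ u

/-- The patterned block matrix `I_d ⊗ (M - N) + 𝟙 𝟙ᵀ ⊗ N`: diagonal blocks `M`, all other
blocks `N`. -/
def patterned (d : ℕ) {a b : ℕ} (M N : Matrix (Fin a) (Fin b) ℝ) :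
    Matrix (Fin d × Fin a) (Fin d × Fin b) ℝ :=
  (1 : Matrix (Fin d) (Fin d) ℝ) ⊗ₖ (M - N) + (of fun _ _ => (1 : ℝ)) ⊗ₖ N

/-- Largest singular value of a square matrix. -/
noncomputable def sigmaMax {n : ℕ} (M : Matrix (Fin n) (Fin n) ℝ) : ℝ :=
  (Matrix.toEuclideanLin M).singularValues 0

/-- Smallest singular value of an `n × n` matrix, the last of the `n` singular values
in decreasing order. -/
noncomputable def sigmaMin {n : ℕ} (M : Matrix (Fin n) (Fin n) ℝ) : ℝ :=
  (Matrix.toEuclideanLin M).singularValues (n - 1)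

/-! ### The D3PI algorithm -/

namespace D3PI

/-- Data of one agent (`A`, `B`) and of the cost (`Q₁`, `Q₂`, `R`). -/
structure Plant (n m : ℕ) where
  A : Matrix (Fin n) (Fin n) ℝ
  B : Matrix (Fin n) (Fin m) ℝ
  Q₁ : Matrix (Fin n) (Fin n) ℝ
  Q₂ : Matrix (Fin n) (Fin n) ℝ
  R : Matrix (Fin m) (Fin m) ℝ

/-- `Q̃ = Q₁ + d Q₂`. -/
def Plant.Qtilde {n m : ℕ} (S : Plant n m) (d : ℕ) : Matrix (Fin n) (Fin n) ℝ :=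
  S.Q₁ + (d : ℝ) • S.Q₂

/-- `I_d ⊗ A`. -/
def Plant.bigA {n m : ℕ} (S : Plant n m) (d : ℕ) :
    Matrix (Fin d × Fin n) (Fin d × Fin n) ℝ :=
  (1 : Matrix (Fin d) (Fin d) ℝ) ⊗ₖ S.A

/-- `I_d ⊗ B`. -/
def Plant.bigB {n m : ℕ} (S : Plant n m) (d : ℕ) :
    Matrix (Fin d × Fin n) (Fin d × Fin m) ℝ :=
  (1 : Matrix (Fin d) (Fin d) ℝ) ⊗ₖ S.B

/-- `I_d ⊗ Q̃ - 𝟙 𝟙ᵀ ⊗ Q₂`. -/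
def Plant.bigQ {n m : ℕ} (S : Plant n m) (d : ℕ) :
    Matrix (Fin d × Fin n) (Fin d × Fin n) ℝ :=
  (1 : Matrix (Fin d) (Fin d) ℝ) ⊗ₖ S.Qtilde d - (of fun _ _ => (1 : ℝ)) ⊗ₖ S.Q₂

/-- `I_d ⊗ R`. -/
def Plant.bigR {n m : ℕ} (S : Plant n m) (d : ℕ) :
    Matrix (Fin d × Fin m) (Fin d × Fin m) ℝ :=
  (1 : Matrix (Fin d) (Fin d) ℝ) ⊗ₖ S.R

/-- Coordinates of the stacked state-input vector `z = [x ; u]` of `d` agents; there are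
`p = d (n + m)` of them. -/
abbrev Idx (d n m : ℕ) : Type := (Fin d × Fin n) ⊕ (Fin d × Fin m)

/-- The `p (p + 1) / 2` quadratic monomials `zᵢ zⱼ`, indexed by unordered pairs `{i, j}`. -/
def quadFeatures {ι : Type*} (z : ι → ℝ) : Sym2 ι → ℝ :=
  fun s => (s.map z).mul

/-- Half-vectorization matching `quadFeatures`: the entry at `{i, j}` is the coefficient of the
monomial `zᵢ zⱼ` in `zᵀ H z`. -/
def vech {ι : Type*} [DecidableEq ι] (H : Matrix ι ι ℝ) : Sym2 ι → ℝ :=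
  Sym2.lift ⟨fun i j => if i = j then H i i else H i j + H j i, by
    intro i j
    by_cases h : i = j
    · subst h; rfl
    · simp [h, Ne.symm h, add_comm]⟩

/-- The symmetric matrix with given half-vectorization. -/
noncomputable def unvech {ι : Type*} [DecidableEq ι] (θ : Sym2 ι → ℝ) : Matrix ι ι ℝ :=
  of fun i j => if i = j then θ s(i, j) else θ s(i, j) / 2

/-- The set of learning agents, the vertices of the subgraph `G_d`; `lab` is its labelling by
`1, …, d`. -/
def learners {V : Type*} {d : ℕ} (lab : Fin d ↪ V) : Finset V := Finset.univ.map lab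

/-- Concatenation of the vectors of the learning agents. -/
def stack {V : Type*} {d a : ℕ} (lab : Fin d ↪ V) (x : V → Fin a → ℝ) : Fin d × Fin a → ℝ :=
  fun q => x (lab q.1) q.2

/-- The control policy of the entire network during the learning phase, for gains `K`, `L` and
margin `τ`. The learning agents form a complete graph and ignore all the others: their stacked
input is `(I_d ⊗ (K - L) + 𝟙 𝟙ᵀ ⊗ L) x`, i.e. agent `i` uses `(K - L) xᵢ + L ∑ xⱼ` with the sum
over all learning agents `j` (equivalently `K xᵢ + L ∑_{j ≠ i} xⱼ`). Every other agent uses its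
neighbours in `G` with weight `τ / (d - 1)`. -/
noncomputable def policy {V : Type*} [Fintype V] [DecidableEq V] (G : SimpleGraph V)
    [DecidableRel G.Adj] {d n m : ℕ} (lab : Fin d ↪ V) (K L : Matrix (Fin m) (Fin n) ℝ) (τ : ℝ)
    (x : V → Fin n → ℝ) (i : V) : Fin m → ℝ :=
  (K - L) *ᵥ x i +
    L *ᵥ (if i ∈ learners lab then ∑ j ∈ learners lab, x j
      else ∑ j ∈ G.neighborFinset i, (τ / ((d : ℝ) - 1)) • x j)

/-- State of the subgraph policy evaluation: time `t`, network state `x`, parameter estimate `θ`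
and projection factor `P`. -/
structure SPEState (V : Type*) (d n m : ℕ) where
  t : ℕ
  x : V → Fin n → ℝ
  θ : Sym2 (Idx d n m) → ℝ
  P : Matrix (Sym2 (Idx d n m)) (Sym2 (Idx d n m)) ℝ

section SPE

variable {V : Type*} [Fintype V] [DecidableEq V] (G : SimpleGraph V) [DecidableRel G.Adj]
  {d n m : ℕ} (lab : Fin d ↪ V) (S : Plant n m) (K L : Matrix (Fin m) (Fin n) ℝ) (τ : ℝ)
  (e : ℕ → V → Fin m → ℝ)

/-- Input applied at time `t` in network state `x`: the policy, plus the exploration signal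
`e t` on the learning agents. -/
noncomputable def appliedInput (t : ℕ) (x : V → Fin n → ℝ) (i : V) : Fin m → ℝ :=
  policy G lab K L τ x i + if i ∈ learners lab then e t i else 0

/-- Network state after one step from `x` at time `t`. -/
noncomputable def nextState (t : ℕ) (x : V → Fin n → ℝ) (i : V) : Fin n → ℝ :=
  S.A *ᵥ x i + S.B *ᵥ appliedInput G lab K L τ e t x i

/-- The regression vector: the quadratic monomials of `z_t = [x_t ; u_t]`, with the applied
(exploring) input `u_t`, minus those of `z_{t+1} = [x_{t+1} ; u_{t+1}]`, with the input `u_{t+1}`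
prescribed by the policy. -/
noncomputable def regressor (t : ℕ) (x : V → Fin n → ℝ) : Sym2 (Idx d n m) → ℝ :=
  quadFeatures (Sum.elim (stack lab x) (stack lab (appliedInput G lab K L τ e t x))) -
    quadFeatures (Sum.elim (stack lab (nextState G lab S K L τ e t x))
      (stack lab (policy G lab K L τ (nextState G lab S K L τ e t x))))

/-- The local one-step cost of the learning agents. -/
noncomputable def stageCost (t : ℕ) (x : V → Fin n → ℝ) : ℝ :=
  stack lab x ⬝ᵥ S.bigQ d *ᵥ stack lab x +
    stack lab (appliedInput G lab K L τ e t x) ⬝ᵥ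
      S.bigR d *ᵥ stack lab (appliedInput G lab K L τ e t x)

/-- One pass through the loop of the subgraph policy evaluation: the network makes one step and
the estimate is updated by recursive least squares. -/
noncomputable def speStep (s : SPEState V d n m) : SPEState V d n m :=
  let ζ := regressor G lab S K L τ e s.t s.x
  let c := 1 + ζ ⬝ᵥ s.P *ᵥ ζ
  { t := s.t + 1
    x := nextState G lab S K L τ e s.t s.x
    θ := s.θ + ((stageCost G lab S K L τ e s.t s.x - ζ ⬝ᵥ s.θ) / c) • s.P *ᵥ ζ
    P := s.P - c⁻¹ • (s.P * vecMulVec ζ ζ * s.P) }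

end SPE

/-- Variables of the main loop at the beginning of an iteration: time `t`, network state `x`,
current estimate `H` of the cost matrix, gains `K`, `L`, and `γ`, `τ`. -/
structure State (V : Type*) (d n m : ℕ) where
  t : ℕ
  x : V → Fin n → ℝ
  H : Matrix (Idx d n m) (Idx d n m) ℝ
  K : Matrix (Fin m) (Fin n) ℝ
  L : Matrix (Fin m) (Fin n) ℝ
  γ : ℝ
  τ : ℝ

/-- Block `(i, j)` of a `d × d` block matrix. -/
def block {d a b : ℕ} (M : Matrix (Fin d × Fin a) (Fin d × Fin b) ℝ) (i j : Fin d) :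
    Matrix (Fin a) (Fin b) ℝ :=
  of fun k l => M (i, k) (j, l)

/-- The update of `K`, `L`, `γ`, `τ` from the cost matrix `H` delivered by the policy evaluation
(which has left the network in state `x` at time `t`). -/
noncomputable def improve {V : Type*} {d n m : ℕ} (hd : 2 ≤ d) (S : Plant n m) (t : ℕ)
    (x : V → Fin n → ℝ) (H : Matrix (Idx d n m) (Idx d n m) ℝ) : State V d n m :=
  let first : Fin d := ⟨0, by omega⟩
  let second : Fin d := ⟨1, by omega⟩
  let X₁ := block H.toBlocks₁₁ first first
  let X₂ := block H.toBlocks₁₁ first second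
  let Y₁ := block H.toBlocks₂₂ first first
  let Y₂ := block H.toBlocks₂₂ first second
  let Z₁ := block H.toBlocks₂₁ first first
  let Z₂ := block H.toBlocks₂₁ first second
  let dX := X₁ - X₂
  let dY := Y₁ - Y₂
  let dZ := Z₁ - Z₂
  let F := (Y₁ - ((d : ℝ) - 1) • (Y₂ * (Y₁ + ((d : ℝ) - 2) • Y₂)⁻¹ * Y₂))⁻¹
  let Γ := (Y₁ + ((d : ℝ) - 1) • Y₂)⁻¹ * Y₂ * (Y₁ - Y₂)⁻¹
  let K := -(F * Z₁) + ((d : ℝ) - 1) • (Γ * Z₂)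
  let L := -(F * Z₂) + Γ * Z₁ + ((d : ℝ) - 2) • (Γ * Z₂)
  let dK := K - L
  let Ξ := dX - S.Qtilde d + S.Q₂ + dKᵀ * dZ + dZᵀ * dK + dKᵀ * (dY - S.R) * dK
  let γ := sigmaMin (dKᵀ * S.R * dK + S.Qtilde d) / sigmaMax (Ξ + Lᵀ * (dY - S.R) * L)
  { t := t, x := x, H := H, K := K, L := L, γ := γ, τ := Real.sqrt (γ ^ 2 / (1 + γ)) }

section Main

variable {V : Type*} [Fintype V] [DecidableEq V] (G : SimpleGraph V) [DecidableRel G.Adj]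
  {d n m : ℕ} (hd : 2 ≤ d) (lab : Fin d ↪ V) (S : Plant n m) (β : ℝ)
  (e : ℕ → V → Fin m → ℝ)

/-- The `r`-th state of the policy evaluation that starts from `s`, with the projection factor
reset to `β I`. -/
noncomputable def spe (s : State V d n m) (r : ℕ) : SPEState V d n m :=
  (speStep G lab S s.K s.L s.τ e)^[r] ⟨s.t, s.x, vech s.H, β • 1⟩

/-- One iteration of the main loop, whose policy evaluation makes `r` steps. -/
noncomputable def iterate (r : ℕ) (s : State V d n m) : State V d n m :=
  improve hd S (spe G lab S β e s r).t (spe G lab S β e s r).x (unvech (spe G lab S β e s r).θ)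

/-- The run of the algorithm from `K₁`, the initial guess `H₀` and the initial network state
`x₁`, with `T k` policy evaluation steps in iteration `k`. Iterations are counted from `0`, so
that `run … 0` holds `K₁`, `L₁ = 0`, `τ₁ = 0` (and a placeholder for `γ₁`, which the algorithm
neither defines nor uses). -/
noncomputable def run (K₁ : Matrix (Fin m) (Fin n) ℝ) (H₀ : Matrix (Idx d n m) (Idx d n m) ℝ)
    (x₁ : V → Fin n → ℝ) (T : ℕ → ℕ) : ℕ → State V d n m
  | 0 => ⟨0, x₁, H₀, K₁, 0, 0, 0⟩
  | k + 1 => iterate G hd lab S β e (T k) (run K₁ H₀ x₁ T k)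

/-- Persistence of excitation with level `ε` in a policy evaluation of `r` steps from `s`:
`ε I ≼ (1 / r) ∑ ζ ζᵀ`, the sum over the `r` regression vectors `ζ`. -/
def PersistentlyExcited (ε : ℝ) (r : ℕ) (s : State V d n m) : Prop :=
  ∀ v : Sym2 (Idx d n m) → ℝ, ε * r * (v ⬝ᵥ v) ≤
    ∑ q ∈ Finset.range r,
      (regressor G lab S s.K s.L s.τ e (spe G lab S β e s q).t (spe G lab S β e s q).x ⬝ᵥ v) ^ 2

end Main

end D3PI

/-! ### Stability and Lyapunov equations -/

section PowerStable

/-! Every patterned matrix acts separately on consensus vectors `𝟙 ⊗ v` and on disagreement vectors.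
In these modes the learners' LQR problem splits into two problems for one agent with the same `A`,
`B`, `R` and with state weights `Q₁` (consensus) and `Q̃` (disagreement). Each has a Riccati
solution: among the cost matrices of all gains one of least trace exists by compactness, and exact
policy improvement cannot lower its trace, so its gain is its own improvement (`exists_isRiccati`).
Completing the square shows that the assembled gain is the unique optimum over all input sequences
(`IsRiccati.isOptimalLQRGain_iff`).

The algorithm is inexact policy iteration. The Bellman equation holds exactly along the learners'
trajectory, whatever the exploration, so recursive least squares works with noise-free data. Its
error then satisfies `J w = β⁻¹ w₀`, with `J` the information matrix, and persistent excitation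
makes `w` smaller than `w₀` by the factor `1 + β ε T` (`rls_contraction`). Large `T` therefore
contracts the error of the warm-started estimate by any prescribed factor, uniformly in the
trajectory.

Let `v` be the trace gap to the optimal cost and `e` the evaluation error. If `e` is small, the old
cost matrix is still a Lyapunov function for the new gain, and `(1 - C e) v' ≤ ρ v + C e V*` with `ρ
< 1`, while the new evaluation error is at most `δ (e + M (v + v'))`. With `δ` small both sequences
decay geometrically (`exists_geometric_rates`, `inexact_policy_iteration`), and all gains stay
stabilizing.

The estimated matrix need not be patterned, but the update reads only its blocks (1,1) and (1,2). It
is thus the exact improvement formula for the patterned matrix with these blocks (`improve_gain`),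
and exact parameters are fixed by this linear replacement. Finally `K`, `L`, `γ`, `τ` depend
continuously on the estimate near the limit: the matrices to be inverted have coercive limits,
extreme singular values are 1-Lipschitz, and the denominator of `γ` does not vanish at the optimum
(`gammaDenominator_ne_zero`). -/

theorem tendsto_matrix_iff {X α β : Type*} {f : X → Matrix α β ℝ} {l : Filter X}
    {M : Matrix α β ℝ} :
    Tendsto f l (𝓝 M) ↔ ∀ i j, Tendsto (fun x => f x i j) l (𝓝 (M i j)) :=
  Iff.trans (tendsto_pi_nhds (f := f) (g := M)) (forall_congr' fun _ => tendsto_pi_nhds)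

-- Gelfand's formula: `‖M ^ t‖ ^ (1 / t)` tends to the spectral radius, so `‖M ^ t‖ ≤ r ^ t`
-- eventually for some `r < 1`.
open scoped Matrix.Norms.L2Operator in
theorem tendsto_pow_of_spectrum {ι : Type*} [Fintype ι] [DecidableEq ι] (M : Matrix ι ι ℂ)
    (h : ∀ μ ∈ spectrum ℂ M, ‖μ‖ < 1) : Tendsto (fun t : ℕ => M ^ t) atTop (𝓝 0) := by
  cases isEmpty_or_nonempty ι
  · exact tendsto_const_nhds.congr fun t => Subsingleton.elim _ _
  have hr : spectralRadius ℂ M < 1 := by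
    obtain ⟨μ, hμ, hμr⟩ := spectrum.exists_nnnorm_eq_spectralRadius M
    rw [← hμr]
    exact_mod_cast h μ hμ
  obtain ⟨r, hr₁, hr₂⟩ := ENNReal.lt_iff_exists_nnreal_btwn.mp hr
  have hev := (spectrum.pow_nnnorm_pow_one_div_tendsto_nhds_spectralRadius M).eventually_lt_const hr₁
  have hr1 : (r : ℝ) < 1 := by exact_mod_cast hr₂
  refine squeeze_zero_norm' (a := fun t => (r : ℝ) ^ t) ?_
    (tendsto_pow_atTop_nhds_zero_of_lt_one r.2 hr1)
  filter_upwards [hev, eventually_gt_atTop 0] with t ht ht0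
  have h1 : ((‖M ^ t‖₊ : ℝ≥0∞)) ≤ (r : ℝ≥0∞) ^ t := by
    have := ENNReal.rpow_le_rpow ht.le (z := (t : ℝ)) (by positivity)
    rwa [← ENNReal.rpow_mul, one_div, inv_mul_cancel₀ (by positivity), ENNReal.rpow_one,
      ENNReal.rpow_natCast] at this
  exact_mod_cast h1

/-- Schur stability in terms of powers. -/
theorem isSchurStable_iff {ι : Type*} [Fintype ι] [DecidableEq ι] (M : Matrix ι ι ℝ) :
    IsSchurStable M ↔ Tendsto (fun t : ℕ => M ^ t) atTop (𝓝 0) := by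
  have hmap : ∀ t : ℕ, (M ^ t).map (algebraMap ℝ ℂ) = (M.map (algebraMap ℝ ℂ)) ^ t := fun t => by
    simpa using map_pow (algebraMap ℝ ℂ).mapMatrix M t
  constructor
  · intro h
    have := tendsto_pow_of_spectrum _ h
    have hc : Continuous fun N : Matrix ι ι ℂ => N.map Complex.re :=
      continuous_id.matrix_map Complex.continuous_re
    have h0 : (0 : Matrix ι ι ℂ).map Complex.re = 0 := by ext; simp
    have hre := (hc.tendsto _).comp this
    rw [h0] at hre
    refine hre.congr fun t => ?_
    rw [Function.comp_apply, ← hmap]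
    ext
    simp
  -- On a complex eigenvector the powers of `M` act as `μ ^ t`, which must therefore tend to zero.
  · intro h μ hμ
    rw [← Matrix.spectrum_toLin', ← Module.End.hasEigenvalue_iff_mem_spectrum] at hμ
    obtain ⟨v, hv⟩ := hμ.exists_hasEigenvector
    have hpow : ∀ t : ℕ, (M.map (algebraMap ℝ ℂ)) ^ t *ᵥ v = μ ^ t • v := fun t => by
      have := hv.pow_apply t
      rwa [← Matrix.toLin'_pow, Matrix.toLin'_apply] at this
    obtain ⟨i, hi⟩ : ∃ i, v i ≠ 0 := Function.ne_iff.mp hv.2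
    have hc : Continuous fun N : Matrix ι ι ℝ => (N.map (algebraMap ℝ ℂ) *ᵥ v) i := by
      have : Continuous fun N : Matrix ι ι ℝ => N.map (algebraMap ℝ ℂ) :=
        continuous_id.matrix_map Complex.continuous_ofReal
      exact (continuous_apply i).comp (this.matrix_mulVec continuous_const)
    have h1 := (hc.tendsto 0).comp h
    have h2 : Tendsto (fun t : ℕ => μ ^ t * v i) atTop (𝓝 0) := by
      have h0 : ((0 : Matrix ι ι ℝ).map (algebraMap ℝ ℂ) *ᵥ v) i = 0 := by
        simp
      rw [h0] at h1
      refine h1.congr fun t => ?_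
      simp only [Function.comp, hmap, hpow]
      rfl
    have h3 : Tendsto (fun t : ℕ => μ ^ t) atTop (𝓝 0) := by
      have := h2.mul_const (v i)⁻¹
      simpa [mul_assoc, hi] using this
    have h4 : Tendsto (fun t : ℕ => ‖μ‖ ^ t) atTop (𝓝 0) := by
      simpa using h3.norm
    simpa using tendsto_pow_atTop_nhds_zero_iff.mp h4

end PowerStable

section Lyapunov

variable {ι : Type*} [Fintype ι] [DecidableEq ι] {M : Matrix ι ι ℝ}

theorem lyapunov_iterate {P : Matrix ι ι ℝ} (h : Mᵀ * P * M = P) (t : ℕ) :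
    (M ^ t)ᵀ * P * M ^ t = P := by
  induction t with
  | zero => simp
  | succ t ih =>
    calc (M ^ (t + 1))ᵀ * P * M ^ (t + 1) = (M ^ t)ᵀ * (Mᵀ * P * M) * M ^ t := by
          rw [pow_succ', transpose_mul]; noncomm_ring
      _ = P := by rw [h, ih]

theorem tendsto_conj_pow (hM : IsSchurStable M) (P : Matrix ι ι ℝ) :
    Tendsto (fun t : ℕ => (M ^ t)ᵀ * P * M ^ t) atTop (𝓝 0) := by
  have hM := (isSchurStable_iff M).mp hM
  have hc : Continuous fun N : Matrix ι ι ℝ => Nᵀ * P * N :=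
    (continuous_id.matrix_transpose.matrix_mul continuous_const).matrix_mul continuous_id
  simpa [Function.comp_def] using (hc.tendsto 0).comp hM

/-- The discrete Lyapunov equation of a stable matrix is uniquely solvable. -/
theorem existsUnique_lyapunov (hM : IsSchurStable M) (W : Matrix ι ι ℝ) :
    ∃! P : Matrix ι ι ℝ, P = W + Mᵀ * P * M := by
  let φ : Matrix ι ι ℝ →ₗ[ℝ] Matrix ι ι ℝ :=
    LinearMap.id - (LinearMap.mulRight ℝ M).comp (LinearMap.mulLeft ℝ Mᵀ)
  have hφ : ∀ P, φ P = P - Mᵀ * P * M := fun P => by simp [φ]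
  -- A solution of the homogeneous equation equals `(M ^ t)ᵀ P (M ^ t)` for all `t`, hence its limit
  -- `0`. In finite dimension injectivity yields existence as well.
  have hinj : Function.Injective φ := by
    rw [injective_iff_map_eq_zero]
    intro P hP
    rw [hφ, sub_eq_zero] at hP
    refine tendsto_nhds_unique ?_ (tendsto_conj_pow hM P)
    exact tendsto_const_nhds.congr fun t => (lyapunov_iterate hP.symm t).symm
  obtain ⟨P, hP⟩ := LinearMap.surjective_of_injective hinj W
  refine ⟨P, ?_, fun P' hP' => hinj ?_⟩
  · simp only
    rw [hφ, sub_eq_iff_eq_add] at hP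
    exact hP
  · rw [hP, hφ, sub_eq_iff_eq_add]
    exact hP'

theorem lyapunov_unique (hM : IsSchurStable M) {W P P' : Matrix ι ι ℝ}
    (h : P = W + Mᵀ * P * M) (h' : P' = W + Mᵀ * P' * M) : P = P' :=
  (existsUnique_lyapunov hM W).unique h h'

/-- Comparison principle for the Lyapunov operator. -/
theorem posSemidef_of_lyapunov (hM : IsSchurStable M) {P : Matrix ι ι ℝ}
    (h : (P - Mᵀ * P * M).PosSemidef) : P.PosSemidef := by
  -- Symmetry comes for free: `Pᵀ` solves the same Lyapunov equation as `P`.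
  have hsymm : Pᵀ = P := by
    have h1 : (P - Mᵀ * P * M)ᵀ = P - Mᵀ * P * M := by simpa using h.1.eq
    refine lyapunov_unique hM (W := P - Mᵀ * P * M) ?_ (by abel)
    nth_rewrite 1 [← h1]
    simp [Matrix.mul_assoc]
  refine .of_dotProduct_mulVec_nonneg (by simpa [IsHermitian] using hsymm) fun x => ?_
  -- Telescoping: `P - (M ^ t)ᵀ P (M ^ t)` is a sum of conjugates of the decrement, and its
  -- subtracted term vanishes in the limit.
  have hstep : ∀ t : ℕ, 0 ≤ star x ⬝ᵥ ((P - (M ^ t)ᵀ * P * M ^ t) *ᵥ x) := by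
    intro t
    induction t with
    | zero => simp
    | succ t ih =>
      have h2 := (h.conjTranspose_mul_mul_same (M ^ t)).dotProduct_mulVec_nonneg x
      have h3 : P - (M ^ (t + 1))ᵀ * P * M ^ (t + 1) =
          (P - (M ^ t)ᵀ * P * M ^ t) + (M ^ t)ᴴ * (P - Mᵀ * P * M) * M ^ t := by
        rw [pow_succ', transpose_mul, conjTranspose_eq_transpose_of_trivial]; noncomm_ring
      rw [h3, add_mulVec, dotProduct_add]
      exact add_nonneg ih h2
  have hc : Continuous fun N : Matrix ι ι ℝ => star x ⬝ᵥ ((P - N) *ᵥ x) := by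
    fun_prop
  have hl := (hc.tendsto 0).comp (tendsto_conj_pow hM P)
  simp only [sub_zero] at hl
  exact ge_of_tendsto' hl hstep

/-- Diagonalization. The affine form covers both later uses: the lower bound by the least eigenvalue
and the upper bound by the trace. -/
theorem posSemidef_affine {Q : Matrix ι ι ℝ} (hQ : Q.IsHermitian) {a b : ℝ}
    (h : ∀ i, 0 ≤ a + b * hQ.eigenvalues i) : (a • (1 : Matrix ι ι ℝ) + b • Q).PosSemidef := by
  have hU := hQ.spectral_theorem
  set U := hQ.eigenvectorUnitary
  have h3 : (U : Matrix ι ι ℝ) * (U : Matrix ι ι ℝ)ᴴ = 1 := Unitary.coe_mul_star_self U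
  have h2 : (diagonal (fun j => a + b * hQ.eigenvalues j) : Matrix ι ι ℝ) =
      a • 1 + b • diagonal hQ.eigenvalues := by
    rw [← diagonal_one, ← diagonal_smul, ← diagonal_smul, diagonal_add]; congr 1; ext; simp
  have h1 : a • (1 : Matrix ι ι ℝ) + b • Q = (U : Matrix ι ι ℝ) *
      (diagonal (fun j => a + b * hQ.eigenvalues j)) * (U : Matrix ι ι ℝ)ᴴ := by
    rw [h2, Matrix.mul_add, Matrix.add_mul, Matrix.mul_smul, Matrix.smul_mul, Matrix.mul_one, h3,
      Matrix.mul_smul, Matrix.smul_mul]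
    congr 2
  rw [h1]
  exact (PosSemidef.diagonal fun j => h j).mul_mul_conjTranspose_same _

theorem exists_coercive_of_posDef {Q : Matrix ι ι ℝ} (hQ : Q.PosDef) :
    ∃ q : ℝ, 0 < q ∧ (Q - q • (1 : Matrix ι ι ℝ)).PosSemidef := by
  cases isEmpty_or_nonempty ι
  · refine ⟨1, one_pos, ?_⟩
    rw [Subsingleton.elim (Q - (1 : ℝ) • 1) 0]
    exact .zero
  obtain ⟨i, -, hi⟩ := Finset.exists_min_image Finset.univ hQ.1.eigenvalues Finset.univ_nonempty
  refine ⟨hQ.1.eigenvalues i, hQ.eigenvalues_pos i, ?_⟩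
  have h := posSemidef_affine hQ.1 (a := -hQ.1.eigenvalues i) (b := 1) fun j => by
    linarith [hi j (Finset.mem_univ j)]
  convert h using 1
  simp only [neg_smul, one_smul]
  abel

/-- A positive semidefinite matrix is bounded by its trace. -/
theorem posSemidef_trace_smul_one_sub {D : Matrix ι ι ℝ} (hD : D.PosSemidef) :
    (D.trace • (1 : Matrix ι ι ℝ) - D).PosSemidef := by
  have h := posSemidef_affine hD.1 (a := D.trace) (b := -1) fun j => by
    have h1 := Finset.single_le_sum (f := hD.1.eigenvalues)
      (fun j _ => hD.eigenvalues_nonneg j) (Finset.mem_univ j)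
    have h2 := hD.1.trace_eq_sum_eigenvalues
    simp only [RCLike.ofReal_real_eq_id, id] at h2
    linarith
  convert h using 1
  simp only [neg_smul, one_smul, sub_eq_add_neg]

theorem quad_lower {Q : Matrix ι ι ℝ} {q : ℝ} (h : (Q - q • (1 : Matrix ι ι ℝ)).PosSemidef)
    (x : ι → ℝ) : q * (x ⬝ᵥ x) ≤ x ⬝ᵥ Q *ᵥ x := by
  have := h.dotProduct_mulVec_nonneg x
  simpa [sub_mulVec, dotProduct_sub, smul_mulVec] using this

theorem sq_le_dotProduct_self {α : Type*} [Fintype α] (x : α → ℝ) (i : α) : x i ^ 2 ≤ x ⬝ᵥ x := by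
  rw [dotProduct]
  have := Finset.single_le_sum (f := fun j => x j * x j) (fun j _ => mul_self_nonneg _)
    (Finset.mem_univ i)
  simpa [sq] using this

/-- A Lyapunov inequality with positive definite decrement implies stability. -/
theorem isSchurStable_of_lyapunov {P : Matrix ι ι ℝ} (hP : P.PosSemidef)
    (h : (P - Mᵀ * P * M).PosDef) : IsSchurStable M := by
  rw [isSchurStable_iff]
  obtain ⟨q, hq, hqP⟩ := exists_coercive_of_posDef h
  have hx : ∀ x : ι → ℝ, ∀ i, Tendsto (fun t : ℕ => (M ^ t *ᵥ x) i) atTop (𝓝 0) := by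
    intro x i
    -- `xᵀ P x` loses at least `q` times the squared coordinate in each step and stays nonnegative,
    -- so these squares are summable along the orbit.
    have hsum : ∀ T : ℕ, ∑ t ∈ Finset.range T, q * ((M ^ t *ᵥ x) i) ^ 2 ≤
        x ⬝ᵥ P *ᵥ x - (M ^ T *ᵥ x) ⬝ᵥ P *ᵥ (M ^ T *ᵥ x) := by
      intro T
      induction T with
      | zero => simp
      | succ T ih =>
        rw [Finset.sum_range_succ]
        have h1 := quad_lower hqP (M ^ T *ᵥ x)
        have h2 := sq_le_dotProduct_self (M ^ T *ᵥ x) i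
        have h3 : (M ^ T *ᵥ x) ⬝ᵥ (P - Mᵀ * P * M) *ᵥ (M ^ T *ᵥ x) =
            (M ^ T *ᵥ x) ⬝ᵥ P *ᵥ (M ^ T *ᵥ x) -
              (M ^ (T + 1) *ᵥ x) ⬝ᵥ P *ᵥ (M ^ (T + 1) *ᵥ x) := by
          rw [sub_mulVec, dotProduct_sub, pow_succ', ← mulVec_mulVec x M, ← mulVec_mulVec _ _ M,
            ← mulVec_mulVec _ Mᵀ, mulVec_transpose, dotProduct_comm _ (_ ᵥ* M),
            ← dotProduct_mulVec, dotProduct_comm (P *ᵥ _)]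
        nlinarith
    have hs : Summable fun t : ℕ => q * ((M ^ t *ᵥ x) i) ^ 2 := by
      refine summable_of_sum_range_le (c := x ⬝ᵥ P *ᵥ x) (fun t => by positivity) fun T => ?_
      have := hP.dotProduct_mulVec_nonneg (M ^ T *ᵥ x)
      simp only [star_trivial] at this
      linarith [hsum T]
    have h0 := hs.tendsto_atTop_zero.const_mul q⁻¹
    simp only [mul_zero, inv_mul_cancel_left₀ hq.ne'] at h0
    have h1 := (Real.continuous_sqrt.tendsto 0).comp h0
    simp only [Function.comp_def, Real.sqrt_sq_eq_abs, Real.sqrt_zero] at h1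
    exact (tendsto_zero_iff_abs_tendsto_zero _).mpr h1
  rw [tendsto_matrix_iff]
  intro i j
  refine (hx (Pi.single j 1) i).congr fun t => ?_
  simp

end Lyapunov

/-! ### Policy evaluation, policy improvement and the Riccati equation -/

set_option linter.unusedSectionVars false

section Riccati

variable {ι κ : Type*} [Fintype ι] [Fintype κ]

/-- `P` is the cost matrix of the feedback gain `K`: the Lyapunov (Bellman) equation. -/
def IsPolicyCost (A : Matrix ι ι ℝ) (B : Matrix ι κ ℝ) (Q : Matrix ι ι ℝ) (R : Matrix κ κ ℝ)
    (K : Matrix κ ι ℝ) (P : Matrix ι ι ℝ) : Prop :=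
  P = (Q + Kᵀ * R * K) + (A + B * K)ᵀ * P * (A + B * K)

/-- `P` is a positive semidefinite solution of the discrete algebraic Riccati equation, with
associated gain `K`. -/
structure IsRiccati (A : Matrix ι ι ℝ) (B : Matrix ι κ ℝ) (Q : Matrix ι ι ℝ) (R : Matrix κ κ ℝ)
    (K : Matrix κ ι ℝ) (P : Matrix ι ι ℝ) : Prop where
  posSemidef : P.PosSemidef
  cost : IsPolicyCost A B Q R K P
  gain : (R + Bᵀ * P * B) * K = -(Bᵀ * P * A)

variable {A : Matrix ι ι ℝ} {B : Matrix ι κ ℝ} {Q : Matrix ι ι ℝ} {R : Matrix κ κ ℝ}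
  {K K' K'' : Matrix κ ι ℝ} {P P' P'' : Matrix ι ι ℝ}

theorem Matrix.PosSemidef.transpose_mul_mul_same {D : Matrix κ κ ℝ} (hD : D.PosSemidef)
    {l : Type*} [Fintype l] (C : Matrix κ l ℝ) : (Cᵀ * D * C).PosSemidef := by
  simpa using hD.conjTranspose_mul_mul_same C

theorem Matrix.PosSemidef.transpose_eq {D : Matrix κ κ ℝ} (hD : D.PosSemidef) : Dᵀ = D := by
  simpa using hD.1.eq

theorem posDef_hessian (hR : R.PosDef) (hP : P.PosSemidef) (B : Matrix ι κ ℝ) :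
    (R + Bᵀ * P * B).PosDef :=
  hR.add_posSemidef (hP.transpose_mul_mul_same B)

theorem quadratic_expand {l : Type*} (hP : Pᵀ = P) (X : Matrix ι l ℝ) (U : Matrix κ l ℝ) :
    Uᵀ * R * U + (A * X + B * U)ᵀ * P * (A * X + B * U) =
      Uᵀ * (R + Bᵀ * P * B) * U + Xᵀ * (Aᵀ * P * A) * X + Xᵀ * (Bᵀ * P * A)ᵀ * U +
        Uᵀ * (Bᵀ * P * A) * X := by
  simp only [transpose_add, transpose_mul, hP, transpose_transpose, Matrix.mul_add, Matrix.add_mul,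
    Matrix.mul_assoc]
  abel

/-- Completion of the square. -/
theorem complete_square {l : Type*} [DecidableEq ι] (hP : Pᵀ = P) (hR : Rᵀ = R)
    (hK : (R + Bᵀ * P * B) * K = -(Bᵀ * P * A)) (X : Matrix ι l ℝ) (U : Matrix κ l ℝ) :
    Uᵀ * R * U + (A * X + B * U)ᵀ * P * (A * X + B * U) =
      Xᵀ * (Kᵀ * R * K + (A + B * K)ᵀ * P * (A + B * K)) * X +
        (U - K * X)ᵀ * (R + Bᵀ * P * B) * (U - K * X) := by
  have hY : (R + Bᵀ * P * B)ᵀ = R + Bᵀ * P * B := by simp [hP, hR, Matrix.mul_assoc]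
  have hN : Bᵀ * P * A = -((R + Bᵀ * P * B) * K) := by rw [hK, neg_neg]
  have h1 := quadratic_expand (A := A) (B := B) (R := R) hP (1 : Matrix ι ι ℝ) K
  rw [Matrix.mul_one] at h1
  rw [quadratic_expand hP, h1, hN]
  generalize R + Bᵀ * P * B = Y at *
  simp only [transpose_neg, transpose_mul, transpose_sub, hY, Matrix.mul_add, Matrix.add_mul,
    Matrix.mul_sub, Matrix.sub_mul, Matrix.mul_neg, Matrix.neg_mul, Matrix.mul_assoc,
    transpose_one, Matrix.one_mul, Matrix.mul_one]
  abel

theorem complete_square_gain [DecidableEq ι] (hP : Pᵀ = P) (hR : Rᵀ = R)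
    (hK : (R + Bᵀ * P * B) * K' = -(Bᵀ * P * A)) (K : Matrix κ ι ℝ) :
    Kᵀ * R * K + (A + B * K)ᵀ * P * (A + B * K) =
      K'ᵀ * R * K' + (A + B * K')ᵀ * P * (A + B * K') +
        (K - K')ᵀ * (R + Bᵀ * P * B) * (K - K') := by
  simpa using complete_square hP hR hK (1 : Matrix ι ι ℝ) K

variable [DecidableEq ι]

theorem exists_policyCost (hK : IsSchurStable (A + B * K)) : ∃ P, IsPolicyCost A B Q R K P :=
  (existsUnique_lyapunov hK _).exists

theorem IsPolicyCost.unique (hK : IsSchurStable (A + B * K)) (h : IsPolicyCost A B Q R K P)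
    (h' : IsPolicyCost A B Q R K P') : P = P' :=
  lyapunov_unique hK h h'

theorem posDef_stage (hQ : Q.PosDef) (hR : R.PosDef) (K : Matrix κ ι ℝ) :
    (Q + Kᵀ * R * K).PosDef :=
  hQ.add_posSemidef (hR.posSemidef.transpose_mul_mul_same K)

theorem IsPolicyCost.sub_eq (h : IsPolicyCost A B Q R K P) :
    P - (A + B * K)ᵀ * P * (A + B * K) = Q + Kᵀ * R * K :=
  sub_eq_of_eq_add h

theorem IsPolicyCost.posSemidef (hQ : Q.PosDef) (hR : R.PosDef) (hK : IsSchurStable (A + B * K))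
    (h : IsPolicyCost A B Q R K P) : P.PosSemidef := by
  refine posSemidef_of_lyapunov hK ?_
  rw [h.sub_eq]
  exact (posDef_stage hQ hR K).posSemidef

theorem IsPolicyCost.isSchurStable (hQ : Q.PosDef) (hR : R.PosDef) (hP : P.PosSemidef)
    (h : IsPolicyCost A B Q R K P) : IsSchurStable (A + B * K) := by
  refine isSchurStable_of_lyapunov hP ?_
  rw [h.sub_eq]
  exact posDef_stage hQ hR K

theorem IsRiccati.isSchurStable (hQ : Q.PosDef) (hR : R.PosDef) (h : IsRiccati A B Q R K P) :
    IsSchurStable (A + B * K) :=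
  h.cost.isSchurStable hQ hR h.posSemidef

theorem trace_le_of_posSemidef_sub {D E : Matrix ι ι ℝ} (h : (D - E).PosSemidef) :
    E.trace ≤ D.trace := by
  have := h.trace_nonneg
  rw [trace_sub] at this
  linarith

/-- The Lyapunov decrement of the cost matrix of `K` along another gain `K''`, where `K'` is the
exactly improved gain. -/
theorem inexact_improvement_step (hR : Rᵀ = R) (hPs : Pᵀ = P) (h : IsPolicyCost A B Q R K P)
    (hK' : (R + Bᵀ * P * B) * K' = -(Bᵀ * P * A)) :
    P - (A + B * K'')ᵀ * P * (A + B * K'') =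
      Q + K''ᵀ * R * K'' + (K - K')ᵀ * (R + Bᵀ * P * B) * (K - K') -
        (K'' - K')ᵀ * (R + Bᵀ * P * B) * (K'' - K') := by
  -- Both `K` and `K''` are compared with the minimizer `K'` by completing the square; the term of
  -- `K'` then cancels.
  have h1 := complete_square_gain hPs hR hK' K
  have h2 := complete_square_gain hPs hR hK' K''
  have h3 : Q + (Kᵀ * R * K + (A + B * K)ᵀ * P * (A + B * K)) = P := by
    rw [← add_assoc]; exact h.symm
  rw [← eq_sub_iff_add_eq'] at h2
  rw [h2, ← sub_eq_zero]
  rw [h1] at h3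
  nth_rewrite 1 [← h3]
  abel

/-- An inexact policy improvement is stabilizing: `K'` is the exactly improved gain, and `K''` is
so close to it that `(K'' - K')ᵀ (R + Bᵀ P B) (K'' - K') ≼ α Q`. -/
theorem inexact_improvement_isSchurStable (hQ : Q.PosDef) (hR : R.PosDef) (hP : P.PosSemidef)
    (h : IsPolicyCost A B Q R K P) (hK' : (R + Bᵀ * P * B) * K' = -(Bᵀ * P * A)) {α : ℝ}
    (hα : α < 1)
    (hδ : (α • Q - (K'' - K')ᵀ * (R + Bᵀ * P * B) * (K'' - K')).PosSemidef) :
    IsSchurStable (A + B * K'') := by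
  refine isSchurStable_of_lyapunov hP ?_
  rw [inexact_improvement_step hR.posSemidef.transpose_eq hP.transpose_eq h hK']
  have h1 := (hQ.smul (sub_pos.mpr hα)).add_posSemidef
    ((hδ.add (hR.posSemidef.transpose_mul_mul_same K'')).add
      ((posDef_hessian hR hP B).posSemidef.transpose_mul_mul_same (K - K')))
  convert h1 using 1
  rw [sub_smul, one_smul]
  abel

/-- Along `K''` the matrix `D = P - (1 - α) P''` has a Lyapunov decrement that dominates the square
`E` of `K - K'`. Hence `D` is positive semidefinite, and since `D` is its decrement plus a conjugate
of itself, even `D ≽ E`. This quantitative form is what bounds the remaining gap in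
`IsRiccati.trace_gap_le`. -/
theorem inexact_improvement_cost (hQ : Q.PosDef) (hR : R.PosDef) (hP : P.PosSemidef)
    (h : IsPolicyCost A B Q R K P) (hK' : (R + Bᵀ * P * B) * K' = -(Bᵀ * P * A)) {α : ℝ}
    (hα₀ : 0 ≤ α) (hα : α < 1)
    (hδ : (α • Q - (K'' - K')ᵀ * (R + Bᵀ * P * B) * (K'' - K')).PosSemidef)
    (h'' : IsPolicyCost A B Q R K'' P'') :
    (P - (1 - α) • P'' - (K - K')ᵀ * (R + Bᵀ * P * B) * (K - K')).PosSemidef := by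
  have hstab := inexact_improvement_isSchurStable hQ hR hP h hK' hα hδ
  have h1 := inexact_improvement_step hR.posSemidef.transpose_eq hP.transpose_eq h hK' (K'' := K'')
  have hE := (posDef_hessian hR hP B).posSemidef.transpose_mul_mul_same (K - K')
  set E := (K - K')ᵀ * (R + Bᵀ * P * B) * (K - K')
  set D := P - (1 - α) • P''
  have h2 : D - (A + B * K'')ᵀ * D * (A + B * K'') = E + ((α • Q -
      (K'' - K')ᵀ * (R + Bᵀ * P * B) * (K'' - K')) + α • (K''ᵀ * R * K'')) := by
    have h3 : D - (A + B * K'')ᵀ * D * (A + B * K'') = P - (A + B * K'')ᵀ * P * (A + B * K'') -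
        (1 - α) • (P'' - (A + B * K'')ᵀ * P'' * (A + B * K'')) := by
      simp only [D, Matrix.mul_sub, Matrix.sub_mul, Matrix.mul_smul, Matrix.smul_mul, smul_sub]
      abel
    rw [h3, h1, h''.sub_eq]
    simp only [sub_smul, one_smul, smul_add]
    abel
  have hrest := hδ.add ((hR.posSemidef.transpose_mul_mul_same K'').smul hα₀)
  have hD : D.PosSemidef := by
    refine posSemidef_of_lyapunov hstab ?_
    rw [h2]
    exact hE.add hrest
  have h4 := hrest.add (hD.transpose_mul_mul_same (A + B * K''))
  convert h4 using 1
  rw [sub_eq_iff_eq_add] at h2 ⊢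
  refine h2.trans ?_
  abel

/-- The cost of every stabilizing gain dominates the solution of the Riccati equation. -/
theorem IsRiccati.le_cost {Ks : Matrix κ ι ℝ} {Ps : Matrix ι ι ℝ} (hR : R.PosDef)
    (hs : IsRiccati A B Q R Ks Ps) (hK : IsSchurStable (A + B * K))
    (h : IsPolicyCost A B Q R K P) : (P - Ps).PosSemidef := by
  refine posSemidef_of_lyapunov hK ?_
  have h1 := complete_square_gain hs.posSemidef.transpose_eq hR.posSemidef.transpose_eq hs.gain K
  have h2 := h.sub_eq
  have h3 := hs.cost.sub_eq
  have h4 : P - Ps - (A + B * K)ᵀ * (P - Ps) * (A + B * K) =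
      (K - Ks)ᵀ * (R + Bᵀ * Ps * B) * (K - Ks) := by
    rw [← eq_sub_iff_add_eq'] at h1
    rw [Matrix.mul_sub, Matrix.sub_mul, sub_sub_sub_comm, h2, h1]
    rw [sub_eq_iff_eq_add] at h3
    nth_rewrite 1 [h3]
    abel
  rw [h4]
  exact (posDef_hessian hR hs.posSemidef B).posSemidef.transpose_mul_mul_same _

/-- The gap to the optimal cost is bounded by the improvement that is possible in one step. -/
theorem IsRiccati.trace_gap_le {Ks : Matrix κ ι ℝ} {Ps PI Δ : Matrix ι ι ℝ} (hQ : Q.PosDef)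
    (hR : R.PosDef) (hs : IsRiccati A B Q R Ks Ps)
    (hPI : PI = 1 + (A + B * Ks)ᵀ * PI * (A + B * Ks)) (hP : P.PosSemidef)
    (h : IsPolicyCost A B Q R K P) (hK' : (R + Bᵀ * P * B) * K' = -(Bᵀ * P * A))
    (hΔ : (Δ - (K - K')ᵀ * (R + Bᵀ * P * B) * (K - K')).PosSemidef) :
    (P - Ps).trace ≤ Δ.trace * PI.trace := by
  have hY := posDef_hessian hR hP B
  have hΔ₀ : Δ.PosSemidef := by
    simpa using hΔ.add (hY.posSemidef.transpose_mul_mul_same (K - K'))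
  have h1 := inexact_improvement_step hR.posSemidef.transpose_eq hP.transpose_eq h hK' (K'' := Ks)
  have h2 := hs.cost.sub_eq
  rw [← smul_eq_mul, ← trace_smul]
  -- Comparison along the optimal closed loop: the decrement of `P - Ps` there is at most `Δ ≼ tr Δ
  -- • 1`, and `PI` has decrement `1`, so `P - Ps ≼ tr Δ • PI`.
  refine trace_le_of_posSemidef_sub (posSemidef_of_lyapunov (hs.isSchurStable hQ hR) ?_)
  have h3 := (posSemidef_trace_smul_one_sub hΔ₀).add
    (hΔ.add (hY.posSemidef.transpose_mul_mul_same (Ks - K')))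
  convert h3 using 1
  have h4 : PI - (A + B * Ks)ᵀ * PI * (A + B * Ks) = 1 := sub_eq_of_eq_add hPI
  calc _ = Δ.trace • (PI - (A + B * Ks)ᵀ * PI * (A + B * Ks)) -
        ((P - (A + B * Ks)ᵀ * P * (A + B * Ks)) - (Ps - (A + B * Ks)ᵀ * Ps * (A + B * Ks))) := by
        simp only [Matrix.mul_sub, Matrix.sub_mul, Matrix.mul_smul, Matrix.smul_mul, smul_sub]
        abel
    _ = _ := by
        rw [h4, h1, h2]
        abel

end Riccati

/-! ### Existence of a Riccati solution, and optimality -/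

section Existence

theorem isCompact_matrix_box (α β : Type*) (b : ℝ) :
    IsCompact {M : Matrix α β ℝ | ∀ i j, M i j ∈ Set.Icc (-b) b} :=
  isCompact_pi_infinite (s := fun _ : α => {v : β → ℝ | ∀ j, v j ∈ Set.Icc (-b) b}) fun _ =>
    isCompact_pi_infinite fun _ => isCompact_Icc

variable {ι κ : Type*} [Fintype ι] [Fintype κ]

theorem isClosed_posSemidef : IsClosed {P : Matrix ι ι ℝ | P.PosSemidef} := by
  have h : {P : Matrix ι ι ℝ | P.PosSemidef} =
      {P : Matrix ι ι ℝ | Pᵀ = P} ∩ ⋂ x : ι → ℝ, {P | 0 ≤ x ⬝ᵥ P *ᵥ x} := by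
    ext P
    simp only [posSemidef_iff_dotProduct_mulVec, Set.mem_ofPred_eq, Set.mem_inter_iff, Set.mem_iInter,
      IsHermitian, conjTranspose_eq_transpose_of_trivial, star_trivial]
  rw [h]
  refine (isClosed_eq (by fun_prop) continuous_id).inter (isClosed_iInter fun x => ?_)
  exact isClosed_le continuous_const (by fun_prop)

theorem dotProduct_self_le_of_entry (M : Matrix κ ι ℝ) (i : κ) (j : ι) :
    M i j ^ 2 ≤ (Mᵀ * M).trace := by
  have h1 : M i j ^ 2 ≤ ∑ k, M k j * M k j := by
    have := Finset.single_le_sum (f := fun k => M k j * M k j) (fun k _ => mul_self_nonneg _)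
      (Finset.mem_univ i)
    simpa [sq] using this
  refine h1.trans ?_
  exact Finset.single_le_sum (f := fun j => ∑ k, M k j * M k j)
    (fun j _ => Finset.sum_nonneg fun k _ => mul_self_nonneg _) (Finset.mem_univ j)

variable [DecidableEq ι]

/-- Testing the form on `eᵢ ± eⱼ` gives `2 |P i j| ≤ P i i + P j j`. -/
theorem Matrix.PosSemidef.abs_apply_le_trace {P : Matrix ι ι ℝ} (hP : P.PosSemidef) (i j : ι) :
    |P i j| ≤ P.trace := by
  have hsym : P j i = P i j := congrFun₂ hP.transpose_eq i j
  have hle : ∀ k, P k k ≤ P.trace := fun k =>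
    Finset.single_le_sum (f := fun k => P k k) (fun k _ => hP.diag_nonneg) (Finset.mem_univ k)
  have hq : ∀ c : ℝ, 0 ≤ P i i + 2 * c * P i j + c ^ 2 * P j j := fun c => by
    have h := hP.dotProduct_mulVec_nonneg (Pi.single i 1 + c • Pi.single j 1)
    simp only [star_trivial, mulVec_add, mulVec_smul, add_dotProduct, dotProduct_add,
      smul_dotProduct, dotProduct_smul, single_one_dotProduct, mulVec_single_one, col_apply,
      smul_eq_mul, hsym] at h
    linarith
  have h1 := hq 1
  have h2 := hq (-1)
  rw [abs_le]
  constructor <;> nlinarith [hle i, hle j]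

variable [DecidableEq κ]

theorem exists_improved_gain {R : Matrix κ κ ℝ} {P : Matrix ι ι ℝ} (hR : R.PosDef)
    (hP : P.PosSemidef) (A : Matrix ι ι ℝ) (B : Matrix ι κ ℝ) :
    ∃ K' : Matrix κ ι ℝ, (R + Bᵀ * P * B) * K' = -(Bᵀ * P * A) := by
  refine ⟨-((R + Bᵀ * P * B)⁻¹ * (Bᵀ * P * A)), ?_⟩
  rw [Matrix.mul_neg, Matrix.mul_nonsing_inv_cancel_left _ _
    ((isUnit_iff_isUnit_det _).mp (posDef_hessian hR hP B).isUnit)]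

theorem eq_of_quadratic_eq_zero {Y : Matrix κ κ ℝ} (hY : Y.PosDef) {D : Matrix κ ι ℝ}
    (h : (Dᵀ * Y * D).trace = 0) : D = 0 := by
  obtain ⟨r, hr, hYr⟩ := exists_coercive_of_posDef hY
  have h1 := (hYr.transpose_mul_mul_same D).trace_nonneg
  rw [Matrix.mul_sub, Matrix.sub_mul, trace_sub, h, Matrix.mul_smul, Matrix.smul_mul,
    Matrix.mul_one, trace_smul, smul_eq_mul] at h1
  ext i j
  have h2 := dotProduct_self_le_of_entry D i j
  have h3 : D i j ^ 2 ≤ 0 := by nlinarith [sq_nonneg (D i j)]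
  simpa using le_antisymm h3 (sq_nonneg _)

/-- The term `Kᵀ R K` is dominated by `P`, so a bound on the cost bounds the gain and makes sublevel
sets compact. The summand `1` avoids a square root, by `|k| ≤ 1 + k²`. -/
theorem IsPolicyCost.abs_gain_le {A : Matrix ι ι ℝ} {B : Matrix ι κ ℝ} {Q : Matrix ι ι ℝ}
    {R : Matrix κ κ ℝ} {K : Matrix κ ι ℝ} {P : Matrix ι ι ℝ} (hQ : Q.PosDef) {r : ℝ} (hr : 0 < r)
    (hRr : (R - r • (1 : Matrix κ κ ℝ)).PosSemidef) (hP : P.PosSemidef)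
    (h : IsPolicyCost A B Q R K P) (i : κ) (j : ι) : |K i j| ≤ 1 + P.trace / r := by
  have h1 : r * (Kᵀ * K).trace ≤ P.trace := by
    have h2 := ((hQ.posSemidef.add (hRr.transpose_mul_mul_same K)).add
      (hP.transpose_mul_mul_same (A + B * K))).trace_nonneg
    have h3 : P.trace = _ := congrArg trace h
    simp only [trace_add, Matrix.mul_sub, Matrix.sub_mul, Matrix.mul_smul, Matrix.smul_mul,
      Matrix.mul_one, trace_sub, trace_smul, smul_eq_mul] at h2 h3
    linarith
  have h2 := dotProduct_self_le_of_entry K i j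
  have h3 : K i j ^ 2 ≤ P.trace / r := by
    rw [le_div_iff₀ hr]
    nlinarith
  nlinarith [sq_abs (K i j), sq_nonneg (|K i j| - 1), abs_nonneg (K i j)]

/-- Among all gains there is one whose cost matrix has the least trace. -/
theorem exists_min_trace {A : Matrix ι ι ℝ} {B : Matrix ι κ ℝ} {Q : Matrix ι ι ℝ}
    {R : Matrix κ κ ℝ} (hQ : Q.PosDef) (hR : R.PosDef) {K₁ : Matrix κ ι ℝ} {P₁ : Matrix ι ι ℝ}
    (h₁ : IsPolicyCost A B Q R K₁ P₁) (hP₁ : P₁.PosSemidef) :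
    ∃ K P, IsPolicyCost A B Q R K P ∧ P.PosSemidef ∧
      ∀ K' P', IsPolicyCost A B Q R K' P' → P'.PosSemidef → P.trace ≤ P'.trace := by
  obtain ⟨r, hr, hRr⟩ := exists_coercive_of_posDef hR
  let b := max P₁.trace (1 + P₁.trace / r)
  -- Stability is an open condition and would spoil compactness. The closed condition `P ≽ 0` takes
  -- its place; with `Q ≻ 0` it implies stability.
  have hcl1 : IsClosed {z : Matrix κ ι ℝ × Matrix ι ι ℝ | IsPolicyCost A B Q R z.1 z.2} :=
    isClosed_eq continuous_snd (by fun_prop)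
  have hcl2 : IsClosed {z : Matrix κ ι ℝ × Matrix ι ι ℝ | z.2.PosSemidef} :=
    isClosed_posSemidef.preimage continuous_snd
  have hcl3 : IsClosed {z : Matrix κ ι ℝ × Matrix ι ι ℝ | z.2.trace ≤ P₁.trace} :=
    isClosed_le (by fun_prop) continuous_const
  have hS := ((isCompact_matrix_box κ ι b).prod (isCompact_matrix_box ι ι b)).inter_right
    ((hcl1.inter hcl2).inter hcl3)
  have hmem : ∀ K P, IsPolicyCost A B Q R K P → P.PosSemidef → P.trace ≤ P₁.trace →
      (K, P) ∈ ({M : Matrix κ ι ℝ | ∀ i j, M i j ∈ Set.Icc (-b) b} ×ˢ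
          {M : Matrix ι ι ℝ | ∀ i j, M i j ∈ Set.Icc (-b) b}) ∩
        (({z : Matrix κ ι ℝ × Matrix ι ι ℝ | IsPolicyCost A B Q R z.1 z.2} ∩
          {z | z.2.PosSemidef}) ∩ {z | z.2.trace ≤ P₁.trace}) := by
    intro K P hc hP ht
    refine Set.mem_inter ?_ (Set.mem_inter (Set.mem_inter hc hP) ht)
    refine Set.mk_mem_prod (fun i j => abs_le.mp ?_) (fun i j => abs_le.mp ?_)
    · refine (hc.abs_gain_le hQ hr hRr hP i j).trans (le_trans ?_ (le_max_right _ _))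
      gcongr
    · exact (hP.abs_apply_le_trace i j).trans (ht.trans (le_max_left _ _))
  obtain ⟨z, hz, hmin⟩ := hS.exists_isMinOn ⟨_, hmem K₁ P₁ h₁ hP₁ le_rfl⟩
    (f := fun z => z.2.trace) (by fun_prop)
  have hz1 : z.2.trace ≤ P₁.trace := hz.2.2
  refine ⟨z.1, z.2, hz.2.1.1, hz.2.1.2, fun K' P' hc hP => ?_⟩
  by_cases ht : P'.trace ≤ P₁.trace
  · exact hmin (hmem K' P' hc hP ht)
  · linarith

/-- If there is a stabilizing gain, then the Riccati equation has a solution: the cost matrix of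
least trace. -/
theorem exists_isRiccati {A : Matrix ι ι ℝ} {B : Matrix ι κ ℝ} {Q : Matrix ι ι ℝ}
    {R : Matrix κ κ ℝ} (hQ : Q.PosDef) (hR : R.PosDef) {K₁ : Matrix κ ι ℝ}
    (hK₁ : IsSchurStable (A + B * K₁)) : ∃ K P, IsRiccati A B Q R K P := by
  obtain ⟨P₁, hP₁⟩ := exists_policyCost (Q := Q) (R := R) hK₁
  obtain ⟨K, P, hc, hP, hmin⟩ := exists_min_trace hQ hR hP₁ (hP₁.posSemidef hQ hR hK₁)
  obtain ⟨K', hK'⟩ := exists_improved_gain hR hP A B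
  -- The exact improvement is the inexact one with `α = 0` and `K'' = K'`. Minimality of the trace
  -- then forces the square of `K - K'` to vanish.
  have h0 : ((0 : ℝ) • Q - (K' - K')ᵀ * (R + Bᵀ * P * B) * (K' - K')).PosSemidef := by
    simpa using Matrix.PosSemidef.zero
  have hst := inexact_improvement_isSchurStable hQ hR hP hc hK' zero_lt_one h0
  obtain ⟨P', hP'⟩ := exists_policyCost (Q := Q) (R := R) hst
  have h1 := inexact_improvement_cost hQ hR hP hc hK' le_rfl zero_lt_one h0 hP'
  rw [sub_zero, one_smul] at h1
  have h2 := trace_le_of_posSemidef_sub h1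
  have hE := ((posDef_hessian hR hP B).posSemidef.transpose_mul_mul_same (K - K')).trace_nonneg
  rw [trace_sub] at h2
  have h3 := hmin K' P' hP' (hP'.posSemidef hQ hR hst)
  have h4 := eq_of_quadratic_eq_zero (posDef_hessian hR hP B) (D := K - K') (by linarith)
  refine ⟨K, P, hP, hc, ?_⟩
  rw [sub_eq_zero.mp h4, hK']

end Existence

/-! ### Optimality of the Riccati feedback among all input sequences. -/

section Optimality

variable {ι κ : Type*} [Fintype ι] [Fintype κ] {A : Matrix ι ι ℝ} {B : Matrix ι κ ℝ}
  {Q : Matrix ι ι ℝ} {R : Matrix κ κ ℝ} {K : Matrix κ ι ℝ} {P : Matrix ι ι ℝ}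

theorem replicateCol_quadratic {α : Type*} [Fintype α] (M : Matrix α α ℝ) (x y : α → ℝ) :
    ((replicateCol Unit x)ᵀ * M * replicateCol Unit y) () () = x ⬝ᵥ M *ᵥ y := by
  rw [Matrix.mul_assoc, ← replicateCol_mulVec]
  simp [Matrix.mul_apply, dotProduct]

variable [DecidableEq ι]

/-- Completion of the square on one-column matrices: the stage cost is the drop of `xᵀ P x` plus a
square that vanishes exactly on the feedback. Summation telescopes and yields both bounds for the
optimal cost. -/
theorem IsRiccati.stage_eq (hR : R.PosDef) (h : IsRiccati A B Q R K P) (x : ι → ℝ) (u : κ → ℝ) :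
    x ⬝ᵥ Q *ᵥ x + u ⬝ᵥ R *ᵥ u = x ⬝ᵥ P *ᵥ x - (A *ᵥ x + B *ᵥ u) ⬝ᵥ P *ᵥ (A *ᵥ x + B *ᵥ u) +
      (u - K *ᵥ x) ⬝ᵥ (R + Bᵀ * P * B) *ᵥ (u - K *ᵥ x) := by
  have h1 := congrFun₂ (complete_square h.posSemidef.transpose_eq hR.posSemidef.transpose_eq h.gain
    (replicateCol Unit x) (replicateCol Unit u)) () ()
  have h2 : Kᵀ * R * K + (A + B * K)ᵀ * P * (A + B * K) = P - Q := by
    rw [eq_sub_iff_add_eq', ← add_assoc]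
    exact h.cost.symm
  have h3 : replicateCol Unit u - replicateCol Unit (K *ᵥ x) = replicateCol Unit (u - K *ᵥ x) := rfl
  rw [h2, ← replicateCol_mulVec A x, ← replicateCol_mulVec B u, ← replicateCol_mulVec K x,
    ← replicateCol_add, h3] at h1
  rw [Matrix.add_apply, Matrix.add_apply, replicateCol_quadratic, replicateCol_quadratic, replicateCol_quadratic,
    replicateCol_quadratic, sub_mulVec P Q, dotProduct_sub] at h1
  linarith

theorem IsRiccati.sum_stage (hR : R.PosDef) (h : IsRiccati A B Q R K P) (x₀ : ι → ℝ)
    (u : ℕ → κ → ℝ) (T : ℕ) :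
    ∑ t ∈ Finset.range T,
      (lqrState A B x₀ u t ⬝ᵥ Q *ᵥ lqrState A B x₀ u t + u t ⬝ᵥ R *ᵥ u t) =
      x₀ ⬝ᵥ P *ᵥ x₀ - lqrState A B x₀ u T ⬝ᵥ P *ᵥ lqrState A B x₀ u T +
        ∑ t ∈ Finset.range T, (u t - K *ᵥ lqrState A B x₀ u t) ⬝ᵥ
          (R + Bᵀ * P * B) *ᵥ (u t - K *ᵥ lqrState A B x₀ u t) := by
  induction T with
  | zero => simp [lqrState]
  | succ T ih =>
    rw [Finset.sum_range_succ, ih, Finset.sum_range_succ, h.stage_eq hR, lqrState]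
    ring

theorem lqrState_feedbackInput (K : Matrix κ ι ℝ) (x₀ : ι → ℝ) (t : ℕ) :
    lqrState A B x₀ (feedbackInput A B K x₀) t = (A + B * K) ^ t *ᵥ x₀ := by
  induction t with
  | zero => simp [lqrState]
  | succ t ih =>
    rw [lqrState, ih, feedbackInput, pow_succ', ← mulVec_mulVec, add_mulVec,
      mulVec_mulVec _ B K]

theorem Matrix.PosSemidef.dotProduct_nonneg {α : Type*} [Fintype α] {D : Matrix α α ℝ}
    (hD : D.PosSemidef) (x : α → ℝ) : 0 ≤ x ⬝ᵥ D *ᵥ x := by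
  simpa using hD.dotProduct_mulVec_nonneg x

theorem stage_nonneg (hQ : Q.PosDef) (hR : R.PosDef) (x : ι → ℝ) (u : κ → ℝ) :
    0 ≤ x ⬝ᵥ Q *ᵥ x + u ⬝ᵥ R *ᵥ u :=
  add_nonneg (hQ.posSemidef.dotProduct_nonneg x) (hR.posSemidef.dotProduct_nonneg u)

/-- The optimal cost is attained by the Riccati gain. -/
theorem IsRiccati.lqrCost_feedbackInput_le (hQ : Q.PosDef) (hR : R.PosDef)
    (h : IsRiccati A B Q R K P) (x₀ : ι → ℝ) :
    lqrCost A B Q R x₀ (feedbackInput A B K x₀) ≤ ENNReal.ofReal (x₀ ⬝ᵥ P *ᵥ x₀) := by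
  refine ENNReal.tsum_le_of_sum_range_le fun T => ?_
  rw [← ENNReal.ofReal_sum_of_nonneg fun t _ => stage_nonneg hQ hR _ _]
  refine ENNReal.ofReal_le_ofReal ?_
  rw [h.sum_stage hR]
  simp only [lqrState_feedbackInput, feedbackInput, sub_self, mulVec_zero, dotProduct_zero,
    Finset.sum_const_zero]
  linarith [h.posSemidef.dotProduct_nonneg ((A + B * K) ^ T *ᵥ x₀)]

/-- Lower bound for the cost of an arbitrary input sequence; the second summand measures how far
its first input is from the Riccati feedback. -/
theorem IsRiccati.le_lqrCost (hQ : Q.PosDef) (hR : R.PosDef) (h : IsRiccati A B Q R K P)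
    (x₀ : ι → ℝ) (u : ℕ → κ → ℝ) :
    ENNReal.ofReal (x₀ ⬝ᵥ P *ᵥ x₀ + (u 0 - K *ᵥ x₀) ⬝ᵥ (R + Bᵀ * P * B) *ᵥ (u 0 - K *ᵥ x₀)) ≤
      lqrCost A B Q R x₀ u := by
  by_cases hfin : lqrCost A B Q R x₀ u = ⊤
  · rw [hfin]; exact le_top
  have hY := (posDef_hessian hR h.posSemidef B).posSemidef
  set c : ℕ → ℝ := fun t =>
    lqrState A B x₀ u t ⬝ᵥ Q *ᵥ lqrState A B x₀ u t + u t ⬝ᵥ R *ᵥ u t with hc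
  have hc₀ : ∀ t, 0 ≤ c t := fun t => stage_nonneg hQ hR _ _
  have hsum : Summable c := by
    have := ENNReal.summable_toReal hfin
    exact this.congr fun t => ENNReal.toReal_ofReal (hc₀ t)
  have htot : lqrCost A B Q R x₀ u = ENNReal.ofReal (∑' t, c t) :=
    (ENNReal.ofReal_tsum_of_nonneg hc₀ hsum).symm
  rw [htot]
  refine ENNReal.ofReal_le_ofReal ?_
  obtain ⟨q, hq, hQq⟩ := exists_coercive_of_posDef hQ
  -- Finite cost alone drives the state to zero, because `Q ≻ 0`; the input sequence need not come
  -- from a stabilizing feedback.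
  have hx : Tendsto (fun t => lqrState A B x₀ u t ⬝ᵥ P *ᵥ lqrState A B x₀ u t) atTop (𝓝 0) := by
    have h0 : Tendsto (fun t => P.trace * (q⁻¹ * c t)) atTop (𝓝 0) := by
      simpa using (hsum.tendsto_atTop_zero.const_mul q⁻¹).const_mul P.trace
    refine squeeze_zero (fun t => h.posSemidef.dotProduct_nonneg _) (fun t => ?_) h0
    set x := lqrState A B x₀ u t
    have h1 := (posSemidef_trace_smul_one_sub h.posSemidef).dotProduct_nonneg x
    have h2 := quad_lower hQq x
    have h3 := hR.posSemidef.dotProduct_nonneg (u t)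
    have h4 : x ⬝ᵥ x ≤ q⁻¹ * c t := by
      rw [← div_eq_inv_mul, le_div_iff₀ hq]
      simp only [hc]
      linarith
    simp only [sub_mulVec, smul_mulVec, one_mulVec, dotProduct_sub, dotProduct_smul,
      smul_eq_mul] at h1
    nlinarith [h.posSemidef.trace_nonneg]
  have hlim := hsum.hasSum.tendsto_sum_nat.add hx
  rw [add_zero] at hlim
  refine ge_of_tendsto hlim ?_
  filter_upwards [eventually_ge_atTop 1] with T hT
  have h1 := h.sum_stage hR x₀ u T
  -- Of the nonnegative squares only the one at `t = 0` is kept; it suffices for uniqueness.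
  have h2 := Finset.single_le_sum (f := fun t => (u t - K *ᵥ lqrState A B x₀ u t) ⬝ᵥ
    (R + Bᵀ * P * B) *ᵥ (u t - K *ᵥ lqrState A B x₀ u t)) (fun t _ => hY.dotProduct_nonneg _)
    (Finset.mem_range.mpr hT)
  simp only [lqrState] at h2
  simp only [hc]
  linarith

/-- The Riccati gain is the unique optimal gain. -/
theorem IsRiccati.isOptimalLQRGain_iff (hQ : Q.PosDef) (hR : R.PosDef)
    (h : IsRiccati A B Q R K P) (K' : Matrix κ ι ℝ) :
    IsOptimalLQRGain A B Q R K' ↔ K' = K := by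
  have hYpd := posDef_hessian hR h.posSemidef B
  have hY := hYpd.posSemidef
  constructor
  · intro ⟨_, hK'⟩
    -- From each basis vector the lower and upper bounds for the optimal cost meet, so the first
    -- input of an optimal gain agrees with that of `K`.
    refine Matrix.ext_of_mulVec_single fun j => ?_
    set x₀ : ι → ℝ := Pi.single j 1
    have h1 := (h.le_lqrCost hQ hR x₀ (feedbackInput A B K' x₀)).trans
      ((hK' x₀ _).trans (h.lqrCost_feedbackInput_le hQ hR x₀))
    rw [ENNReal.ofReal_le_ofReal_iff (h.posSemidef.dotProduct_nonneg x₀)] at h1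
    have h2 : feedbackInput A B K' x₀ 0 = K' *ᵥ x₀ := by simp [feedbackInput]
    rw [h2] at h1
    by_contra hne
    have h3 := hYpd.dotProduct_mulVec_pos (x := K' *ᵥ x₀ - K *ᵥ x₀) (sub_ne_zero.mpr hne)
    simp only [star_trivial] at h3
    linarith
  · rintro rfl
    refine ⟨h.isSchurStable hQ hR, fun x₀ u => (h.lqrCost_feedbackInput_le hQ hR x₀).trans
      ((ENNReal.ofReal_le_ofReal ?_).trans (h.le_lqrCost hQ hR x₀ u))⟩
    linarith [hY.dotProduct_nonneg (u 0 - K' *ᵥ x₀)]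

end Optimality

/-! ### Convergence of inexact policy iteration -/

section InexactPolicyIteration

variable {ι κ : Type*} [Fintype ι] [Fintype κ] [DecidableEq ι] [DecidableEq κ]
  {A : Matrix ι ι ℝ} {B : Matrix ι κ ℝ} {Q : Matrix ι ι ℝ} {R : Matrix κ κ ℝ}

/-- On the positive semidefinite cone the trace controls every entry. This turns trace gaps between
cost matrices into distances between parameters. -/
theorem linearMap_norm_le_trace {E : Type*} [NormedAddCommGroup E] [NormedSpace ℝ E]
    (T : Matrix ι ι ℝ →ₗ[ℝ] E) :
    ∃ M : ℝ, 0 ≤ M ∧ ∀ P : Matrix ι ι ℝ, P.PosSemidef → ‖T P‖ ≤ M * P.trace := by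
  refine ⟨∑ i, ∑ j, ‖T (single i j 1)‖, by positivity, fun P hP => ?_⟩
  have hP' : P = ∑ i, ∑ j, P i j • single i j (1 : ℝ) := by
    conv_lhs => rw [matrix_eq_sum_single P]
    simp
  conv_lhs => rw [hP']
  simp only [map_sum, map_smul]
  rw [Finset.sum_mul]
  refine (norm_sum_le _ _).trans (Finset.sum_le_sum fun i _ => ?_)
  rw [Finset.sum_mul]
  refine (norm_sum_le _ _).trans (Finset.sum_le_sum fun j _ => ?_)
  rw [norm_smul, mul_comm]
  gcongr
  exact hP.abs_apply_le_trace i j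

/-- Euclidean norm of a vector. -/
noncomputable def euclNorm {α : Type*} [Fintype α] (x : α → ℝ) : ℝ := ‖WithLp.toLp 2 x‖

theorem euclNorm_nonneg {α : Type*} [Fintype α] (x : α → ℝ) : 0 ≤ euclNorm x := norm_nonneg _

theorem euclNorm_sq {α : Type*} [Fintype α] (x : α → ℝ) : euclNorm x ^ 2 = x ⬝ᵥ x := by
  rw [euclNorm, EuclideanSpace.real_norm_sq_eq]
  simp [dotProduct, sq]

theorem dotProduct_le_euclNorm {α : Type*} [Fintype α] (x y : α → ℝ) :
    |x ⬝ᵥ y| ≤ euclNorm x * euclNorm y := by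
  have := abs_real_inner_le_norm (WithLp.toLp 2 x : EuclideanSpace ℝ α) (WithLp.toLp 2 y)
  rwa [EuclideanSpace.inner_toLp_toLp, star_trivial, dotProduct_comm] at this

open scoped Matrix.Norms.L2Operator

theorem euclNorm_mulVec_le {α β : Type*} [Fintype α] [Fintype β] [DecidableEq β]
    (M : Matrix α β ℝ) (x : β → ℝ) : euclNorm (M *ᵥ x) ≤ ‖M‖ * euclNorm x :=
  l2_opNorm_mulVec M (WithLp.toLp 2 x)

theorem quadratic_le_norm {α β : Type*} [Fintype α] [Fintype β] [DecidableEq β]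
    (M : Matrix α β ℝ) (x : α → ℝ) (y : β → ℝ) :
    |x ⬝ᵥ M *ᵥ y| ≤ ‖M‖ * euclNorm x * euclNorm y := by
  calc |x ⬝ᵥ M *ᵥ y| ≤ euclNorm x * euclNorm (M *ᵥ y) := dotProduct_le_euclNorm _ _
    _ ≤ euclNorm x * (‖M‖ * euclNorm y) := by
        gcongr
        · exact euclNorm_nonneg x
        · exact euclNorm_mulVec_le M y
    _ = _ := by ring

/-- Pairing `Y K' x = -N x` with `K' x` gives `r |K' x|² ≤ ‖N‖ |K' x| |x|`. -/
theorem exactGain_bound {Y : Matrix κ κ ℝ} {N K' : Matrix κ ι ℝ} {r : ℝ} (hr : 0 < r)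
    (hY : (Y - r • (1 : Matrix κ κ ℝ)).PosSemidef) (hK' : Y * K' = -N) (x : ι → ℝ) :
    euclNorm (K' *ᵥ x) ≤ ‖N‖ / r * euclNorm x := by
  have h1 := quad_lower hY (K' *ᵥ x)
  have h2 : (K' *ᵥ x) ⬝ᵥ Y *ᵥ (K' *ᵥ x) = -((K' *ᵥ x) ⬝ᵥ N *ᵥ x) := by
    rw [mulVec_mulVec, hK', neg_mulVec, dotProduct_neg]
  have h3 := neg_le_of_abs_le (quadratic_le_norm N (K' *ᵥ x) x)
  rw [← euclNorm_sq] at h1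
  rw [div_mul_eq_mul_div, le_div_iff₀ hr]
  by_contra! hlt
  have h4 : 0 < euclNorm (K' *ᵥ x) := by
    by_contra! h0
    have h5 : euclNorm (K' *ᵥ x) = 0 := le_antisymm h0 (euclNorm_nonneg _)
    rw [h5, zero_mul] at hlt
    exact absurd hlt (not_lt.mpr (mul_nonneg (norm_nonneg _) (euclNorm_nonneg _)))
  nlinarith

/-- Perturbation bound for the improved gain. -/
theorem perturbed_gain {Y Y' : Matrix κ κ ℝ} {N N' K' K'' : Matrix κ ι ℝ} {r ε k : ℝ} (hr : 0 < r)
    (hY : (Y - r • (1 : Matrix κ κ ℝ)).PosSemidef) (hYs : Yᵀ = Y) (hK' : Y * K' = -N)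
    (hk : ‖N‖ / r ≤ k)
    (hεr : ε ≤ r / 2) (hεY : ‖Y' - Y‖ ≤ ε) (hεN : ‖N' - N‖ ≤ ε) (hK'' : Y' * K'' = -N') :
    ((2 * ε * (1 + k) ^ 2) • (1 : Matrix ι ι ℝ) - (K'' - K')ᵀ * Y * (K'' - K')).PosSemidef := by
  refine .of_dotProduct_mulVec_nonneg ?_ fun x => ?_
  · simp [IsHermitian, hYs, Matrix.mul_assoc]
  have hε : 0 ≤ ε := (norm_nonneg _).trans hεY
  have hk0 : 0 ≤ k := (by positivity : 0 ≤ ‖N‖ / r).trans hk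
  set y := (K'' - K') *ᵥ x with hy
  have h1 : x ⬝ᵥ ((K'' - K')ᵀ * Y * (K'' - K')) *ᵥ x = y ⬝ᵥ Y *ᵥ y := by
    rw [Matrix.mul_assoc, ← mulVec_mulVec, ← mulVec_mulVec, mulVec_transpose, dotProduct_comm,
      ← dotProduct_mulVec, dotProduct_comm]
  -- The difference of the two gain equations. The last term still contains the unknown `K'' - K'`;
  -- it will be absorbed thanks to `ε ≤ r / 2`.
  have h2 : Y * (K'' - K') = -(N' - N) - (Y' - Y) * K' - (Y' - Y) * (K'' - K') := by
    rw [Matrix.mul_sub, hK', Matrix.sub_mul, Matrix.sub_mul, Matrix.mul_sub, Matrix.mul_sub, hK'',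
      hK']
    abel
  have h3 : y ⬝ᵥ Y *ᵥ y =
      -(y ⬝ᵥ (N' - N) *ᵥ x) - y ⬝ᵥ (Y' - Y) *ᵥ (K' *ᵥ x) - y ⬝ᵥ (Y' - Y) *ᵥ y := by
    conv_lhs => rw [hy, mulVec_mulVec, h2, ← hy]
    rw [sub_mulVec, sub_mulVec, neg_mulVec, dotProduct_sub, dotProduct_sub, dotProduct_neg,
      ← mulVec_mulVec, ← mulVec_mulVec, ← hy]
  have hx0 := euclNorm_nonneg x
  have hy0 := euclNorm_nonneg y
  have hK'x := exactGain_bound hr hY hK' x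
  have b1 := neg_le_of_abs_le (quadratic_le_norm (N' - N) y x)
  have b2 := neg_le_of_abs_le (quadratic_le_norm (Y' - Y) y (K' *ᵥ x))
  have b3 := neg_le_of_abs_le (quadratic_le_norm (Y' - Y) y y)
  have c1 : ‖N' - N‖ * euclNorm y * euclNorm x ≤ ε * euclNorm y * euclNorm x := by gcongr
  have c2 : ‖Y' - Y‖ * euclNorm y * euclNorm (K' *ᵥ x) ≤ ε * euclNorm y * (k * euclNorm x) := by
    have : euclNorm (K' *ᵥ x) ≤ k * euclNorm x := hK'x.trans (by gcongr)
    gcongr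
    exact euclNorm_nonneg _
  have c3 : ‖Y' - Y‖ * euclNorm y * euclNorm y ≤ ε * euclNorm y * euclNorm y := by gcongr
  have h4 : y ⬝ᵥ Y *ᵥ y ≤ ε * euclNorm y * ((1 + k) * euclNorm x + euclNorm y) := by
    rw [h3]; linarith
  have h5 : r * euclNorm y ^ 2 ≤ y ⬝ᵥ Y *ᵥ y := by rw [euclNorm_sq]; exact quad_lower hY y
  -- If `|y|` exceeded `(1 + k) |x|`, then `h4` would give `yᵀ Y y < 2 ε |y|² ≤ r |y|²`, against
  -- `h5`. Inserting the bound back into `h4` produces the constant `2 ε (1 + k)²`.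
  have hyb : euclNorm y ≤ (1 + k) * euclNorm x := by
    by_contra! hlt
    have h6 : 0 ≤ (1 + k) * euclNorm x := by positivity
    nlinarith [mul_le_mul_of_nonneg_right hεr (mul_nonneg hy0 hy0),
      mul_nonneg (mul_nonneg hε hy0) (sub_nonneg.mpr hlt.le),
      mul_pos hr (sq_pos_of_pos (h6.trans_lt hlt))]
  have h6 : ε * euclNorm y * ((1 + k) * euclNorm x + euclNorm y) ≤
      ε * ((1 + k) * euclNorm x) * ((1 + k) * euclNorm x + (1 + k) * euclNorm x) := by gcongr
  rw [star_trivial, sub_mulVec, dotProduct_sub, h1, smul_mulVec, one_mulVec, dotProduct_smul,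
    ← euclNorm_sq, smul_eq_mul]
  linarith

theorem coercive_of_norm_sub_le {Y Y' : Matrix κ κ ℝ} {r : ℝ} (hr : 0 < r)
    (hY : (Y - r • (1 : Matrix κ κ ℝ)).PosSemidef) (h : ‖Y' - Y‖ ≤ r / 2) (u : κ → ℝ)
    (hu : u ≠ 0) : 0 < u ⬝ᵥ Y' *ᵥ u := by
  have h1 := quad_lower hY u
  have h2 := neg_le_of_abs_le (quadratic_le_norm (Y' - Y) u u)
  have h3 : u ⬝ᵥ Y' *ᵥ u = u ⬝ᵥ Y *ᵥ u + u ⬝ᵥ (Y' - Y) *ᵥ u := by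
    rw [sub_mulVec, dotProduct_sub]; ring
  have h4 : 0 < u ⬝ᵥ u := by
    obtain ⟨i, hi⟩ := Function.ne_iff.mp hu
    exact (sq_pos_of_ne_zero hi).trans_le (sq_le_dotProduct_self u i)
  have h5 : ‖Y' - Y‖ * euclNorm u * euclNorm u ≤ r / 2 * (u ⬝ᵥ u) := by
    rw [mul_assoc, ← sq, euclNorm_sq]
    gcongr
  nlinarith

/-- On a sublevel set of the cost, an inexact policy improvement is a perturbation of the exact one
whose effect is linear in the evaluation error `‖θ - (T P + c₀)‖`. -/
theorem inexact_improvement_bound {E : Type*} [NormedAddCommGroup E] [NormedSpace ℝ E]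
    [FiniteDimensional ℝ E] (A : Matrix ι ι ℝ) (B : Matrix ι κ ℝ) (hQ : Q.PosDef) (hR : R.PosDef)
    (rY : E →ₗ[ℝ] Matrix κ κ ℝ) (rZ : E →ₗ[ℝ] Matrix κ ι ℝ) {c : ℝ} (hc : 0 ≤ c) :
    ∃ C η : ℝ, 0 < C ∧ 0 < η ∧ C * η ≤ 1 / 2 ∧ ∀ (P : Matrix ι ι ℝ) (θ θ' : E), P.PosSemidef →
      P.trace ≤ c → rY θ = R + Bᵀ * P * B → rZ θ = Bᵀ * P * A → ‖θ' - θ‖ ≤ η →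
      (∀ u ≠ 0, 0 < u ⬝ᵥ rY θ' *ᵥ u) ∧
      ∀ K' K'' : Matrix κ ι ℝ, (R + Bᵀ * P * B) * K' = -(Bᵀ * P * A) → rY θ' * K'' = -rZ θ' →
        ((C * ‖θ' - θ‖) • Q - (K'' - K')ᵀ * (R + Bᵀ * P * B) * (K'' - K')).PosSemidef := by
  obtain ⟨q, hq, hQq⟩ := exists_coercive_of_posDef hQ
  obtain ⟨r, hr, hRr⟩ := exists_coercive_of_posDef hR
  let N : Matrix ι ι ℝ →ₗ[ℝ] Matrix κ ι ℝ :=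
    (mulRightLinearMap κ ℝ A).comp (mulLeftLinearMap ι ℝ Bᵀ)
  have hN : ∀ P, N P = Bᵀ * P * A := fun P => rfl
  obtain ⟨b, hb, hNb⟩ := linearMap_norm_le_trace N
  set fY := LinearMap.toContinuousLinearMap rY with hfY
  set fZ := LinearMap.toContinuousLinearMap rZ with hfZ
  -- A common Lipschitz constant of both readouts, made positive by the `1`. Below, `k` bounds the
  -- exactly improved gain on the sublevel set, and the division by `q` in `C` converts a multiple
  -- of the identity into one of `Q`.
  set C₁ : ℝ := ‖fY‖ + ‖fZ‖ + 1 with hC₁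
  have hC₁pos : 0 < C₁ := by positivity
  set k : ℝ := b * c / r with hk
  have hk0 : 0 ≤ k := by positivity
  set C : ℝ := 2 * C₁ * (1 + k) ^ 2 / q with hC
  have hCpos : 0 < C := by positivity
  -- The first bound keeps the perturbation of the Hessian below `r / 2`; the second keeps `α = C
  -- ‖θ' - θ‖` at most `1 / 2`.
  refine ⟨C, min (r / 2 / C₁) (1 / 2 / C), hCpos, by positivity, ?_, ?_⟩
  · calc C * min (r / 2 / C₁) (1 / 2 / C) ≤ C * (1 / 2 / C) := by gcongr; exact min_le_right _ _
      _ = 1 / 2 := by field_simp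
  intro P θ θ' hP ht hY hZ hθ
  have hYd : ‖rY θ' - (R + Bᵀ * P * B)‖ ≤ C₁ * ‖θ' - θ‖ := by
    rw [← hY, ← map_sub]
    refine (fY.le_opNorm (θ' - θ)).trans ?_
    gcongr
    rw [hC₁]
    linarith [norm_nonneg fZ]
  have hZd : ‖rZ θ' - Bᵀ * P * A‖ ≤ C₁ * ‖θ' - θ‖ := by
    rw [← hZ, ← map_sub]
    refine (fZ.le_opNorm (θ' - θ)).trans ?_
    gcongr
    rw [hC₁]
    linarith [norm_nonneg fY]
  have hsmall : C₁ * ‖θ' - θ‖ ≤ r / 2 := by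
    have := hθ.trans (min_le_left _ _)
    rwa [le_div_iff₀' hC₁pos] at this
  have hYr : (R + Bᵀ * P * B - r • (1 : Matrix κ κ ℝ)).PosSemidef := by
    rw [add_sub_right_comm]
    exact hRr.add (hP.transpose_mul_mul_same B)
  refine ⟨coercive_of_norm_sub_le hr hYr (hYd.trans hsmall), fun K' K'' hK' hK'' => ?_⟩
  have hkN : ‖Bᵀ * P * A‖ / r ≤ k := by
    rw [hk]
    gcongr
    calc ‖Bᵀ * P * A‖ ≤ b * P.trace := by rw [← hN]; exact hNb P hP
      _ ≤ b * c := by gcongr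
  have h1 := perturbed_gain hr hYr (posDef_hessian hR hP B).posSemidef.transpose_eq hK' hkN hsmall
    hYd hZd hK''
  have h2 := (hQq.smul (by positivity : 0 ≤ C * ‖θ' - θ‖)).add h1
  convert h2 using 1
  have h3 : 2 * (C₁ * ‖θ' - θ‖) * (1 + k) ^ 2 = C * ‖θ' - θ‖ * q := by
    rw [hC]; field_simp
  rw [h3, smul_sub, smul_smul]
  abel

/-- Linear convergence of two coupled error sequences: `v` is the gap of the cost, `e` the
evaluation error. -/
theorem exists_geometric_rates {ρ C η₀ M Vs v₀ : ℝ} (hρ : 0 ≤ ρ) (hρ1 : ρ < 1) (hC : 0 < C)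
    (hη₀ : 0 < η₀) (hCη : C * η₀ ≤ 1 / 2) (hM : 0 ≤ M) (hVs : 0 ≤ Vs) (hv₀ : 0 < v₀) (e₀ : ℝ)
    (he₀ : 0 ≤ e₀) :
    ∃ η lam δ : ℝ, 0 < η ∧ η ≤ η₀ ∧ 0 < lam ∧ lam < 1 ∧ 0 < δ ∧ δ * e₀ ≤ η ∧
      ∀ μ v v' e e' : ℝ, 0 ≤ μ → μ ≤ 1 → v ≤ v₀ * μ → 0 ≤ e → e ≤ η * μ →
        (1 - C * e) * v' ≤ ρ * v + C * e * Vs → 0 ≤ v' →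
        (v' ≤ v₀ * (lam * μ) ∧ (e' ≤ δ * (e + M * (v + v')) → e' ≤ η * (lam * μ))) := by
  -- A rate strictly between `ρ` and `1`; the slack `lam - ρ` pays for the evaluation error.
  set lam := (1 + ρ) / 2 with hlam
  have hl0 : 0 < lam := by positivity
  have hl1 : lam < 1 := by rw [hlam]; linarith
  have hρl : 0 < lam - ρ := by rw [hlam]; linarith
  -- Chosen so that the error terms `C e (Vs + v')` fit into this slack.
  set η := min η₀ (v₀ * (lam - ρ) / (C * (Vs + v₀ * lam))) with hη
  have hηpos : 0 < η := by positivity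
  have hη1 : C * η * (Vs + v₀ * lam) ≤ v₀ * (lam - ρ) := by
    have := min_le_right η₀ (v₀ * (lam - ρ) / (C * (Vs + v₀ * lam)))
    rw [← hη, le_div_iff₀ (by positivity)] at this
    linarith
  have hη2 : C * η ≤ 1 / 2 := by
    refine le_trans ?_ hCη
    gcongr
    exact min_le_left _ _
  -- The first entry carries the bound on `e` over to the next iteration; the second brings the
  -- error `e₀` of the initial guess below `η`, with `+ 1` since `e₀` may vanish.
  set δ := min (η * lam / (η + M * (2 * v₀))) (η / (e₀ + 1)) with hδ
  have hδpos : 0 < δ := by positivity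
  have hδ1 : δ * (η + M * (2 * v₀)) ≤ η * lam := by
    have := min_le_left (η * lam / (η + M * (2 * v₀))) (η / (e₀ + 1))
    rwa [← hδ, le_div_iff₀ (by positivity)] at this
  have hδ2 : δ * (e₀ + 1) ≤ η := by
    have := min_le_right (η * lam / (η + M * (2 * v₀))) (η / (e₀ + 1))
    rwa [← hδ, le_div_iff₀ (by positivity)] at this
  refine ⟨η, lam, δ, hηpos, min_le_left _ _, hl0, hl1, hδpos, by linarith, ?_⟩
  intro μ v v' e e' hμ0 hμ1 hv he0 he hv' hv'0
  have hCe : C * e ≤ C * η * μ := by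
    calc C * e ≤ C * (η * μ) := by gcongr
      _ = _ := by ring
  have hCe' : C * e ≤ 1 / 2 := by
    refine hCe.trans (le_trans ?_ hη2)
    exact mul_le_of_le_one_right (by positivity) hμ1
  have key : v' ≤ v₀ * (lam * μ) := by
    have h1 : (1 - C * e) * v' ≤ (1 - C * e) * (v₀ * (lam * μ)) := by
      refine hv'.trans ?_
      have h2 : ρ * v ≤ ρ * (v₀ * μ) := by gcongr
      have h3 : C * e * (Vs + v₀ * (lam * μ)) ≤ C * η * μ * (Vs + v₀ * lam) := by
        have : v₀ * (lam * μ) ≤ v₀ * lam := by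
          gcongr
          exact mul_le_of_le_one_right hl0.le hμ1
        gcongr
      have h4 := mul_le_mul_of_nonneg_right hη1 hμ0
      nlinarith
    exact le_of_mul_le_mul_left h1 (by linarith)
  refine ⟨key, fun he' => he'.trans ?_⟩
  have h5 : v₀ * (lam * μ) ≤ v₀ * μ := by
    gcongr
    exact mul_le_of_le_one_left hμ0 hl1.le
  calc δ * (e + M * (v + v')) ≤ δ * (η * μ + M * (v₀ * μ + v₀ * μ)) := by gcongr; linarith
    _ = δ * (η + M * (2 * v₀)) * μ := by ring
    _ ≤ η * lam * μ := by gcongr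
    _ = _ := by ring

/-- Inexact policy iteration: if the evaluation contracts the error of the warm-started estimate
by a small enough factor, then the estimates converge to the one of the optimal policy. -/
theorem inexact_policy_iteration {E : Type*} [NormedAddCommGroup E] [NormedSpace ℝ E]
    [FiniteDimensional ℝ E] (hQ : Q.PosDef) (hR : R.PosDef) {Ks : Matrix κ ι ℝ}
    {Ps : Matrix ι ι ℝ} (hs : IsRiccati A B Q R Ks Ps) (T : Matrix ι ι ℝ →ₗ[ℝ] E) (c₀ : E)
    (rY : E →ₗ[ℝ] Matrix κ κ ℝ) (rZ : E →ₗ[ℝ] Matrix κ ι ℝ) (𝒦 : Set (Matrix κ ι ℝ))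
    (h𝒦 : ∀ K ∈ 𝒦, IsSchurStable (A + B * K) → ∀ P, IsPolicyCost A B Q R K P →
      rY (T P + c₀) = R + Bᵀ * P * B ∧ rZ (T P + c₀) = Bᵀ * P * A)
    {K₁ : Matrix κ ι ℝ} (hK₁ : K₁ ∈ 𝒦) (hK₁s : IsSchurStable (A + B * K₁)) (θ₀ : E) :
    ∃ δ : ℝ, 0 < δ ∧ ∀ (K : ℕ → Matrix κ ι ℝ) (θ : ℕ → E), K 0 = K₁ → θ 0 = θ₀ →
      (∀ k P, K k ∈ 𝒦 → IsSchurStable (A + B * K k) → IsPolicyCost A B Q R (K k) P →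
        ‖θ (k + 1) - (T P + c₀)‖ ≤ δ * ‖θ k - (T P + c₀)‖) →
      (∀ k, (∀ u ≠ 0, 0 < u ⬝ᵥ rY (θ (k + 1)) *ᵥ u) →
        K (k + 1) ∈ 𝒦 ∧ rY (θ (k + 1)) * K (k + 1) = -rZ (θ (k + 1))) →
      Tendsto θ atTop (𝓝 (T Ps + c₀)) := by
  -- `PI` sums the squared states along the optimal closed loop. Its trace governs the contraction
  -- factor `ρ` of policy iteration.
  obtain ⟨PI, hPI, -⟩ := existsUnique_lyapunov (hs.isSchurStable hQ hR) 1
  obtain ⟨P₁, hP₁⟩ := exists_policyCost (Q := Q) (R := R) hK₁s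
  obtain ⟨M, hM, hTM⟩ := linearMap_norm_le_trace T
  have hPIpsd : PI.PosSemidef := by
    refine posSemidef_of_lyapunov (hs.isSchurStable hQ hR) ?_
    rw [sub_eq_of_eq_add hPI]
    exact .one
  set s : ℝ := PI.trace + 1 with hsdef
  have hs1 : 1 ≤ s := by linarith [hPIpsd.trace_nonneg]
  set ρ : ℝ := 1 - 1 / s with hρ
  have hρ0 : 0 ≤ ρ := by
    rw [hρ, sub_nonneg, div_le_one (by linarith)]
    exact hs1
  have hρ1 : ρ < 1 := by rw [hρ]; linarith [(by positivity : 0 < 1 / s)]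
  set Vs := Ps.trace with hVs
  have hVs0 : 0 ≤ Vs := hs.posSemidef.trace_nonneg
  have hgap₁ := (hs.le_cost hR hK₁s hP₁).trace_nonneg
  set v₀ : ℝ := (P₁ - Ps).trace + 1 with hv₀
  have hv₀pos : 0 < v₀ := by linarith
  obtain ⟨C, η₀, hC, hη₀, hCη, himp⟩ := inexact_improvement_bound A B hQ hR rY rZ
    (by positivity : 0 ≤ Vs + v₀)
  obtain ⟨η, lam, δ, hη, hηη₀, hlam0, hlam1, hδ, hδ₀, hrate⟩ := exists_geometric_rates hρ0 hρ1 hC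
    hη₀ hCη hM hVs0 hv₀pos ‖θ₀ - (T P₁ + c₀)‖ (norm_nonneg _)
  refine ⟨δ, hδ, fun K θ hK0 hθ0 heval himprove => ?_⟩
  -- The index is shifted: `θ (k + 1)` is the estimate for the policy `K k`, and `θ k` is its warm
  -- start.
  have hinv : ∀ k, K k ∈ 𝒦 ∧ IsSchurStable (A + B * K k) ∧ ∃ P, IsPolicyCost A B Q R (K k) P ∧
      (P - Ps).trace ≤ v₀ * lam ^ k ∧ ‖θ (k + 1) - (T P + c₀)‖ ≤ η * lam ^ k := by
    intro k
    induction k with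
    | zero =>
      refine ⟨by rwa [hK0], by rwa [hK0], P₁, by rwa [hK0], by simp [hv₀], ?_⟩
      have := heval 0 P₁ (by rwa [hK0]) (by rwa [hK0]) (by rwa [hK0])
      rw [hθ0] at this
      rw [pow_zero, mul_one]
      exact this.trans hδ₀
    | succ k ih =>
      obtain ⟨hmem, hst, P, hcost, hv, he⟩ := ih
      have hPpsd := hcost.posSemidef hQ hR hst
      have hpow1 : lam ^ k ≤ 1 := pow_le_one₀ hlam0.le hlam1.le
      have hpow0 : 0 ≤ lam ^ k := by positivity
      obtain ⟨hYeq, hZeq⟩ := h𝒦 _ hmem hst P hcost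
      have htr : P.trace ≤ Vs + v₀ := by
        rw [trace_sub] at hv
        nlinarith
      have heη : ‖θ (k + 1) - (T P + c₀)‖ ≤ η := he.trans (mul_le_of_le_one_right hη.le hpow1)
      obtain ⟨hcoer, hpert⟩ := himp P _ _ hPpsd htr hYeq hZeq (heη.trans hηη₀)
      obtain ⟨hmem', hgain⟩ := himprove k hcoer
      obtain ⟨K', hK'⟩ := exists_improved_gain hR hPpsd A B
      have hδK := hpert K' _ hK' hgain
      set e := ‖θ (k + 1) - (T P + c₀)‖ with hedef
      have he0 : 0 ≤ e := norm_nonneg _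
      have hCe : C * e ≤ 1 / 2 := le_trans (by gcongr; exact heη.trans hηη₀) hCη
      have hst' := inexact_improvement_isSchurStable hQ hR hPpsd hcost hK' (by linarith) hδK
      obtain ⟨P'', hcost''⟩ := exists_policyCost (Q := Q) (R := R) hst'
      have hdec := inexact_improvement_cost hQ hR hPpsd hcost hK' (by positivity) (by linarith) hδK
        hcost''
      have hgap := hs.trace_gap_le hQ hR hPI hPpsd hcost hK' hdec
      have hΔ : 0 ≤ (P - (1 - C * e) • P'').trace := by
        have := trace_le_of_posSemidef_sub hdec
        exact ((posDef_hessian hR hPpsd B).posSemidef.transpose_mul_mul_same _).trace_nonneg.trans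
          this
      have hv'0 := (hs.le_cost hR hst' hcost'').trace_nonneg
      have hv0 := (hs.le_cost hR hst hcost).trace_nonneg
      have hrec : (1 - C * e) * (P'' - Ps).trace ≤ ρ * (P - Ps).trace + C * e * Vs := by
        -- The gap is at most `s` times the decrease of the cost; rearranged, the decrease removes
        -- the fraction `1 / s` of the gap.
        have h1 : (P - Ps).trace / s ≤ (P - (1 - C * e) • P'').trace := by
          rw [div_le_iff₀ (by linarith)]
          refine hgap.trans ?_
          gcongr
          linarith
        have h0 : ρ * (P - Ps).trace = (P - Ps).trace - (P - Ps).trace / s := by rw [hρ]; ring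
        rw [h0]
        rw [trace_sub P ((1 - C * e) • P''), trace_smul, smul_eq_mul] at h1
        have h2 : (P - Ps).trace = P.trace - Vs := trace_sub _ _
        have h3 : (P'' - Ps).trace = P''.trace - Vs := trace_sub _ _
        rw [h3]
        linarith
      obtain ⟨hv', he'⟩ := hrate (lam ^ k) _ _ e ‖θ (k + 1 + 1) - (T P'' + c₀)‖ hpow0 hpow1 hv he0
        he hrec hv'0
      rw [pow_succ']
      refine ⟨hmem', hst', P'', hcost'', hv', he' ?_⟩
      refine (heval (k + 1) P'' hmem' hst' hcost'').trans ?_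
      gcongr
      -- The target moves from the parameter of `P` to that of `P''`. Going through `Ps` bounds this
      -- shift by the two trace gaps.
      have h4 : θ (k + 1) - (T P'' + c₀) =
          (θ (k + 1) - (T P + c₀)) + (T (P - Ps) - T (P'' - Ps)) := by
        simp only [map_sub]
        abel
      rw [h4]
      refine (norm_add_le _ _).trans ?_
      gcongr
      refine (norm_sub_le _ _).trans ?_
      rw [mul_add]
      exact add_le_add (hTM _ (hs.le_cost hR hst hcost)) (hTM _ (hs.le_cost hR hst' hcost''))
  rw [← tendsto_add_atTop_iff_nat 1, tendsto_iff_norm_sub_tendsto_zero]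
  have hlim : Tendsto (fun k => (η + M * v₀) * lam ^ k) atTop (𝓝 0) := by
    simpa using (tendsto_pow_atTop_nhds_zero_of_lt_one hlam0.le hlam1).const_mul (η + M * v₀)
  refine squeeze_zero (fun _ => norm_nonneg _) (fun k => ?_) hlim
  obtain ⟨_, hst, P, hcost, hv, he⟩ := hinv k
  have h4 : θ (k + 1) - (T Ps + c₀) = (θ (k + 1) - (T P + c₀)) + T (P - Ps) := by
    simp only [map_sub]
    abel
  rw [h4]
  refine (norm_add_le _ _).trans ?_
  rw [add_mul, mul_assoc]
  refine add_le_add he ((hTM _ (hs.le_cost hR hst hcost)).trans ?_)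
  gcongr

end InexactPolicyIteration

/-! ### Patterned matrices and their modes -/

section Modes

/-- The averaging projection `d⁻¹ 𝟙 𝟙ᵀ`. -/
noncomputable def avgProj (d : ℕ) : Matrix (Fin d) (Fin d) ℝ := of fun _ _ => (d : ℝ)⁻¹

/-- The patterned matrix that acts as `M` on consensus vectors and as `N` on disagreement
vectors. -/
noncomputable def modes (d : ℕ) {α β : Type*} (M N : Matrix α β ℝ) :
    Matrix (Fin d × α) (Fin d × β) ℝ :=
  avgProj d ⊗ₖ M + (1 - avgProj d) ⊗ₖ N

variable {d : ℕ} {α β γ : Type*}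

theorem avgProj_mul_self (hd : d ≠ 0) : avgProj d * avgProj d = avgProj d := by
  ext i j
  have : (d : ℝ) ≠ 0 := by exact_mod_cast hd
  simp [avgProj, Matrix.mul_apply, this]

theorem avgProj_transpose : (avgProj d)ᵀ = avgProj d := rfl

theorem one_sub_avgProj_mul_self (hd : d ≠ 0) :
    (1 - avgProj d) * (1 - avgProj d) = 1 - avgProj d := by
  rw [Matrix.sub_mul, Matrix.mul_sub, Matrix.mul_sub, avgProj_mul_self hd]
  simp

theorem avgProj_posSemidef (hd : d ≠ 0) : (avgProj d).PosSemidef := by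
  have h := posSemidef_conjTranspose_mul_self (avgProj d)
  rwa [conjTranspose_eq_transpose_of_trivial, avgProj_transpose, avgProj_mul_self hd] at h

theorem one_sub_avgProj_posSemidef (hd : d ≠ 0) : (1 - avgProj d).PosSemidef := by
  have h := posSemidef_conjTranspose_mul_self (1 - avgProj d)
  rwa [conjTranspose_eq_transpose_of_trivial, transpose_sub, transpose_one, avgProj_transpose,
    one_sub_avgProj_mul_self hd] at h

/-- `avgProj` and its complement are idempotents with product zero, so patterned matrices multiply
mode by mode. Stability, Lyapunov and Riccati equations all decouple for this reason. -/
theorem modes_mul [Fintype β] (hd : d ≠ 0) (M N : Matrix α β ℝ) (M' N' : Matrix β γ ℝ) :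
    modes d M N * modes d M' N' = modes d (M * M') (N * N') := by
  simp only [modes, Matrix.mul_add, Matrix.add_mul, ← mul_kronecker_mul]
  have h1 : avgProj d * (1 - avgProj d) = 0 := by
    rw [Matrix.mul_sub, avgProj_mul_self hd, Matrix.mul_one, sub_self]
  have h2 : (1 - avgProj d) * avgProj d = 0 := by
    rw [Matrix.sub_mul, avgProj_mul_self hd, Matrix.one_mul, sub_self]
  rw [h1, h2, avgProj_mul_self hd, one_sub_avgProj_mul_self hd]
  simp

theorem modes_add (M N M' N' : Matrix α β ℝ) :
    modes d M N + modes d M' N' = modes d (M + M') (N + N') := by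
  simp only [modes, kronecker_add]
  abel

theorem modes_neg (M N : Matrix α β ℝ) : -modes d M N = modes d (-M) (-N) := by
  have h := modes_add (d := d) M N (-M) (-N)
  rw [add_neg_cancel, add_neg_cancel] at h
  refine neg_eq_of_add_eq_zero_right (h.trans ?_)
  simp [modes]

theorem modes_transpose (M N : Matrix α β ℝ) : (modes d M N)ᵀ = modes d Mᵀ Nᵀ := by
  ext ⟨i, k⟩ ⟨j, l⟩
  simp [modes, avgProj, Matrix.one_apply, eq_comm]

theorem modes_self (M : Matrix α β ℝ) : modes d M M = (1 : Matrix (Fin d) (Fin d) ℝ) ⊗ₖ M := by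
  rw [modes, ← add_kronecker, add_sub_cancel]

theorem modes_one [DecidableEq α] : modes d (1 : Matrix α α ℝ) 1 = 1 := by
  rw [modes_self, one_kronecker_one]

theorem modes_pow [Fintype α] [DecidableEq α] (hd : d ≠ 0) (M N : Matrix α α ℝ) (t : ℕ) :
    modes d M N ^ t = modes d (M ^ t) (N ^ t) := by
  induction t with
  | zero => simp [modes_one]
  | succ t ih => rw [pow_succ, ih, modes_mul hd, pow_succ, pow_succ]

theorem modes_posSemidef [Finite α] (hd : d ≠ 0) {M N : Matrix α α ℝ} (hM : M.PosSemidef)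
    (hN : N.PosSemidef) : (modes d M N).PosSemidef := by
  classical
  have := Fintype.ofFinite α
  exact ((avgProj_posSemidef hd).kronecker hM).add ((one_sub_avgProj_posSemidef hd).kronecker hN)

theorem modes_self_posDef [Finite α] {M : Matrix α α ℝ} (hM : M.PosDef) : (modes d M M).PosDef := by
  classical
  have := Fintype.ofFinite α
  rw [modes_self]
  exact PosDef.one.kronecker hM

/-- `𝟙 𝟙ᵀ` is `d` on consensus and `0` on disagreement vectors. -/
theorem patterned_eq_modes (hd : d ≠ 0) {a b : ℕ} (M N : Matrix (Fin a) (Fin b) ℝ) :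
    patterned d M N = modes d (M + ((d : ℝ) - 1) • N) (M - N) := by
  ext ⟨i, k⟩ ⟨j, l⟩
  have : (d : ℝ) ≠ 0 := by exact_mod_cast hd
  simp only [patterned, modes, avgProj, Matrix.add_apply, kronecker_apply, Matrix.sub_apply,
    of_apply, Matrix.smul_apply, smul_eq_mul]
  field_simp
  ring

variable {a b : ℕ}

/-- The consensus mode, read off the blocks in the positions `(1, 1)` and `(1, 2)`. -/
noncomputable def consensusMode (hd : 2 ≤ d) :
    Matrix (Fin d × Fin a) (Fin d × Fin b) ℝ →ₗ[ℝ] Matrix (Fin a) (Fin b) ℝ where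
  toFun M := D3PI.block M ⟨0, by omega⟩ ⟨0, by omega⟩ +
    ((d : ℝ) - 1) • D3PI.block M ⟨0, by omega⟩ ⟨1, by omega⟩
  map_add' M N := by
    ext
    simp [D3PI.block]
    ring
  map_smul' c M := by
    ext
    simp [D3PI.block]
    ring

/-- The disagreement mode, read off the blocks in the positions `(1, 1)` and `(1, 2)`. -/
noncomputable def disagreementMode (hd : 2 ≤ d) :
    Matrix (Fin d × Fin a) (Fin d × Fin b) ℝ →ₗ[ℝ] Matrix (Fin a) (Fin b) ℝ where
  toFun M := D3PI.block M ⟨0, by omega⟩ ⟨0, by omega⟩ -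
    D3PI.block M ⟨0, by omega⟩ ⟨1, by omega⟩
  map_add' M N := by
    ext
    simp [D3PI.block]
    ring
  map_smul' c M := by
    ext
    simp [D3PI.block]
    ring

theorem consensusMode_modes (hd : 2 ≤ d) (M N : Matrix (Fin a) (Fin b) ℝ) :
    consensusMode hd (modes d M N) = M := by
  have : (d : ℝ) ≠ 0 := by
    have : d ≠ 0 := by omega
    exact_mod_cast this
  ext
  simp [consensusMode, modes, D3PI.block, avgProj]
  field_simp
  ring

theorem disagreementMode_modes (hd : 2 ≤ d) (M N : Matrix (Fin a) (Fin b) ℝ) :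
    disagreementMode hd (modes d M N) = N := by
  ext
  simp [disagreementMode, modes, D3PI.block, avgProj]
  ring

/-- The patterned matrix with the same blocks in the positions `(1, 1)` and `(1, 2)`. -/
noncomputable def patternize (hd : 2 ≤ d) :
    Matrix (Fin d × Fin a) (Fin d × Fin b) ℝ →ₗ[ℝ] Matrix (Fin d × Fin a) (Fin d × Fin b) ℝ where
  toFun M := modes d (consensusMode hd M) (disagreementMode hd M)
  map_add' M N := by rw [map_add, map_add, modes_add]
  map_smul' c M := by simp [modes, kronecker_smul]

theorem patternize_apply (hd : 2 ≤ d) (M : Matrix (Fin d × Fin a) (Fin d × Fin b) ℝ) :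
    patternize hd M = modes d (consensusMode hd M) (disagreementMode hd M) := rfl

theorem patternize_modes (hd : 2 ≤ d) (M N : Matrix (Fin a) (Fin b) ℝ) :
    patternize hd (modes d M N) = modes d M N := by
  simp [patternize_apply, consensusMode_modes, disagreementMode_modes]

theorem isSchurStable_of_modes (hd : 2 ≤ d) {M N : Matrix (Fin a) (Fin a) ℝ}
    (h : IsSchurStable (modes d M N)) : IsSchurStable M ∧ IsSchurStable N := by
  rw [isSchurStable_iff] at h
  simp only [modes_pow (by omega : d ≠ 0)] at h
  have hc : Continuous (consensusMode hd : Matrix (Fin d × Fin a) (Fin d × Fin a) ℝ → _) :=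
    (consensusMode hd).continuous_of_finiteDimensional
  have hdis : Continuous (disagreementMode hd : Matrix (Fin d × Fin a) (Fin d × Fin a) ℝ → _) :=
    (disagreementMode hd).continuous_of_finiteDimensional
  have h1 := (hc.tendsto _).comp h
  have h2 := (hdis.tendsto _).comp h
  simp only [Function.comp_def, consensusMode_modes, disagreementMode_modes, map_zero] at h1 h2
  exact ⟨(isSchurStable_iff M).mpr h1, (isSchurStable_iff N).mpr h2⟩

theorem isSchurStable_modes (hd : d ≠ 0) {M N : Matrix (Fin a) (Fin a) ℝ}
    (hM : IsSchurStable M) (hN : IsSchurStable N) : IsSchurStable (modes d M N) := by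
  rw [isSchurStable_iff] at *
  have hc : Continuous fun z : Matrix (Fin a) (Fin a) ℝ × Matrix (Fin a) (Fin a) ℝ =>
      modes d z.1 z.2 := by
    have hk : ∀ C : Matrix (Fin d) (Fin d) ℝ,
        Continuous fun M : Matrix (Fin a) (Fin a) ℝ => C ⊗ₖ M := fun C => by
      refine continuous_matrix fun i j => ?_
      have h : Continuous fun M : Matrix (Fin a) (Fin a) ℝ => C i.1 j.1 * M i.2 j.2 := by fun_prop
      exact h
    exact ((hk _).comp continuous_fst).add ((hk _).comp continuous_snd)
  have h := (hc.tendsto (0, 0)).comp (hM.prodMk_nhds hN)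
  have h0 : modes d (0 : Matrix (Fin a) (Fin a) ℝ) 0 = 0 := by simp [modes]
  rw [h0] at h
  refine h.congr fun t => ?_
  simp [modes_pow hd]

theorem kronecker_mulVec_tmul {α β : Type*} [Fintype α] [Fintype β] (C : Matrix α α ℝ)
    (M : Matrix β β ℝ) (w : α → ℝ) (v : β → ℝ) :
    (C ⊗ₖ M) *ᵥ (fun q : α × β => w q.1 * v q.2) = fun q => (C *ᵥ w) q.1 * (M *ᵥ v) q.2 := by
  ext ⟨i, k⟩
  simp only [mulVec, dotProduct, Fintype.sum_prod_type, kronecker_apply, Finset.sum_mul_sum]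
  refine Finset.sum_congr rfl fun j _ => Finset.sum_congr rfl fun l _ => by ring

theorem dotProduct_tmul {α β : Type*} [Fintype α] [Fintype β] (w w' : α → ℝ) (v v' : β → ℝ) :
    (fun q : α × β => w q.1 * v q.2) ⬝ᵥ (fun q => w' q.1 * v' q.2) = (w ⬝ᵥ w') * (v ⬝ᵥ v') := by
  simp only [dotProduct, Fintype.sum_prod_type, Finset.sum_mul_sum]
  refine Finset.sum_congr rfl fun j _ => Finset.sum_congr rfl fun l _ => by ring

theorem modes_quadratic_tmul {β : Type*} [Fintype β] (M N : Matrix β β ℝ) (w : Fin d → ℝ)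
    (v : β → ℝ) :
    (fun q : Fin d × β => w q.1 * v q.2) ⬝ᵥ modes d M N *ᵥ (fun q => w q.1 * v q.2) =
      (w ⬝ᵥ avgProj d *ᵥ w) * (v ⬝ᵥ M *ᵥ v) + (w ⬝ᵥ (1 - avgProj d) *ᵥ w) * (v ⬝ᵥ N *ᵥ v) := by
  rw [modes, add_mulVec, dotProduct_add, kronecker_mulVec_tmul, kronecker_mulVec_tmul,
    dotProduct_tmul, dotProduct_tmul]

/-- The modes of a coercive patterned matrix are coercive. -/
theorem coercive_of_modes (hd : 2 ≤ d) {β : Type*} [Fintype β] {M N : Matrix β β ℝ}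
    (h : ∀ u ≠ 0, 0 < u ⬝ᵥ modes d M N *ᵥ u) :
    (∀ v ≠ 0, 0 < v ⬝ᵥ M *ᵥ v) ∧ ∀ v ≠ 0, 0 < v ⬝ᵥ N *ᵥ v := by
  have hd' : (d : ℝ) ≠ 0 := by
    have : d ≠ 0 := by omega
    exact_mod_cast this
  let i₀ : Fin d := ⟨0, by omega⟩
  let i₁ : Fin d := ⟨1, by omega⟩
  have h01 : i₀ ≠ i₁ := by simp [i₀, i₁]
  constructor
  · intro v hv
    obtain ⟨k, hk⟩ := Function.ne_iff.mp hv
    -- The consensus mode is tested on `𝟙 ⊗ v`, the disagreement mode below on `(e₀ - e₁) ⊗ v`;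
    -- `avgProj` fixes `𝟙` and kills `e₀ - e₁`.
    obtain ⟨w, hw⟩ : ∃ w : Fin d → ℝ, w = fun _ => 1 := ⟨_, rfl⟩
    have h1 := h (fun q => w q.1 * v q.2)
      (Function.ne_iff.mpr ⟨(i₀, k), by simpa [hw] using hk⟩)
    rw [modes_quadratic_tmul] at h1
    have e1 : avgProj d *ᵥ w = w := by
      ext
      simp [avgProj, mulVec, dotProduct, hd', hw]
    rw [sub_mulVec, one_mulVec, e1, sub_self, dotProduct_zero, zero_mul, add_zero] at h1
    refine pos_of_mul_pos_right h1 ?_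
    exact Finset.sum_nonneg fun i _ => mul_self_nonneg _
  · intro v hv
    obtain ⟨k, hk⟩ := Function.ne_iff.mp hv
    set w : Fin d → ℝ := Pi.single i₀ 1 - Pi.single i₁ 1 with hw
    have h1 := h (fun q => w q.1 * v q.2)
      (Function.ne_iff.mpr ⟨(i₀, k), by simpa [hw, h01] using hk⟩)
    rw [modes_quadratic_tmul] at h1
    have e1 : avgProj d *ᵥ w = 0 := by
      ext
      simp [avgProj, hw, mulVec_sub]
    rw [sub_mulVec, one_mulVec, e1, sub_zero, dotProduct_zero, zero_mul, zero_add] at h1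
    refine pos_of_mul_pos_right h1 ?_
    exact Finset.sum_nonneg fun i _ => mul_self_nonneg _

theorem isUnit_det_of_coercive {β : Type*} [Fintype β] [DecidableEq β] {M : Matrix β β ℝ}
    (h : ∀ v ≠ 0, 0 < v ⬝ᵥ M *ᵥ v) : IsUnit M.det := by
  rw [isUnit_iff_ne_zero]
  intro h0
  obtain ⟨v, hv, hMv⟩ := exists_mulVec_eq_zero_iff.mpr h0
  have := h v hv
  simp [hMv] at this

end Modes

/-! ### Half-vectorization, the Bellman equation and recursive least squares -/

section Vech

variable {ι : Type*} [DecidableEq ι]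

theorem D3PI.vech_mk (H : Matrix ι ι ℝ) (i j : ι) :
    D3PI.vech H s(i, j) = if i = j then H i i else H i j + H j i := rfl

theorem D3PI.unvech_vech {H : Matrix ι ι ℝ} (hH : Hᵀ = H) : D3PI.unvech (D3PI.vech H) = H := by
  ext i j
  have h : H j i = H i j := congrFun₂ hH i j
  rw [D3PI.unvech, of_apply]
  split_ifs with hij
  · subst hij
    simp [D3PI.vech_mk]
  · simp [D3PI.vech_mk, hij, h]

theorem D3PI.vech_unvech (θ : Sym2 ι → ℝ) : D3PI.vech (D3PI.unvech θ) = θ := by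
  ext s
  induction s with
  | _ i j =>
    rw [D3PI.vech_mk]
    split_ifs with hij
    · subst hij
      simp [D3PI.unvech]
    · simp [D3PI.unvech, hij, Ne.symm hij, Sym2.eq_swap (a := j)]

/-- `vech` as a linear map. -/
noncomputable def vechLinear : Matrix ι ι ℝ →ₗ[ℝ] (Sym2 ι → ℝ) where
  toFun := D3PI.vech
  map_add' H H' := by
    ext s
    induction s with
    | _ i j =>
      simp only [D3PI.vech_mk, Pi.add_apply, Matrix.add_apply]
      split_ifs <;> ring
  map_smul' c H := by
    ext s
    induction s with
    | _ i j =>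
      simp only [D3PI.vech_mk, Pi.smul_apply, Matrix.smul_apply, smul_eq_mul, RingHom.id_apply]
      split_ifs <;> ring

/-- `unvech` as a linear map. -/
noncomputable def unvechLinear : (Sym2 ι → ℝ) →ₗ[ℝ] Matrix ι ι ℝ where
  toFun := D3PI.unvech
  map_add' θ θ' := by
    ext i j
    simp only [D3PI.unvech, of_apply, Pi.add_apply, Matrix.add_apply]
    split_ifs <;> ring
  map_smul' c θ := by
    ext i j
    simp only [D3PI.unvech, of_apply, Pi.smul_apply, Matrix.smul_apply, smul_eq_mul,
      RingHom.id_apply]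
    split_ifs <;> ring

/-- The double sum over ordered pairs is grouped by unordered pairs; a fibre has one element on the
diagonal and two off it. -/
theorem D3PI.quadFeatures_dotProduct_vech [Fintype ι] (z : ι → ℝ) (H : Matrix ι ι ℝ) :
    D3PI.quadFeatures z ⬝ᵥ D3PI.vech H = z ⬝ᵥ H *ᵥ z := by
  have h1 : z ⬝ᵥ H *ᵥ z = ∑ p : ι × ι, z p.1 * z p.2 * H p.1 p.2 := by
    simp only [dotProduct, mulVec, Fintype.sum_prod_type, Finset.mul_sum]
    exact Finset.sum_congr rfl fun i _ => Finset.sum_congr rfl fun j _ => by ring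
  rw [h1, ← Finset.sum_fiberwise (s := Finset.univ) (g := fun p : ι × ι => s(p.1, p.2)), dotProduct]
  refine Finset.sum_congr rfl fun s _ => ?_
  induction s with
  | _ i j =>
    have h2 : D3PI.quadFeatures z s(i, j) = z i * z j := by simp [D3PI.quadFeatures]
    rw [h2, D3PI.vech_mk]
    split_ifs with hij
    · subst hij
      have : (Finset.univ.filter fun p : ι × ι => s(p.1, p.2) = s(i, i)) = {(i, i)} := by
        ext ⟨a, b⟩
        simp
      rw [this, Finset.sum_singleton]
    · have : (Finset.univ.filter fun p : ι × ι => s(p.1, p.2) = s(i, j)) = {(i, j), (j, i)} := by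
        ext ⟨a, b⟩
        simp
      rw [this, Finset.sum_pair (by simp [hij])]
      ring

end Vech

section Bellman

variable {ι κ : Type*} [Fintype ι] [Fintype κ]

/-- The matrix of the state-input value function that belongs to the cost matrix `P`. -/
def qMatrix (A : Matrix ι ι ℝ) (B : Matrix ι κ ℝ) (Q : Matrix ι ι ℝ) (R : Matrix κ κ ℝ)
    (P : Matrix ι ι ℝ) : Matrix (ι ⊕ κ) (ι ⊕ κ) ℝ :=
  fromBlocks (Q + Aᵀ * P * A) (Aᵀ * P * B) (Bᵀ * P * A) (R + Bᵀ * P * B)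

variable {A : Matrix ι ι ℝ} {B : Matrix ι κ ℝ} {Q : Matrix ι ι ℝ} {R : Matrix κ κ ℝ}
  {K : Matrix κ ι ℝ} {P : Matrix ι ι ℝ}

theorem dotProduct_conj_mulVec {α β γ : Type*} [Fintype α] [Fintype β] [Fintype γ]
    (C : Matrix α β ℝ) (M : Matrix α α ℝ) (D : Matrix α γ ℝ) (x : β → ℝ) (y : γ → ℝ) :
    x ⬝ᵥ (Cᵀ * M * D) *ᵥ y = (C *ᵥ x) ⬝ᵥ M *ᵥ (D *ᵥ y) := by
  rw [Matrix.mul_assoc, ← mulVec_mulVec, ← mulVec_mulVec, mulVec_transpose, dotProduct_comm,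
    ← dotProduct_mulVec, dotProduct_comm]

theorem qMatrix_quadratic (x : ι → ℝ) (u : κ → ℝ) :
    Sum.elim x u ⬝ᵥ qMatrix A B Q R P *ᵥ Sum.elim x u =
      x ⬝ᵥ Q *ᵥ x + u ⬝ᵥ R *ᵥ u + (A *ᵥ x + B *ᵥ u) ⬝ᵥ P *ᵥ (A *ᵥ x + B *ᵥ u) := by
  rw [qMatrix, fromBlocks_mulVec, sumElim_dotProduct_sumElim]
  simp only [Sum.elim_comp_inl, Sum.elim_comp_inr, add_mulVec, mulVec_add, dotProduct_add,
    add_dotProduct, dotProduct_conj_mulVec]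
  ring

/-- If the current input already follows the policy, the state-input value reduces to the value `xᵀ
P x`. This is what the second half of each regressor measures. -/
theorem IsPolicyCost.qMatrix_feedback (h : IsPolicyCost A B Q R K P) (x : ι → ℝ) :
    Sum.elim x (K *ᵥ x) ⬝ᵥ qMatrix A B Q R P *ᵥ Sum.elim x (K *ᵥ x) = x ⬝ᵥ P *ᵥ x := by
  rw [qMatrix_quadratic]
  conv_rhs => rw [h]
  rw [add_mulVec, add_mulVec, dotProduct_add, dotProduct_add, dotProduct_conj_mulVec,
    dotProduct_conj_mulVec, add_mulVec, mulVec_mulVec _ R K, mulVec_mulVec _ B K]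

theorem qMatrix_transpose (hQ : Qᵀ = Q) (hR : Rᵀ = R) (hP : Pᵀ = P) :
    (qMatrix A B Q R P)ᵀ = qMatrix A B Q R P := by
  simp [qMatrix, fromBlocks_transpose, hQ, hR, hP, Matrix.mul_assoc]

end Bellman

/-! ### The closed dynamics of the learning agents and their Bellman equation. -/

section LearnerDynamics

open D3PI

variable {V : Type*} [Fintype V] [DecidableEq V] (G : SimpleGraph V) [DecidableRel G.Adj]
  {d n m : ℕ} (lab : Fin d ↪ V) (S : Plant n m) (K L : Matrix (Fin m) (Fin n) ℝ) (τ : ℝ)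
  (e : ℕ → V → Fin m → ℝ)

theorem one_kronecker_mulVec_stack {a b : ℕ} (M : Matrix (Fin a) (Fin b) ℝ) (x : V → Fin b → ℝ) :
    ((1 : Matrix (Fin d) (Fin d) ℝ) ⊗ₖ M) *ᵥ stack lab x = stack lab fun i => M *ᵥ x i := by
  ext ⟨i, k⟩
  simp [mulVec, dotProduct, stack, Fintype.sum_prod_type, Matrix.one_apply]

theorem ones_kronecker_mulVec_stack {a b : ℕ} (M : Matrix (Fin a) (Fin b) ℝ) (x : V → Fin b → ℝ) :
    ((of fun _ _ => (1 : ℝ) : Matrix (Fin d) (Fin d) ℝ) ⊗ₖ M) *ᵥ stack lab x =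
      stack lab fun _ => M *ᵥ ∑ j : Fin d, x (lab j) := by
  ext ⟨i, k⟩
  simp only [mulVec, dotProduct, stack, Fintype.sum_prod_type, kronecker_apply, of_apply, one_mul,
    Finset.sum_apply, Finset.mul_sum]
  exact Finset.sum_comm

/-- Learners ignore all other agents, so their stacked state evolves on its own: neither the rest of
the network nor `τ` enters the evaluation. -/
theorem stack_policy (x : V → Fin n → ℝ) :
    stack lab (policy G lab K L τ x) = patterned d K L *ᵥ stack lab x := by
  rw [patterned, add_mulVec, one_kronecker_mulVec_stack, ones_kronecker_mulVec_stack]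
  ext ⟨i, k⟩
  simp [stack, policy, learners, Finset.sum_map]

theorem stack_nextState (t : ℕ) (x : V → Fin n → ℝ) :
    stack lab (nextState G lab S K L τ e t x) =
      S.bigA d *ᵥ stack lab x + S.bigB d *ᵥ stack lab (appliedInput G lab K L τ e t x) := by
  rw [Plant.bigA, Plant.bigB, one_kronecker_mulVec_stack, one_kronecker_mulVec_stack]
  rfl

/-- The Bellman equation: the regressors reproduce the stage cost exactly at the parameter of the
policy under evaluation. -/
theorem regressor_dotProduct_vech {P : Matrix (Fin d × Fin n) (Fin d × Fin n) ℝ}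
    (h : IsPolicyCost (S.bigA d) (S.bigB d) (S.bigQ d) (S.bigR d) (patterned d K L) P) (t : ℕ)
    (x : V → Fin n → ℝ) :
    regressor G lab S K L τ e t x ⬝ᵥ
      vech (qMatrix (S.bigA d) (S.bigB d) (S.bigQ d) (S.bigR d) P) =
      stageCost G lab S K L τ e t x := by
  -- Exploration causes no bias: the first input of the Bellman equation is arbitrary, only the
  -- second one must follow the policy.
  rw [regressor, sub_dotProduct, quadFeatures_dotProduct_vech, quadFeatures_dotProduct_vech,
    qMatrix_quadratic, stack_policy, h.qMatrix_feedback, stack_nextState, stageCost]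
  ring

end LearnerDynamics

/-! ### Recursive least squares with noise-free data. -/

section RecursiveLeastSquares

variable {σ : Type*} [Fintype σ] [DecidableEq σ]

/-- The information matrix of recursive least squares after `r` regressors. -/
noncomputable def informationMatrix (β : ℝ) (ζ : ℕ → σ → ℝ) (r : ℕ) : Matrix σ σ ℝ :=
  β⁻¹ • 1 + ∑ q ∈ Finset.range r, vecMulVec (ζ q) (ζ q)

theorem informationMatrix_succ (β : ℝ) (ζ : ℕ → σ → ℝ) (r : ℕ) :
    informationMatrix β ζ (r + 1) = informationMatrix β ζ r + vecMulVec (ζ r) (ζ r) := by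
  rw [informationMatrix, informationMatrix, Finset.sum_range_succ, add_assoc]

theorem informationMatrix_quadratic (β : ℝ) (ζ : ℕ → σ → ℝ) (r : ℕ) (v : σ → ℝ) :
    v ⬝ᵥ informationMatrix β ζ r *ᵥ v =
      β⁻¹ * (v ⬝ᵥ v) + ∑ q ∈ Finset.range r, (ζ q ⬝ᵥ v) ^ 2 := by
  rw [informationMatrix, add_mulVec, dotProduct_add, smul_mulVec, one_mulVec, dotProduct_smul,
    smul_eq_mul, sum_mulVec, dotProduct_sum]
  congr 1
  refine Finset.sum_congr rfl fun q _ => ?_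
  rw [vecMulVec_mulVec, sq]
  simp [dotProduct_comm v]

variable {β : ℝ} {ζ : ℕ → σ → ℝ} {θ : ℕ → σ → ℝ} {P : ℕ → Matrix σ σ ℝ} {ℛ : ℕ → ℝ} {θs : σ → ℝ}

/-- The update of `P` is the Sherman–Morrison formula, so `P r` inverts the information matrix `J
r`. Because the data are exact, `J r (θ r - θs)` is conserved and keeps its initial value. -/
theorem rls_invariants (hβ : 0 < β) (hP0 : P 0 = β • 1) (hℛ : ∀ r, ζ r ⬝ᵥ θs = ℛ r)
    (hθ : ∀ r, θ (r + 1) = θ r +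
      ((ℛ r - ζ r ⬝ᵥ θ r) / (1 + ζ r ⬝ᵥ P r *ᵥ ζ r)) • P r *ᵥ ζ r)
    (hP : ∀ r, P (r + 1) = P r - (1 + ζ r ⬝ᵥ P r *ᵥ ζ r)⁻¹ • (P r * vecMulVec (ζ r) (ζ r) * P r))
    (r : ℕ) :
    informationMatrix β ζ r * P r = 1 ∧
      informationMatrix β ζ r *ᵥ (θ r - θs) = β⁻¹ • (θ 0 - θs) := by
  induction r with
  | zero => simp [informationMatrix, hP0, smul_smul, hβ.ne', smul_mulVec]
  | succ r ih =>
    obtain ⟨ih1, ih2⟩ := ih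
    set J := informationMatrix β ζ r with hJ
    set z := ζ r
    have hJP : J *ᵥ (P r *ᵥ z) = z := by rw [mulVec_mulVec, ih1, one_mulVec]
    -- Positivity of `P r` is not carried along; it is inherited from `J` at the vector `P r z`.
    have hpos : 0 ≤ z ⬝ᵥ P r *ᵥ z := by
      have h1 : z ⬝ᵥ P r *ᵥ z = (P r *ᵥ z) ⬝ᵥ J *ᵥ (P r *ᵥ z) := by rw [hJP, dotProduct_comm]
      rw [h1, hJ, informationMatrix_quadratic]
      have : 0 ≤ (P r *ᵥ z) ⬝ᵥ (P r *ᵥ z) := Finset.sum_nonneg fun i _ => mul_self_nonneg _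
      positivity
    set c := 1 + z ⬝ᵥ P r *ᵥ z with hc
    have hc0 : c ≠ 0 := by positivity
    rw [informationMatrix_succ]
    constructor
    · have h1 : vecMulVec z z * (P r * vecMulVec z z * P r) =
          (z ⬝ᵥ P r *ᵥ z) • (vecMulVec z z * P r) := by
        rw [← Matrix.mul_assoc, ← Matrix.mul_assoc, ← Matrix.smul_mul]
        congr 1
        rw [vecMulVec_mul, vecMulVec_mul_vecMulVec, ← dotProduct_mulVec, vecMulVec_smul]
      have h2 : J * (P r * vecMulVec z z * P r) = vecMulVec z z * P r := by
        rw [Matrix.mul_assoc, ← Matrix.mul_assoc, ih1, Matrix.one_mul]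
      rw [hP, Matrix.add_mul, Matrix.mul_sub, Matrix.mul_sub, ih1, Matrix.mul_smul, Matrix.mul_smul,
        h1, h2, smul_smul]
      have h3 : c⁻¹ + c⁻¹ * (z ⬝ᵥ P r *ᵥ z) = 1 := by
        rw [← mul_one_add, ← hc, inv_mul_cancel₀ hc0]
      have h4 : vecMulVec z z * P r = c⁻¹ • (vecMulVec z z * P r) +
          (c⁻¹ * (z ⬝ᵥ P r *ᵥ z)) • (vecMulVec z z * P r) := by
        rw [← add_smul, h3, one_smul]
      nth_rewrite 2 [h4]
      abel
    · have h1 : θ (r + 1) - θs = (θ r - θs) - ((z ⬝ᵥ (θ r - θs)) / c) • P r *ᵥ z := by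
        rw [hθ, ← hℛ, dotProduct_sub, ← neg_sub (z ⬝ᵥ θ r), neg_div, neg_smul]
        abel
      rw [h1, ← hJ]
      generalize θ r - θs = w at *
      rw [add_mulVec, mulVec_sub, mulVec_sub, ih2, mulVec_smul, mulVec_smul, hJP,
        vecMulVec_mulVec, vecMulVec_mulVec]
      have h3 : (z ⬝ᵥ w) / c + (z ⬝ᵥ w) / c * (z ⬝ᵥ P r *ᵥ z) = z ⬝ᵥ w := by
        rw [← mul_one_add, ← hc, div_mul_cancel₀ _ hc0]
      ext i
      simp only [Pi.add_apply, Pi.sub_apply, Pi.smul_apply, smul_eq_mul, MulOpposite.smul_eq_mul_unop, MulOpposite.unop_op]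
      linear_combination (-(z i)) * h3

/-- Under persistent excitation, recursive least squares contracts the parameter error. -/
theorem rls_contraction {ε : ℝ} (hβ : 0 < β) {r : ℕ} {w w₀ : σ → ℝ}
    (h : informationMatrix β ζ r *ᵥ w = β⁻¹ • w₀)
    (hpe : ε * r * (w ⬝ᵥ w) ≤ ∑ q ∈ Finset.range r, (ζ q ⬝ᵥ w) ^ 2) :
    (1 + β * ε * r) * euclNorm w ≤ euclNorm w₀ := by
  have h1 := informationMatrix_quadratic β ζ r w
  rw [h, dotProduct_smul, smul_eq_mul] at h1
  have h2 := le_of_abs_le (dotProduct_le_euclNorm w w₀)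
  -- Pairing the conserved quantity with `w` and inserting the excitation bound; Cauchy–Schwarz then
  -- finishes.
  have h3 : (1 + β * ε * r) * (w ⬝ᵥ w) ≤ w ⬝ᵥ w₀ := by
    have h4 : β * (β⁻¹ * (w ⬝ᵥ w₀)) = w ⬝ᵥ w₀ := mul_inv_cancel_left₀ hβ.ne' _
    have h5 : β * (β⁻¹ * (w ⬝ᵥ w)) = w ⬝ᵥ w := mul_inv_cancel_left₀ hβ.ne' _
    have h6 := mul_le_mul_of_nonneg_left hpe hβ.le
    rw [h1, mul_add, h5] at h4
    linarith
  rw [← euclNorm_sq] at h3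
  rcases (euclNorm_nonneg w).eq_or_lt with h0 | h0
  · rw [← h0, mul_zero]
    exact euclNorm_nonneg _
  · nlinarith

theorem norm_le_euclNorm (w : σ → ℝ) : ‖w‖ ≤ euclNorm w := by
  rw [pi_norm_le_iff_of_nonneg (euclNorm_nonneg w)]
  intro i
  rw [Real.norm_eq_abs]
  exact abs_le_of_sq_le_sq ((sq_le_dotProduct_self w i).trans_eq (euclNorm_sq w).symm)
    (euclNorm_nonneg w)

/-- Parameters carry the sup norm, whereas least squares contracts the Euclidean one. The crude
dimension factor is harmless, since a larger number of steps compensates for it. -/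
theorem euclNorm_le_card_mul_norm (w : σ → ℝ) :
    euclNorm w ≤ (Fintype.card σ + 1) * ‖w‖ := by
  refine abs_le_of_sq_le_sq' ?_ (by positivity) |>.2
  rw [euclNorm_sq]
  have h1 : w ⬝ᵥ w ≤ Fintype.card σ * ‖w‖ ^ 2 := by
    rw [dotProduct, ← nsmul_eq_mul]
    refine Finset.sum_le_card_nsmul _ _ _ fun i _ => ?_
    have := norm_le_pi_norm w i
    rw [Real.norm_eq_abs] at this
    rw [← sq, ← sq_abs]
    gcongr
  refine h1.trans ?_
  rw [mul_pow]
  gcongr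
  nlinarith [(Nat.cast_nonneg (Fintype.card σ) : (0 : ℝ) ≤ _)]

end RecursiveLeastSquares

section PolicyEvaluation

open D3PI

variable {V : Type*} [Fintype V] [DecidableEq V] (G : SimpleGraph V) [DecidableRel G.Adj]
  {d n m : ℕ} (lab : Fin d ↪ V) (S : Plant n m) (e : ℕ → V → Fin m → ℝ)

/-- The subgraph policy evaluation contracts the distance to the exact parameter, by a factor that
is small if there are many steps. -/
theorem spe_contraction {β ε : ℝ} (hβ : 0 < β) (hε : 0 < ε) (s : State V d n m)
    {P : Matrix (Fin d × Fin n) (Fin d × Fin n) ℝ}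
    (h : IsPolicyCost (S.bigA d) (S.bigB d) (S.bigQ d) (S.bigR d) (patterned d s.K s.L) P) {r : ℕ}
    (hpe : PersistentlyExcited G lab S β e ε r s) :
    let θs := vech (qMatrix (S.bigA d) (S.bigB d) (S.bigQ d) (S.bigR d) P)
    (1 + β * ε * r) * ‖(spe G lab S β e s r).θ - θs‖ ≤
      (Fintype.card (Sym2 (Idx d n m)) + 1) * ‖vech s.H - θs‖ := by
  intro θs
  have hstep : ∀ q, spe G lab S β e s (q + 1) =
      speStep G lab S s.K s.L s.τ e (spe G lab S β e s q) := fun q =>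
    Function.iterate_succ_apply' _ _ _
  have hinv := (rls_invariants (β := β)
    (ζ := fun q => regressor G lab S s.K s.L s.τ e (spe G lab S β e s q).t (spe G lab S β e s q).x)
    (θ := fun q => (spe G lab S β e s q).θ) (P := fun q => (spe G lab S β e s q).P)
    (ℛ := fun q => stageCost G lab S s.K s.L s.τ e (spe G lab S β e s q).t
      (spe G lab S β e s q).x) (θs := θs) hβ rfl
    (fun q => regressor_dotProduct_vech G lab S s.K s.L s.τ e h _ _)
    (fun q => by simp only [hstep, speStep]) (fun q => by simp only [hstep, speStep]) r).2
  have hc := rls_contraction hβ hinv (hpe _)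
  refine le_trans ?_ (hc.trans (euclNorm_le_card_mul_norm _))
  gcongr
  exact norm_le_euclNorm _

end PolicyEvaluation

/-! ### Continuity of extreme singular values -/

section SingularValues

open scoped RealInnerProductSpace

variable {E : Type*} [NormedAddCommGroup E] [InnerProductSpace ℝ E] [FiniteDimensional ℝ E]

/-- Take a normalized eigenvector of `T* T`. -/
theorem exists_norm_eq_singularValue (T : E →ₗ[ℝ] E) {i : ℕ} (hi : i < Module.finrank ℝ E) :
    ∃ x : E, ‖x‖ = 1 ∧ ‖T x‖ = T.singularValues i := by
  obtain ⟨v, hv⟩ := (T.hasEigenvalue_adjoint_comp_self_sq_singularValues hi).exists_hasEigenvector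
  have hv0 : ‖v‖ ≠ 0 := norm_ne_zero_iff.mpr hv.2
  have h1 : ‖T v‖ ^ 2 = (T.singularValues i * ‖v‖) ^ 2 := by
    have h2 : ⟪(LinearMap.adjoint T ∘ₗ T) v, v⟫ = ‖T v‖ ^ 2 := by
      rw [LinearMap.comp_apply, LinearMap.adjoint_inner_left, real_inner_self_eq_norm_sq]
    rw [← h2, hv.apply_eq_smul, real_inner_smul_left, real_inner_self_eq_norm_sq]
    simp [mul_pow]
  have h3 : ‖T v‖ = T.singularValues i * ‖v‖ :=
    (sq_eq_sq₀ (norm_nonneg _) (mul_nonneg (T.singularValues_nonneg i) (norm_nonneg _))).mp h1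
  refine ⟨‖v‖⁻¹ • v, by rw [norm_smul, norm_inv, norm_norm, inv_mul_cancel₀ hv0], ?_⟩
  rw [map_smul, norm_smul, norm_inv, norm_norm, h3]
  field_simp

theorem norm_sq_eq_sum_singularValues (T : E →ₗ[ℝ] E) (x : E) :
    ∃ c : Fin (Module.finrank ℝ E) → ℝ, ‖x‖ ^ 2 = ∑ i, c i ^ 2 ∧
      ‖T x‖ ^ 2 = ∑ i : Fin (Module.finrank ℝ E), T.singularValues i ^ 2 * c i ^ 2 := by
  have hT := T.isSymmetric_adjoint_comp_self
  set b := hT.eigenvectorBasis rfl with hb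
  refine ⟨fun i => b.repr x i, ?_, ?_⟩
  · rw [← b.repr.norm_map x, EuclideanSpace.real_norm_sq_eq]
  · have h2 : ⟪(LinearMap.adjoint T ∘ₗ T) x, x⟫ = ‖T x‖ ^ 2 := by
      rw [LinearMap.comp_apply, LinearMap.adjoint_inner_left, real_inner_self_eq_norm_sq]
    rw [← h2, ← b.repr.inner_map_map, PiLp.inner_apply]
    refine Finset.sum_congr rfl fun i _ => ?_
    rw [hb, hT.eigenvectorBasis_apply_self_apply rfl x i, T.sq_singularValues_fin rfl i]
    simp
    ring

theorem norm_le_first_singularValue (T : E →ₗ[ℝ] E) (x : E) :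
    ‖T x‖ ≤ T.singularValues 0 * ‖x‖ := by
  obtain ⟨c, h1, h2⟩ := norm_sq_eq_sum_singularValues T x
  refine le_of_sq_le_sq ?_ (mul_nonneg (T.singularValues_nonneg 0) (norm_nonneg _))
  rw [mul_pow, h1, h2, Finset.mul_sum]
  gcongr with i
  · exact T.singularValues_nonneg _
  · exact T.singularValues_antitone (Nat.zero_le _)

theorem last_singularValue_le_norm (T : E →ₗ[ℝ] E) (x : E) :
    T.singularValues (Module.finrank ℝ E - 1) * ‖x‖ ≤ ‖T x‖ := by
  obtain ⟨c, h1, h2⟩ := norm_sq_eq_sum_singularValues T x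
  refine le_of_sq_le_sq ?_ (norm_nonneg _)
  rw [mul_pow, h1, h2, Finset.mul_sum]
  gcongr with i
  · exact T.singularValues_nonneg _
  · exact T.singularValues_antitone (by omega)

open scoped Matrix.Norms.L2Operator

theorem norm_toEuclideanLin_sub_le {n : ℕ} (M N : Matrix (Fin n) (Fin n) ℝ)
    (x : EuclideanSpace ℝ (Fin n)) :
    ‖toEuclideanLin M x‖ ≤ ‖toEuclideanLin N x‖ + ‖M - N‖ * ‖x‖ := by
  have h : toEuclideanLin M x = toEuclideanLin N x + toEuclideanLin (M - N) x := by
    rw [map_sub, LinearMap.sub_apply]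
    abel
  rw [h]
  refine (norm_add_le _ _).trans ?_
  gcongr
  exact l2_opNorm_mulVec (M - N) x

theorem continuous_of_sub_le {n : ℕ} {f : Matrix (Fin n) (Fin n) ℝ → ℝ}
    (h : ∀ M N, f M ≤ f N + ‖M - N‖) : Continuous f := by
  refine (LipschitzWith.of_le_add fun M N => ?_ : LipschitzWith 1 f).continuous
  rw [dist_eq_norm]
  exact h M N

/-- `σ_max` is 1-Lipschitz: evaluate both matrices at a unit vector where `M` attains its largest
value. -/
theorem continuous_sigmaMax {n : ℕ} (hn : 0 < n) :
    Continuous (sigmaMax : Matrix (Fin n) (Fin n) ℝ → ℝ) := by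
  refine continuous_of_sub_le fun M N => ?_
  obtain ⟨x, hx, hxM⟩ := exists_norm_eq_singularValue (toEuclideanLin M) (i := 0) (by simpa using hn)
  have h1 := norm_toEuclideanLin_sub_le M N x
  have h2 := norm_le_first_singularValue (toEuclideanLin N) x
  rw [hx, mul_one] at h1 h2
  rw [hxM] at h1
  exact h1.trans (by gcongr; exact h2)

/-- As for `σ_max`, but the test vector is one where `N` attains its smallest value. -/
theorem continuous_sigmaMin {n : ℕ} (hn : 0 < n) :
    Continuous (sigmaMin : Matrix (Fin n) (Fin n) ℝ → ℝ) := by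
  refine continuous_of_sub_le fun M N => ?_
  obtain ⟨x, hx, hxN⟩ := exists_norm_eq_singularValue (toEuclideanLin N) (i := n - 1)
    (by simp; omega)
  have h1 := norm_toEuclideanLin_sub_le M N x
  have h2 := last_singularValue_le_norm (toEuclideanLin M) x
  rw [finrank_euclideanSpace_fin] at h2
  rw [hx, mul_one] at h1 h2
  rw [hxN] at h1
  exact h2.trans h1

theorem eq_zero_of_sigmaMax_eq_zero {n : ℕ} {M : Matrix (Fin n) (Fin n) ℝ} (h : sigmaMax M = 0) :
    M = 0 := by
  refine toEuclideanLin.injective ?_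
  ext1 x
  have := norm_le_first_singularValue (toEuclideanLin M) x
  rw [← sigmaMax, h, zero_mul, norm_le_zero_iff] at this
  rw [this, map_zero, LinearMap.zero_apply]

end SingularValues

/-! ### The policy update -/

section Improve

variable {n m : ℕ}

theorem continuousAt_nonsing_inv {X : Type*} [TopologicalSpace X] {f : X → Matrix (Fin m) (Fin m) ℝ}
    {x : X} (hf : ContinuousAt f x) (h : IsUnit (f x).det) :
    ContinuousAt (fun y => (f y)⁻¹) x :=
  ContinuousAt.comp (g := Inv.inv) (continuousAt_matrix_inv _ (by
    rw [Ring.inverse_eq_inv']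
    exact continuousAt_inv₀ h.ne_zero)) hf

theorem continuousAt_matrix_mul {X α β γ : Type*} [TopologicalSpace X] [Fintype β]
    {f : X → Matrix α β ℝ} {g : X → Matrix β γ ℝ} {x : X} (hf : ContinuousAt f x)
    (hg : ContinuousAt g x) : ContinuousAt (fun y => f y * g y) x :=
  ContinuousAt.comp (g := fun z : Matrix α β ℝ × Matrix β γ ℝ => z.1 * z.2)
    (continuous_fst.matrix_mul continuous_snd).continuousAt (hf.prodMk hg)

theorem continuousAt_matrix_transpose {X α β : Type*} [TopologicalSpace X]
    {f : X → Matrix α β ℝ} {x : X} (hf : ContinuousAt f x) : ContinuousAt (fun y => (f y)ᵀ) x :=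
  ContinuousAt.comp (g := fun z : Matrix α β ℝ => zᵀ) continuous_id.matrix_transpose.continuousAt hf

/-- The diagonal block of the inverse of a patterned matrix, as a Schur complement. -/
theorem schur_complement_factor (d : ℝ) (Y₁ Y₂ : Matrix (Fin m) (Fin m) ℝ)
    (hc : IsUnit (Y₁ + (d - 2) • Y₂).det) :
    Y₁ - (d - 1) • (Y₂ * (Y₁ + (d - 2) • Y₂)⁻¹ * Y₂) =
      (Y₁ - Y₂) * (Y₁ + (d - 2) • Y₂)⁻¹ * (Y₁ + (d - 1) • Y₂) := by
  -- In terms of `C` and `Y₂` the outer factors are `C - (d - 1) Y₂` and `C + Y₂`, and the product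
  -- expands with a single inverse.
  obtain ⟨C, hC⟩ : ∃ C, C = Y₁ + (d - 2) • Y₂ := ⟨_, rfl⟩
  have hb : Y₁ - Y₂ = C - (d - 1) • Y₂ := by
    rw [hC, eq_sub_iff_add_eq]; module
  have ha : Y₁ + (d - 1) • Y₂ = C + Y₂ := by rw [hC]; module
  have h1 : Y₁ = C - (d - 2) • Y₂ := by rw [hC]; module
  rw [← hC] at hc ⊢
  rw [hb, ha, Matrix.sub_mul, mul_nonsing_inv _ hc, Matrix.sub_mul, Matrix.one_mul, Matrix.mul_add,
    Matrix.smul_mul, Matrix.smul_mul, nonsing_inv_mul_cancel_right _ _ hc]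
  conv_lhs => rw [h1]
  rw [Matrix.smul_mul]
  module

theorem isUnit_det_schur_complement (d : ℝ) (Y₁ Y₂ : Matrix (Fin m) (Fin m) ℝ)
    (ha : IsUnit (Y₁ + (d - 1) • Y₂).det) (hb : IsUnit (Y₁ - Y₂).det)
    (hc : IsUnit (Y₁ + (d - 2) • Y₂).det) :
    IsUnit (Y₁ - (d - 1) • (Y₂ * (Y₁ + (d - 2) • Y₂)⁻¹ * Y₂)).det := by
  rw [schur_complement_factor d Y₁ Y₂ hc, det_mul, det_mul]
  exact (hb.mul (isUnit_nonsing_inv_det _ hc)).mul ha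

/-- The two matrices `F` and `-Γ` of the update are the diagonal and off-diagonal blocks of the
inverse of the patterned matrix with blocks `Y₁`, `Y₂`; the modes of an inverse are the inverses of
the modes. -/
theorem patterned_inverse_blocks (d : ℝ) (Y₁ Y₂ : Matrix (Fin m) (Fin m) ℝ)
    (ha : IsUnit (Y₁ + (d - 1) • Y₂).det) (hb : IsUnit (Y₁ - Y₂).det)
    (hc : IsUnit (Y₁ + (d - 2) • Y₂).det) :
    (Y₁ - (d - 1) • (Y₂ * (Y₁ + (d - 2) • Y₂)⁻¹ * Y₂))⁻¹ +
        (Y₁ + (d - 1) • Y₂)⁻¹ * Y₂ * (Y₁ - Y₂)⁻¹ = (Y₁ - Y₂)⁻¹ ∧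
      (Y₁ - (d - 1) • (Y₂ * (Y₁ + (d - 2) • Y₂)⁻¹ * Y₂))⁻¹ -
        (d - 1) • ((Y₁ + (d - 1) • Y₂)⁻¹ * Y₂ * (Y₁ - Y₂)⁻¹) = (Y₁ + (d - 1) • Y₂)⁻¹ := by
  rw [schur_complement_factor d Y₁ Y₂ hc, Matrix.mul_inv_rev, Matrix.mul_inv_rev,
    nonsing_inv_nonsing_inv _ hc, ← Matrix.mul_assoc]
  constructor
  · rw [← Matrix.add_mul, ← Matrix.mul_add]
    have : Y₁ + (d - 2) • Y₂ + Y₂ = Y₁ + (d - 1) • Y₂ := by module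
    rw [this, nonsing_inv_mul _ ha, Matrix.one_mul]
  · rw [← Matrix.smul_mul, ← Matrix.mul_smul, ← Matrix.sub_mul, ← Matrix.mul_sub]
    have : Y₁ + (d - 2) • Y₂ - (d - 1) • Y₂ = Y₁ - Y₂ := by module
    rw [this, mul_nonsing_inv_cancel_right _ _ hb]

theorem patterned_gain_modes (d : ℝ) (F Γ : Matrix (Fin m) (Fin m) ℝ)
    (Z₁ Z₂ : Matrix (Fin m) (Fin n) ℝ) :
    (-(F * Z₁) + (d - 1) • (Γ * Z₂)) - (-(F * Z₂) + Γ * Z₁ + (d - 2) • (Γ * Z₂)) =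
        -((F + Γ) * (Z₁ - Z₂)) ∧
      (-(F * Z₁) + (d - 1) • (Γ * Z₂)) + (d - 1) • (-(F * Z₂) + Γ * Z₁ + (d - 2) • (Γ * Z₂)) =
        -((F - (d - 1) • Γ) * (Z₁ + (d - 1) • Z₂)) := by
  simp only [Matrix.add_mul, Matrix.sub_mul, Matrix.mul_add, Matrix.mul_sub, Matrix.smul_mul,
    Matrix.mul_smul]
  constructor <;> module

open D3PI

variable {d : ℕ} (hd : 2 ≤ d) (S : Plant n m) {V : Type*} (t : ℕ) (x : V → Fin n → ℝ)

/-- The regularity condition under which the update formulas make sense. -/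
def IsUpdatable (H : Matrix (Idx d n m) (Idx d n m) ℝ) : Prop :=
  IsUnit (consensusMode hd H.toBlocks₂₂).det ∧ IsUnit (disagreementMode hd H.toBlocks₂₂).det ∧
    IsUnit (block H.toBlocks₂₂ ⟨0, by omega⟩ ⟨0, by omega⟩ +
      ((d : ℝ) - 2) • block H.toBlocks₂₂ ⟨0, by omega⟩ ⟨1, by omega⟩).det

/-- Besides the two modes, `Y₁ + (d - 2) Y₂` must be invertible. It is a convex combination of them,
with weights `(d - 1) / d` and `1 / d`, hence coercive too. -/
theorem isUpdatable_of_coercive {H : Matrix (Idx d n m) (Idx d n m) ℝ}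
    (h : ∀ u ≠ 0, 0 < u ⬝ᵥ patternize hd H.toBlocks₂₂ *ᵥ u) : IsUpdatable hd H := by
  obtain ⟨h1, h2⟩ := coercive_of_modes hd h
  refine ⟨isUnit_det_of_coercive h1, isUnit_det_of_coercive h2, isUnit_det_of_coercive fun v hv => ?_⟩
  have hd2 : (2 : ℝ) ≤ d := by exact_mod_cast hd
  have hpos : (0 : ℝ) < d := by linarith
  have h3 : (d : ℝ) • (block H.toBlocks₂₂ ⟨0, by omega⟩ ⟨0, by omega⟩ +
      ((d : ℝ) - 2) • block H.toBlocks₂₂ ⟨0, by omega⟩ ⟨1, by omega⟩) =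
      ((d : ℝ) - 1) • consensusMode hd H.toBlocks₂₂ + disagreementMode hd H.toBlocks₂₂ := by
    simp only [consensusMode, disagreementMode, LinearMap.coe_mk, AddHom.coe_mk]
    module
  have h4 := congrArg (fun M => v ⬝ᵥ M *ᵥ v) h3
  simp only [smul_mulVec, add_mulVec, dotProduct_add, dotProduct_smul, smul_eq_mul] at h4
  have h5 := mul_nonneg (by linarith : (0 : ℝ) ≤ d - 1) (h1 v hv).le
  rw [← smul_eq_mul, ← smul_eq_mul] at h4
  have h6 := h2 v hv
  simp only [smul_mulVec, add_mulVec, dotProduct_add, dotProduct_smul, smul_eq_mul] at h4 ⊢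
  nlinarith

/-- The updated gains are the improved gain that belongs to the patterned version of `H`. -/
theorem improve_gain {H : Matrix (Idx d n m) (Idx d n m) ℝ} (hH : IsUpdatable hd H) :
    patternize hd H.toBlocks₂₂ *
        patterned d (improve hd S t x H).K (improve hd S t x H).L =
      -patternize hd H.toBlocks₂₁ := by
  obtain ⟨ha, hb, hc⟩ := hH
  obtain ⟨h1, h2⟩ := patterned_inverse_blocks d _ _ ha hb hc
  have hg := patterned_gain_modes (d : ℝ)
    (block H.toBlocks₂₂ ⟨0, by omega⟩ ⟨0, by omega⟩ - ((d : ℝ) - 1) •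
      (block H.toBlocks₂₂ ⟨0, by omega⟩ ⟨1, by omega⟩ *
        (block H.toBlocks₂₂ ⟨0, by omega⟩ ⟨0, by omega⟩ + ((d : ℝ) - 2) •
          block H.toBlocks₂₂ ⟨0, by omega⟩ ⟨1, by omega⟩)⁻¹ *
        block H.toBlocks₂₂ ⟨0, by omega⟩ ⟨1, by omega⟩))⁻¹
    ((consensusMode hd H.toBlocks₂₂)⁻¹ * block H.toBlocks₂₂ ⟨0, by omega⟩ ⟨1, by omega⟩ *
      (disagreementMode hd H.toBlocks₂₂)⁻¹)
    (block H.toBlocks₂₁ ⟨0, by omega⟩ ⟨0, by omega⟩) (block H.toBlocks₂₁ ⟨0, by omega⟩ ⟨1, by omega⟩)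
  obtain ⟨hg1, hg2⟩ := hg
  have h1' := hg1.trans (congrArg (fun M => -(M * disagreementMode hd H.toBlocks₂₁)) h1)
  have h2' := hg2.trans (congrArg (fun M => -(M * consensusMode hd H.toBlocks₂₁)) h2)
  have hd0 : d ≠ 0 := by omega
  have e1 : (improve hd S t x H).K - (improve hd S t x H).L =
    -((disagreementMode hd H.toBlocks₂₂)⁻¹ * disagreementMode hd H.toBlocks₂₁) := h1'
  have e2 : (improve hd S t x H).K + ((d : ℝ) - 1) • (improve hd S t x H).L =
    -((consensusMode hd H.toBlocks₂₂)⁻¹ * consensusMode hd H.toBlocks₂₁) := h2'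
  rw [patterned_eq_modes hd0, e1, e2, patternize_apply, patternize_apply, modes_mul hd0, modes_neg, Matrix.mul_neg, Matrix.mul_neg,
    mul_nonsing_inv_cancel_left _ _ ha, mul_nonsing_inv_cancel_left _ _ hb]

/-- The matrix whose largest singular value is the denominator of `γ`. -/
noncomputable def gammaDenominator (H : Matrix (Idx d n m) (Idx d n m) ℝ) (K L : Matrix (Fin m) (Fin n) ℝ) :
    Matrix (Fin n) (Fin n) ℝ :=
  disagreementMode hd H.toBlocks₁₁ - S.Qtilde d + S.Q₂ +
    (K - L)ᵀ * disagreementMode hd H.toBlocks₂₁ + (disagreementMode hd H.toBlocks₂₁)ᵀ * (K - L) +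
    (K - L)ᵀ * (disagreementMode hd H.toBlocks₂₂ - S.R) * (K - L) +
    Lᵀ * (disagreementMode hd H.toBlocks₂₂ - S.R) * L

theorem improve_gamma (H : Matrix (Idx d n m) (Idx d n m) ℝ) :
    (improve hd S t x H).γ =
      sigmaMin (((improve hd S t x H).K - (improve hd S t x H).L)ᵀ * S.R *
        ((improve hd S t x H).K - (improve hd S t x H).L) + S.Qtilde d) /
      sigmaMax (gammaDenominator hd S H (improve hd S t x H).K (improve hd S t x H).L) := rfl

theorem continuousAt_improve_KL {H : Matrix (Idx d n m) (Idx d n m) ℝ} (hH : IsUpdatable hd H) :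
    ContinuousAt (fun H => (improve hd S t x H).K) H ∧
      ContinuousAt (fun H => (improve hd S t x H).L) H := by
  obtain ⟨ha, hb, hc⟩ := hH
  have hblk₂₂ : ∀ i j : Fin d, ContinuousAt
      (fun H : Matrix (Idx d n m) (Idx d n m) ℝ => block H.toBlocks₂₂ i j) H := fun i j => by
    refine Continuous.continuousAt (continuous_matrix fun k l => ?_)
    exact Continuous.matrix_elem continuous_id _ _
  have hblk₂₁ : ∀ i j : Fin d, ContinuousAt
      (fun H : Matrix (Idx d n m) (Idx d n m) ℝ => block H.toBlocks₂₁ i j) H := fun i j => by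
    refine Continuous.continuousAt (continuous_matrix fun k l => ?_)
    exact Continuous.matrix_elem continuous_id _ _
  let i₀ : Fin d := ⟨0, by omega⟩
  let i₁ : Fin d := ⟨1, by omega⟩
  have cF := continuousAt_nonsing_inv ((hblk₂₂ i₀ i₀).sub ((continuousAt_matrix_mul
    (continuousAt_matrix_mul (hblk₂₂ i₀ i₁) (continuousAt_nonsing_inv
      ((hblk₂₂ i₀ i₀).add ((hblk₂₂ i₀ i₁).const_smul ((d : ℝ) - 2))) hc)) (hblk₂₂ i₀ i₁)).const_smul
        ((d : ℝ) - 1))) (isUnit_det_schur_complement d _ _ ha hb hc)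
  have cΓ := continuousAt_matrix_mul (continuousAt_matrix_mul (continuousAt_nonsing_inv
    ((hblk₂₂ i₀ i₀).add ((hblk₂₂ i₀ i₁).const_smul ((d : ℝ) - 1))) ha) (hblk₂₂ i₀ i₁))
      (continuousAt_nonsing_inv ((hblk₂₂ i₀ i₀).sub (hblk₂₂ i₀ i₁)) hb)
  have cFZ := fun j => continuousAt_matrix_mul cF (hblk₂₁ i₀ j)
  have cΓZ := fun j => continuousAt_matrix_mul cΓ (hblk₂₁ i₀ j)
  exact ⟨(cFZ i₀).neg.add ((cΓZ i₁).const_smul ((d : ℝ) - 1)),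
    ((cFZ i₁).neg.add (cΓZ i₀)).add ((cΓZ i₁).const_smul ((d : ℝ) - 2))⟩

theorem continuousAt_improve_gamma (hn : 0 < n) {H : Matrix (Idx d n m) (Idx d n m) ℝ}
    (hH : IsUpdatable hd H)
    (hden : gammaDenominator hd S H (improve hd S t x H).K (improve hd S t x H).L ≠ 0) :
    ContinuousAt (fun H => (improve hd S t x H).γ) H ∧
      ContinuousAt (fun H => (improve hd S t x H).τ) H := by
  obtain ⟨hK, hL⟩ := continuousAt_improve_KL hd S t x hH
  have hlin : ∀ {a b : ℕ} (f : Matrix (Idx d n m) (Idx d n m) ℝ →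
      Matrix (Fin d × Fin a) (Fin d × Fin b) ℝ), Continuous f →
      ContinuousAt (fun H => disagreementMode hd (f H)) H := fun f hf =>
    ((disagreementMode hd).continuous_of_finiteDimensional.comp hf).continuousAt
  have hX := hlin (fun H => H.toBlocks₁₁)
    (continuous_matrix fun k l => Continuous.matrix_elem continuous_id _ _)
  have hY := (hlin (fun H => H.toBlocks₂₂)
    (continuous_matrix fun k l => Continuous.matrix_elem continuous_id _ _)).sub
      (continuousAt_const (y := S.R))
  have hZ := hlin (fun H => H.toBlocks₂₁)
    (continuous_matrix fun k l => Continuous.matrix_elem continuous_id _ _)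
  have hdK := hK.sub hL
  have hdKt := continuousAt_matrix_transpose hdK
  have hD : ContinuousAt (fun H => gammaDenominator hd S H (improve hd S t x H).K
      (improve hd S t x H).L) H :=
    (((((hX.sub continuousAt_const).add continuousAt_const).add
      (continuousAt_matrix_mul hdKt hZ)).add
      (continuousAt_matrix_mul (continuousAt_matrix_transpose hZ) hdK)).add
      (continuousAt_matrix_mul (continuousAt_matrix_mul hdKt hY) hdK)).add
      (continuousAt_matrix_mul (continuousAt_matrix_mul (continuousAt_matrix_transpose hL) hY) hL)
  have hN : ContinuousAt (fun H => ((improve hd S t x H).K - (improve hd S t x H).L)ᵀ * S.R *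
      ((improve hd S t x H).K - (improve hd S t x H).L) + S.Qtilde d) H :=
    (continuousAt_matrix_mul (continuousAt_matrix_mul hdKt continuousAt_const) hdK).add
      continuousAt_const
  have hγ : ContinuousAt (fun H => (improve hd S t x H).γ) H :=
    ((continuous_sigmaMin hn).continuousAt.comp hN).div
      ((continuous_sigmaMax hn).continuousAt.comp hD) fun h => hden (eq_zero_of_sigmaMax_eq_zero h)
  refine ⟨hγ, ?_⟩
  -- A quotient of singular values is nonnegative, so the denominator `1 + γ` of `τ²` cannot vanish.
  have hγ0 : 0 ≤ (improve hd S t x H).γ := by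
    rw [improve_gamma]
    exact div_nonneg (LinearMap.singularValues_nonneg _ _) (LinearMap.singularValues_nonneg _ _)
  have hγ1 : 1 + (improve hd S t x H).γ ≠ 0 := by positivity
  exact ((hγ.pow 2).div (continuousAt_const.add hγ) hγ1).sqrt

end Improve

/-! ### The LQR problem of the learning agents -/

section LearnerLQR

open D3PI

variable {n m d : ℕ} (S : Plant n m)

theorem bigA_eq_modes : S.bigA d = modes d S.A S.A := (modes_self _).symm

theorem bigB_eq_modes : S.bigB d = modes d S.B S.B := (modes_self _).symm

theorem bigR_eq_modes : S.bigR d = modes d S.R S.R := (modes_self _).symm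

/-- On consensus vectors `𝟙 𝟙ᵀ ⊗ Q₂` acts as `d Q₂` and cancels that part of `Q̃`; on disagreement
vectors it vanishes. -/
theorem bigQ_eq_modes (hd : d ≠ 0) : S.bigQ d = modes d S.Q₁ (S.Qtilde d) := by
  ext ⟨i, k⟩ ⟨j, l⟩
  have : (d : ℝ) ≠ 0 := by exact_mod_cast hd
  simp only [Plant.bigQ, Plant.Qtilde, modes, avgProj, Matrix.add_apply, kronecker_apply,
    Matrix.sub_apply, of_apply, Matrix.smul_apply, smul_eq_mul]
  field_simp
  ring

variable {S}

theorem Qtilde_posDef (hQ₁ : S.Q₁.PosDef) (hQ₂ : S.Q₂.PosSemidef) : (S.Qtilde d).PosDef :=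
  hQ₁.add_posSemidef (hQ₂.smul (Nat.cast_nonneg d))

theorem bigQ_posDef (hd : d ≠ 0) (hQ₁ : S.Q₁.PosDef) (hQ₂ : S.Q₂.PosSemidef) :
    (S.bigQ d).PosDef := by
  have h := (modes_self_posDef (d := d) hQ₁).add_posSemidef
    (modes_posSemidef hd Matrix.PosSemidef.zero (hQ₂.smul (Nat.cast_nonneg (α := ℝ) d)))
  rwa [modes_add, add_zero, ← Plant.Qtilde, ← bigQ_eq_modes S hd] at h

theorem bigR_posDef (hR : S.R.PosDef) : (S.bigR d).PosDef := by
  rw [bigR_eq_modes]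
  exact modes_self_posDef hR

theorem closedLoop_modes (hd : d ≠ 0) (Ka Kb : Matrix (Fin m) (Fin n) ℝ) :
    S.bigA d + S.bigB d * modes d Ka Kb = modes d (S.A + S.B * Ka) (S.A + S.B * Kb) := by
  rw [bigA_eq_modes, bigB_eq_modes, modes_mul hd, modes_add]

theorem isPolicyCost_modes (hd : d ≠ 0) {Ka Kb : Matrix (Fin m) (Fin n) ℝ}
    {Pa Pb : Matrix (Fin n) (Fin n) ℝ} (ha : IsPolicyCost S.A S.B S.Q₁ S.R Ka Pa)
    (hb : IsPolicyCost S.A S.B (S.Qtilde d) S.R Kb Pb) :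
    IsPolicyCost (S.bigA d) (S.bigB d) (S.bigQ d) (S.bigR d) (modes d Ka Kb) (modes d Pa Pb) := by
  rw [IsPolicyCost, closedLoop_modes hd, bigQ_eq_modes S hd, bigR_eq_modes]
  simp only [modes_transpose, modes_mul hd, modes_add]
  rw [IsPolicyCost] at ha hb
  rw [← ha, ← hb]

/-- Solve the Lyapunov equation in each mode separately; by uniqueness the assembled matrix is `P`.
-/
theorem isPolicyCost_patterned (hd : 2 ≤ d) {Ka Kb : Matrix (Fin m) (Fin n) ℝ}
    {P : Matrix (Fin d × Fin n) (Fin d × Fin n) ℝ}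
    (hst : IsSchurStable (S.bigA d + S.bigB d * modes d Ka Kb))
    (h : IsPolicyCost (S.bigA d) (S.bigB d) (S.bigQ d) (S.bigR d) (modes d Ka Kb) P) :
    ∃ Pa Pb, P = modes d Pa Pb := by
  have hd0 : d ≠ 0 := by omega
  have hst' := hst
  rw [closedLoop_modes hd0] at hst'
  obtain ⟨ha, hb⟩ := isSchurStable_of_modes hd hst'
  obtain ⟨Pa, hPa⟩ := exists_policyCost (Q := S.Q₁) (R := S.R) ha
  obtain ⟨Pb, hPb⟩ := exists_policyCost (Q := S.Qtilde d) (R := S.R) hb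
  exact ⟨Pa, Pb, h.unique hst (isPolicyCost_modes hd0 hPa hPb)⟩

theorem isRiccati_modes (hd : d ≠ 0) {Ka Kb : Matrix (Fin m) (Fin n) ℝ}
    {Pa Pb : Matrix (Fin n) (Fin n) ℝ} (ha : IsRiccati S.A S.B S.Q₁ S.R Ka Pa)
    (hb : IsRiccati S.A S.B (S.Qtilde d) S.R Kb Pb) :
    IsRiccati (S.bigA d) (S.bigB d) (S.bigQ d) (S.bigR d) (modes d Ka Kb) (modes d Pa Pb) where
  posSemidef := modes_posSemidef hd ha.posSemidef hb.posSemidef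
  cost := isPolicyCost_modes hd ha.cost hb.cost
  gain := by
    rw [bigA_eq_modes, bigB_eq_modes, bigR_eq_modes]
    simp only [modes_transpose, modes_mul hd, modes_add, modes_neg]
    rw [ha.gain, hb.gain]

theorem qMatrix_blocks_modes (hd : d ≠ 0) (Pa Pb : Matrix (Fin n) (Fin n) ℝ) :
    (qMatrix (S.bigA d) (S.bigB d) (S.bigQ d) (S.bigR d) (modes d Pa Pb)).toBlocks₁₁ =
        modes d (S.Q₁ + S.Aᵀ * Pa * S.A) (S.Qtilde d + S.Aᵀ * Pb * S.A) ∧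
      (qMatrix (S.bigA d) (S.bigB d) (S.bigQ d) (S.bigR d) (modes d Pa Pb)).toBlocks₂₁ =
        modes d (S.Bᵀ * Pa * S.A) (S.Bᵀ * Pb * S.A) ∧
      (qMatrix (S.bigA d) (S.bigB d) (S.bigQ d) (S.bigR d) (modes d Pa Pb)).toBlocks₂₂ =
        modes d (S.R + S.Bᵀ * Pa * S.B) (S.R + S.Bᵀ * Pb * S.B) := by
  rw [qMatrix, toBlocks_fromBlocks₁₁, toBlocks_fromBlocks₂₁, toBlocks_fromBlocks₂₂, bigA_eq_modes,
    bigB_eq_modes, bigR_eq_modes, bigQ_eq_modes S hd]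
  simp only [modes_transpose, modes_mul hd, modes_add, and_self]

/-- The denominator of `γ` does not vanish at the optimum. -/
theorem gammaDenominator_ne_zero (hd : 2 ≤ d) (hQ₁ : S.Q₁.PosDef) (hQ₂ : S.Q₂.PosSemidef)
    (hR : S.R.PosDef) (hne : S.A ≠ 0 ∨ S.Q₂ ≠ 0) {K L Kb : Matrix (Fin m) (Fin n) ℝ}
    {Pa Pb : Matrix (Fin n) (Fin n) ℝ} (hb : IsRiccati S.A S.B (S.Qtilde d) S.R Kb Pb)
    (hKL : K - L = Kb) :
    gammaDenominator hd S (qMatrix (S.bigA d) (S.bigB d) (S.bigQ d) (S.bigR d) (modes d Pa Pb))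
      K L ≠ 0 := by
  obtain ⟨h11, h21, h22⟩ := qMatrix_blocks_modes (S := S) (by omega : d ≠ 0) Pa Pb
  have hPb := hb.posSemidef
  have heq : gammaDenominator hd S
      (qMatrix (S.bigA d) (S.bigB d) (S.bigQ d) (S.bigR d) (modes d Pa Pb)) K L =
      S.Q₂ + (S.A + S.B * Kb)ᵀ * Pb * (S.A + S.B * Kb) + (S.B * L)ᵀ * Pb * (S.B * L) := by
    rw [gammaDenominator, h11, h21, h22, hKL]
    simp only [disagreementMode_modes, transpose_mul, transpose_add, hPb.transpose_eq,
      transpose_transpose, Matrix.mul_add, Matrix.add_mul, Matrix.mul_assoc, add_sub_cancel_left]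
    abel
  intro h0
  rw [heq] at h0
  have h1 := hPb.transpose_mul_mul_same (S.A + S.B * Kb)
  have h2 := hPb.transpose_mul_mul_same (S.B * L)
  -- Three positive semidefinite matrices sum to zero, so each trace vanishes: `Q₂ = 0` and, as `Pb
  -- ≻ 0`, the disagreement closed loop is zero.
  have htr := congrArg trace h0
  rw [trace_add, trace_add, trace_zero] at htr
  have t0 := hQ₂.trace_nonneg
  have t1 := h1.trace_nonneg
  have t2 := h2.trace_nonneg
  have hQ₂0 : S.Q₂ = 0 := hQ₂.trace_eq_zero_iff.mp (by linarith)
  have hPbpd : Pb.PosDef := by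
    rw [hb.cost]
    exact (posDef_stage (Qtilde_posDef hQ₁ hQ₂) hR Kb).add_posSemidef h1
  have hcl : S.A + S.B * Kb = 0 := eq_of_quadratic_eq_zero hPbpd (by linarith)
  have hgain := hb.gain
  -- The gain equation reads `R Kb + Bᵀ Pb (A + B Kb) = 0`. A vanishing closed loop thus gives `Kb =
  -- 0` and then `A = 0`, contradicting `hne`.
  have h3 : S.R * Kb = 0 := by
    have h4 : S.R * Kb + S.Bᵀ * Pb * (S.A + S.B * Kb) = 0 := by
      rw [Matrix.mul_add, ← Matrix.mul_assoc _ S.B]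
      rw [Matrix.add_mul, ← sub_eq_zero, sub_neg_eq_add] at hgain
      rw [← hgain]
      abel
    rwa [hcl, Matrix.mul_zero, add_zero] at h4
  have h5 : Kb = 0 := by
    have h6 := nonsing_inv_mul_cancel_left S.R Kb ((isUnit_iff_isUnit_det _).mp hR.isUnit)
    rw [← h6, h3, Matrix.mul_zero]
  rw [h5, Matrix.mul_zero, add_zero] at hcl
  exact hne.elim (fun h => h hcl) fun h => h hQ₂0

end LearnerLQR

/-! ### The run as an instance of inexact policy iteration. -/

section Readout

open D3PI

/-- The part of `qMatrix` that depends linearly on the cost matrix. -/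
def qMatrixLinear {ι κ : Type*} [Fintype ι] [Fintype κ] (A : Matrix ι ι ℝ) (B : Matrix ι κ ℝ) :
    Matrix ι ι ℝ →ₗ[ℝ] Matrix (ι ⊕ κ) (ι ⊕ κ) ℝ where
  toFun := qMatrix A B 0 0
  map_add' P P' := by
    simp [qMatrix, fromBlocks_add, Matrix.mul_add, Matrix.add_mul]
  map_smul' c P := by
    simp [qMatrix, fromBlocks_smul]

theorem qMatrix_eq_add {ι κ : Type*} [Fintype ι] [Fintype κ] (A : Matrix ι ι ℝ) (B : Matrix ι κ ℝ)
    (Q : Matrix ι ι ℝ) (R : Matrix κ κ ℝ) (P : Matrix ι ι ℝ) :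
    qMatrix A B Q R P = qMatrixLinear A B P + fromBlocks Q 0 0 R := by
  simp [qMatrixLinear, qMatrix, fromBlocks_add, add_comm]

/-- The lower right block of a block matrix, as a linear map. -/
def toBlocks₂₂Linear (α β : Type*) : Matrix (α ⊕ β) (α ⊕ β) ℝ →ₗ[ℝ] Matrix β β ℝ where
  toFun := toBlocks₂₂
  map_add' _ _ := rfl
  map_smul' _ _ := rfl

/-- The lower left block of a block matrix, as a linear map. -/
def toBlocks₂₁Linear (α β : Type*) : Matrix (α ⊕ β) (α ⊕ β) ℝ →ₗ[ℝ] Matrix β α ℝ where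
  toFun := toBlocks₂₁
  map_add' _ _ := rfl
  map_smul' _ _ := rfl

variable {V : Type*} [Fintype V] [DecidableEq V] (G : SimpleGraph V) [DecidableRel G.Adj]
  {n m d : ℕ} (hd : 2 ≤ d) (lab : Fin d ↪ V) {S : Plant n m}

/-- With sufficiently many steps in every policy evaluation, the estimates of a persistently
excited run converge to the parameter of the optimal policy. -/
theorem run_estimate_tendsto (hQ₁ : S.Q₁.PosDef) (hQ₂ : S.Q₂.PosSemidef) (hR : S.R.PosDef)
    {K₁ : Matrix (Fin m) (Fin n) ℝ} (hK₁ : IsSchurStable (S.A + S.B * K₁))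
    {Ks : Matrix (Fin d × Fin m) (Fin d × Fin n) ℝ} {Ps : Matrix (Fin d × Fin n) (Fin d × Fin n) ℝ}
    (hs : IsRiccati (S.bigA d) (S.bigB d) (S.bigQ d) (S.bigR d) Ks Ps)
    (H₀ : Matrix (Idx d n m) (Idx d n m) ℝ) {β ε : ℝ} (hβ : 0 < β) (hε : 0 < ε) :
    ∃ T₀ : ℕ, ∀ (x₁ : V → Fin n → ℝ) (e : ℕ → V → Fin m → ℝ) (T : ℕ → ℕ), (∀ k, T₀ ≤ T k) →
      (∀ k, PersistentlyExcited G lab S β e ε (T k) (run G hd lab S β e K₁ H₀ x₁ T k)) →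
      Tendsto (fun k => vech (run G hd lab S β e K₁ H₀ x₁ T k).H) atTop
        (𝓝 (vech (qMatrix (S.bigA d) (S.bigB d) (S.bigQ d) (S.bigR d) Ps))) := by
  have hd0 : d ≠ 0 := by omega
  have hQ := bigQ_posDef hd0 hQ₁ hQ₂
  have hR' : (S.bigR d).PosDef := bigR_posDef hR
  have hθ : ∀ P, vechLinear (qMatrixLinear (S.bigA d) (S.bigB d) P) +
      vech (fromBlocks (S.bigQ d) 0 0 (S.bigR d)) =
      vech (qMatrix (S.bigA d) (S.bigB d) (S.bigQ d) (S.bigR d) P) := fun P => by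
    rw [qMatrix_eq_add]
    exact (vechLinear.map_add _ _).symm
  have h𝒦 : ∀ K ∈ {K | ∃ Ka Kb, K = modes d Ka Kb}, IsSchurStable (S.bigA d + S.bigB d * K) →
      ∀ P, IsPolicyCost (S.bigA d) (S.bigB d) (S.bigQ d) (S.bigR d) K P →
      ((patternize hd).comp ((toBlocks₂₂Linear _ _).comp unvechLinear))
          ((vechLinear.comp (qMatrixLinear (S.bigA d) (S.bigB d))) P +
            vech (fromBlocks (S.bigQ d) 0 0 (S.bigR d))) =
          S.bigR d + (S.bigB d)ᵀ * P * S.bigB d ∧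
        ((patternize hd).comp ((toBlocks₂₁Linear _ _).comp unvechLinear))
          ((vechLinear.comp (qMatrixLinear (S.bigA d) (S.bigB d))) P +
            vech (fromBlocks (S.bigQ d) 0 0 (S.bigR d))) = (S.bigB d)ᵀ * P * S.bigA d := by
    -- For a patterned gain the cost matrix is patterned, so `patternize` leaves the blocks of the
    -- exact parameter unchanged.
    rintro _ ⟨Ka, Kb, rfl⟩ hst P hP
    obtain ⟨Pa, Pb, rfl⟩ := isPolicyCost_patterned hd hst hP
    have hPs := (hP.posSemidef hQ hR' hst).transpose_eq
    obtain ⟨-, h21, h22⟩ := qMatrix_blocks_modes (S := S) hd0 Pa Pb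
    simp only [LinearMap.comp_apply, hθ]
    have hun : unvechLinear (vech (qMatrix (S.bigA d) (S.bigB d) (S.bigQ d) (S.bigR d)
        (modes d Pa Pb))) = qMatrix (S.bigA d) (S.bigB d) (S.bigQ d) (S.bigR d) (modes d Pa Pb) :=
      unvech_vech (qMatrix_transpose hQ.posSemidef.transpose_eq hR'.posSemidef.transpose_eq hPs)
    rw [hun]
    have e22 : toBlocks₂₂Linear _ _ (qMatrix (S.bigA d) (S.bigB d) (S.bigQ d) (S.bigR d)
        (modes d Pa Pb)) = S.bigR d + (S.bigB d)ᵀ * modes d Pa Pb * S.bigB d := rfl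
    have e21 : toBlocks₂₁Linear _ _ (qMatrix (S.bigA d) (S.bigB d) (S.bigQ d) (S.bigR d)
        (modes d Pa Pb)) = (S.bigB d)ᵀ * modes d Pa Pb * S.bigA d := rfl
    have e22' := e22.symm.trans h22
    have e21' := e21.symm.trans h21
    rw [e22, e21, e22', e21', patternize_modes, patternize_modes]
    exact ⟨rfl, rfl⟩
  have hst₁ : IsSchurStable (S.bigA d + S.bigB d * patterned d K₁ 0) := by
    rw [patterned_eq_modes hd0, closedLoop_modes hd0]
    simp only [smul_zero, add_zero, sub_zero]
    exact isSchurStable_modes hd0 hK₁ hK₁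
  obtain ⟨δ, hδ, hconv⟩ := inexact_policy_iteration hQ hR' hs
    (vechLinear.comp (qMatrixLinear (S.bigA d) (S.bigB d)))
    (vech (fromBlocks (S.bigQ d) 0 0 (S.bigR d)))
    ((patternize hd).comp ((toBlocks₂₂Linear _ _).comp unvechLinear))
    ((patternize hd).comp ((toBlocks₂₁Linear _ _).comp unvechLinear))
    {K | ∃ Ka Kb, K = modes d Ka Kb} h𝒦 (K₁ := patterned d K₁ 0)
    ⟨_, _, patterned_eq_modes hd0 _ _⟩ hst₁ (vech H₀)
  set N : ℝ := Fintype.card (Sym2 (Idx d n m)) + 1 with hN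
  -- Makes the contraction factor `N / (1 + β ε T)` at most `δ`. Since `δ` is fixed by the problem
  -- data, `K₁` and `H₀`, the choice is uniform in initial states and exploration.
  obtain ⟨T₀, hT₀⟩ := exists_nat_ge (N / (δ * (β * ε)))
  refine ⟨T₀, fun x₁ e T hT hpe => ?_⟩
  set s := run G hd lab S β e K₁ H₀ x₁ T with hsdef
  have hlim := hconv (fun k => patterned d (s k).K (s k).L) (fun k => vech (s k).H) rfl rfl ?_ ?_
  · rw [← hθ]
    exact hlim
  · intro k P _ _ hP
    simp only [LinearMap.comp_apply, hθ]
    have hc := spe_contraction G lab S e hβ hε (s k) hP (hpe k)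
    simp only at hc
    have hH : vech (s (k + 1)).H = (spe G lab S β e (s k) (T k)).θ := vech_unvech _
    rw [hH]
    rw [div_le_iff₀ (by positivity)] at hT₀
    have hTk : (T₀ : ℝ) ≤ T k := by exact_mod_cast hT k
    have hNδ : N ≤ δ * (1 + β * ε * T k) := by
      have : T₀ * (δ * (β * ε)) ≤ T k * (δ * (β * ε)) := by gcongr
      nlinarith
    have hpos : 0 < 1 + β * ε * T k := by positivity
    refine le_of_mul_le_mul_left (hc.trans ?_) hpos
    calc N * ‖vech (s k).H - _‖ ≤ δ * (1 + β * ε * T k) * ‖vech (s k).H - _‖ := by gcongr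
      _ = _ := by ring
  · intro k hcoer
    have hH : unvechLinear (vech (s (k + 1)).H) = (s (k + 1)).H :=
      congrArg unvech (vech_unvech (spe G lab S β e (s k) (T k)).θ)
    simp only [LinearMap.comp_apply, hH] at hcoer ⊢
    exact ⟨⟨_, _, patterned_eq_modes hd0 _ _⟩, improve_gain hd S _ _ (isUpdatable_of_coercive hd hcoer)⟩

end Readout

/-! ### The theorem: optimal gain and convergence of the run. -/

theorem mainTheorem1 {V : Type*} [Fintype V] [DecidableEq V] (G : SimpleGraph V)
    [DecidableRel G.Adj] {n m d : ℕ} (hn : 0 < n) (hm : 0 < m)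
    (hdG : d = G.maxDegree + 1) (hd : 2 ≤ d) (lab : Fin d ↪ V)
    (S : D3PI.Plant n m) (hctrl : IsControllable S.A S.B)
    (hQ₁ : S.Q₁.PosDef) (hQ₂ : S.Q₂.PosSemidef) (hR : S.R.PosDef)
    (hne : S.A ≠ 0 ∨ S.Q₂ ≠ 0)
    (K₁ : Matrix (Fin m) (Fin n) ℝ) (hK₁ : IsSchurStable (S.A + S.B * K₁)) :
    ∃ (Kstar Lstar : Matrix (Fin m) (Fin n) ℝ) (γstar τstar : ℝ),
      (∀ K : Matrix (Fin d × Fin m) (Fin d × Fin n) ℝ,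
        IsOptimalLQRGain (S.bigA d) (S.bigB d) (S.bigQ d) (S.bigR d) K ↔
          K = patterned d Kstar Lstar) ∧
      ∀ (H₀ : Matrix (D3PI.Idx d n m) (D3PI.Idx d n m) ℝ) (β ε : ℝ), 0 < β → 0 < ε →
        ∃ T₀ : ℕ, ∀ (x₁ : V → Fin n → ℝ) (e : ℕ → V → Fin m → ℝ) (T : ℕ → ℕ),
          (∀ k, T₀ ≤ T k) →
          (∀ k, D3PI.PersistentlyExcited G lab S β e ε (T k)
            (D3PI.run G hd lab S β e K₁ H₀ x₁ T k)) →
          Tendsto (fun k => (D3PI.run G hd lab S β e K₁ H₀ x₁ T k).K) atTop (𝓝 Kstar) ∧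
          Tendsto (fun k => (D3PI.run G hd lab S β e K₁ H₀ x₁ T k).L) atTop (𝓝 Lstar) ∧
          Tendsto (fun k => (D3PI.run G hd lab S β e K₁ H₀ x₁ T k).γ) atTop (𝓝 γstar) ∧
          Tendsto (fun k => (D3PI.run G hd lab S β e K₁ H₀ x₁ T k).τ) atTop (𝓝 τstar) := by
  have hd0 : d ≠ 0 := by omega
  have hQ := bigQ_posDef hd0 hQ₁ hQ₂
  have hR' : (S.bigR d).PosDef := bigR_posDef hR
  obtain ⟨Ka, Pa, ha⟩ := exists_isRiccati hQ₁ hR hK₁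
  obtain ⟨Kb, Pb, hb⟩ := exists_isRiccati (Qtilde_posDef (d := d) hQ₁ hQ₂) hR hK₁
  have hs := isRiccati_modes hd0 ha hb
  obtain ⟨H, hH⟩ : ∃ H, H = qMatrix (S.bigA d) (S.bigB d) (S.bigQ d) (S.bigR d) (modes d Pa Pb) :=
    ⟨_, rfl⟩
  have hHs : Hᵀ = H := by
    rw [hH]
    exact qMatrix_transpose hQ.posSemidef.transpose_eq hR'.posSemidef.transpose_eq
      hs.posSemidef.transpose_eq
  obtain ⟨-, h21, h22⟩ := qMatrix_blocks_modes (S := S) hd0 Pa Pb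
  have hY : patternize hd H.toBlocks₂₂ = S.bigR d + (S.bigB d)ᵀ * modes d Pa Pb * S.bigB d := by
    rw [hH, h22, patternize_modes, ← h22]
    rfl
  have hZ : patternize hd H.toBlocks₂₁ = (S.bigB d)ᵀ * modes d Pa Pb * S.bigA d := by
    rw [hH, h21, patternize_modes, ← h21]
    rfl
  have hYpd := posDef_hessian hR' hs.posSemidef (S.bigB d)
  have hupd : IsUpdatable hd H := isUpdatable_of_coercive hd fun u hu => by
    rw [hY]
    simpa using hYpd.dotProduct_mulVec_pos hu
  -- The four limits are the result of one update from the exact optimal parameter. Time and network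
  -- state do not affect these fields, so dummy values serve.
  obtain ⟨s, hsdef⟩ : ∃ s, s = D3PI.improve hd S 0 (0 : V → Fin n → ℝ) H := ⟨_, rfl⟩
  have hgain := improve_gain hd S 0 (0 : V → Fin n → ℝ) hupd
  rw [← hsdef, hY, hZ, ← hs.gain] at hgain
  have hK : patterned d s.K s.L = modes d Ka Kb := by
    have hu := (isUnit_iff_isUnit_det _).mp hYpd.isUnit
    rw [← nonsing_inv_mul_cancel_left _ (patterned d s.K s.L) hu, hgain,
      nonsing_inv_mul_cancel_left _ _ hu]
  have hKL : s.K - s.L = Kb := by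
    rw [patterned_eq_modes hd0] at hK
    simpa [disagreementMode_modes] using congrArg (disagreementMode hd) hK
  refine ⟨s.K, s.L, s.γ, s.τ, fun K => ?_, fun H₀ β ε hβ hε => ?_⟩
  · rw [hK]
    exact hs.isOptimalLQRGain_iff hQ hR' K
  obtain ⟨T₀, hT₀⟩ := run_estimate_tendsto G hd lab hQ₁ hQ₂ hR hK₁ hs H₀ hβ hε
  refine ⟨T₀, fun x₁ e T hT hpe => ?_⟩
  have hlim := hT₀ x₁ e T hT hpe
  rw [← hH] at hlim
  have hcont : Continuous (D3PI.unvech : (Sym2 (D3PI.Idx d n m) → ℝ) → _) :=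
    unvechLinear.continuous_of_finiteDimensional
  -- After the first evaluation every estimate is `unvech` of a vector, so convergence of the
  -- half-vectorizations lifts to the matrices; `H₀` itself may be asymmetric.
  have hHlim : Tendsto (fun k => (D3PI.run G hd lab S β e K₁ H₀ x₁ T (k + 1)).H) atTop (𝓝 H) := by
    have h1 := (hcont.tendsto _).comp ((tendsto_add_atTop_iff_nat 1).mpr hlim)
    rw [D3PI.unvech_vech hHs] at h1
    refine h1.congr fun k => ?_
    exact congrArg D3PI.unvech (D3PI.vech_unvech _)
  obtain ⟨cK, cL⟩ := continuousAt_improve_KL hd S 0 (0 : V → Fin n → ℝ) hupd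
  have hden := gammaDenominator_ne_zero (Pa := Pa) hd hQ₁ hQ₂ hR hne hb hKL
  rw [← hH, hsdef] at hden
  obtain ⟨cγ, cτ⟩ := continuousAt_improve_gamma hd S 0 (0 : V → Fin n → ℝ) hn hupd hden
  rw [hsdef]
  refine ⟨?_, ?_, ?_, ?_⟩
  · exact (tendsto_add_atTop_iff_nat 1).mp (cK.tendsto.comp hHlim)
  · exact (tendsto_add_atTop_iff_nat 1).mp (cL.tendsto.comp hHlim)
  · exact (tendsto_add_atTop_iff_nat 1).mp (cγ.tendsto.comp hHlim)
  · exact (tendsto_add_atTop_iff_nat 1).mp (cτ.tendsto.comp hHlim)
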